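/- Let $(a_n)_{n\ge 0}$ be a complex sequence with $\limsup_n |a_n|^{1/n}>0$ whose generating series $G(z)=\sum_{n\ge0} a_n z^n$ converges in a disk $|z|<\rho$, $\rho>0$. Let $\Lambda\subset\mathbb C$ be a finite set, and suppose that $G$ extends to a multivalued analytic function on $\mathbb C\setminus\Lambda$, i.e. that $G$ can be continued analytically along every path in $\mathbb C\setminus\Lambda$ that starts in the disk $|z|<\rho$. Suppose that this multivalued function has quasi-unipotent local monodromy with moderate growth: for every $p\in\Lambda$, every $\delta>0$ such that no other point of $\Lambda$ lies in $|z-p|<\delta$, and every branch $F$ of it on the universal covering of the punctured disk $0<|z-p|<\delta$, * the continuations of $F$ around $p$ span a finite-dimensional vector space, and all eigenvalues of the local monodromy (continuation once around $p$) on this space are roots of unity; * for every $A>0$ there are real constants $C,K$ and $\varepsilon>0$ with $|F(z)|\le C|z-p|^{-K}$ for $0<|z-p|<\varepsilon$, $|\arg(z-p)|\le A$. Then $(a_n)$ is a sequence of Nilsson type. That is, there are a finite set $S\subset\mathbb Q$, a natural number $d$, a real $r>0$, a finite set $M$ of complex numbers of absolute value $r$, and complex numbers $c_{\omega,\mu}$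 for $\omega\in\Omega=(S+\mathbb N)\times\{0,1,\dots,d\}$, $\mu\in M$, not all zero, such that, with $h_{\omega}(n)=(\log n)^{\beta}n^{-\alpha}$ for $\omega=(\alpha,\beta)$, and with $\Omega$ ordered by $(\alpha,\beta)<(\alpha',\beta')$ if and only if $\alpha<\alpha'$, or $\alpha=\alpha'$ and $\beta>\beta'$, for every $\omega\in\Omega$ $$\lim_{n\to\infty}\frac{1}{h_\omega(n)}\Bigl(a_n r^{-n}-\sum_{\omega'\le\omega}h_{\omega'}(n)\sum_{\mu\in M}c_{\omega',\mu}\,(\mu r^{-1})^n\Bigr)=0 .$$ -/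

import Mathlib

open Filter Topology
open scoped ENNReal

/-! ### Sequences of Nilsson type -/

/-- The index set `Ω = (S + ℕ) × {0, …, d}`. -/
def nilssonIndex (S : Finset ℚ) (d : ℕ) : Set (ℚ × ℕ) :=
  {ω | (∃ s ∈ S, ∃ k : ℕ, ω.1 = s + k) ∧ ω.2 ≤ d}

/-- The order on `Ω`: `(α', β') ≤ (α, β)` iff `α' < α`, or `α' = α` and `β ≤ β'`. -/
def NilssonLE (ω' ω : ℚ × ℕ) : Prop :=
  ω'.1 < ω.1 ∨ (ω'.1 = ω.1 ∧ ω.2 ≤ ω'.2)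

/-- Initial segments of `Ω` are finite. -/
theorem nilssonInitial_finite (S : Finset ℚ) (d : ℕ) (ω : ℚ × ℕ) :
    {ω' ∈ nilssonIndex S d | NilssonLE ω' ω}.Finite := by
  have h : (⋃ s ∈ S, (fun p : ℕ × ℕ => (s + (p.1 : ℚ), p.2)) ''
      ((Finset.range (⌊ω.1 - s⌋₊ + 1) ×ˢ Finset.range (d + 1) : Finset (ℕ × ℕ)) :
        Set (ℕ × ℕ))).Finite :=
    Set.Finite.biUnion S.finite_toSet fun s _ => (Finset.finite_toSet _).image _
  refine h.subset ?_
  rintro ⟨α, β⟩ ⟨⟨⟨s, hs, k, hk⟩, hβ⟩, hle⟩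
  simp only at hk hβ
  have hα : α ≤ ω.1 := by
    rcases hle with h1 | h1
    · exact h1.le
    · exact h1.1.le
  simp only [Set.mem_iUnion]
  refine ⟨s, hs, (k, β), ?_, by simp [hk]⟩
  have : k ≤ ⌊ω.1 - s⌋₊ := Nat.le_floor (by linarith)
  simp only [Finset.coe_product, Finset.coe_range, Set.mem_prod, Set.mem_Iio]
  omega

/-- The finite set of all `ω' ∈ Ω` with `ω' ≤ ω`. -/
noncomputable def nilssonInitial (S : Finset ℚ) (d : ℕ) (ω : ℚ × ℕ) : Finset (ℚ × ℕ) :=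
  (nilssonInitial_finite S d ω).toFinset

/-- The monomial `h_ω(n) = (log n)^β / n^α`, where `ω = (α, β)`. -/
noncomputable def nilssonMonomial (ω : ℚ × ℕ) (n : ℕ) : ℝ :=
  Real.log n ^ ω.2 / (n : ℝ) ^ (ω.1 : ℝ)

/-- The asymptotic expansion `a_n ∼ ∑_{ω ∈ Ω} h_ω(n) ∑_{μ ∈ Λ} c_{ω,μ} μ^n`, where all elements of
`Λ` have magnitude `r`; only the values of `c` on `Ω × Λ` play a role. -/
def HasNilssonExpansion (a : ℕ → ℂ) (S : Finset ℚ) (d : ℕ) (Λ : Finset ℂ) (r : ℝ)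
    (c : ℚ × ℕ → ℂ → ℂ) : Prop :=
  (∀ ω ∈ nilssonIndex S d,
    Tendsto (fun n : ℕ =>
      (a n * ((r : ℂ)⁻¹) ^ n -
        ∑ ω' ∈ nilssonInitial S d ω,
          (nilssonMonomial ω' n : ℂ) * ∑ μ ∈ Λ, c ω' μ * (μ * (r : ℂ)⁻¹) ^ n) *
        (1 / (nilssonMonomial ω n : ℂ))) atTop (𝓝 0)) ∧
  ∃ ω ∈ nilssonIndex S d, ∃ μ ∈ Λ, c ω μ ≠ 0

/-- A sequence is of Nilsson type if it has an asymptotic expansion as above for some `Ω`, some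
finite set `Λ` of complex numbers of equal magnitude `r > 0` and some coefficients. -/
def IsNilssonType (a : ℕ → ℂ) : Prop :=
  ∃ (S : Finset ℚ) (d : ℕ) (Λ : Finset ℂ) (r : ℝ) (c : ℚ × ℕ → ℂ → ℂ),
    0 < r ∧ (∀ μ ∈ Λ, ‖μ‖ = r) ∧ HasNilssonExpansion a S d Λ r c

/-! ### Multivalued analytic functions on the complement of a finite set -/

/-- `f` is an analytic continuation along the path `γ : [0, 1] → ℂ`: each `f t` represents a germ
of an analytic function at `γ t`, and for `s` close to `t` the germ of `f s` at `γ s` is the one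
given by `f t`. -/
def IsContinuationAlong (γ : ℝ → ℂ) (f : ℝ → ℂ → ℂ) : Prop :=
  ∀ t ∈ Set.Icc (0 : ℝ) 1, AnalyticAt ℂ (f t) (γ t) ∧
    ∀ᶠ s in 𝓝[Set.Icc (0 : ℝ) 1] t, f s =ᶠ[𝓝 (γ s)] f t

/-- `γ` restricts to a continuous path `[0, 1] → ℂ ∖ Λ` starting in the disk of radius `ρ` around
the origin. -/
def IsAdmissiblePath (Λ : Finset ℂ) (ρ : ℝ) (γ : ℝ → ℂ) : Prop :=
  ContinuousOn γ (Set.Icc 0 1) ∧ γ 0 ∈ Metric.ball (0 : ℂ) ρ ∧ ∀ t ∈ Set.Icc (0 : ℝ) 1, γ t ∉ Λ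

/-- `G`, given on the disk of radius `ρ` around the origin, extends to a multivalued analytic
function on `ℂ ∖ Λ`: it can be continued analytically along every path in `ℂ ∖ Λ` that starts in
the disk. -/
def ExtendsMultivalued (Λ : Finset ℂ) (ρ : ℝ) (G : ℂ → ℂ) : Prop :=
  ∀ γ : ℝ → ℂ, IsAdmissiblePath Λ ρ γ →
    ∃ f : ℝ → ℂ → ℂ, IsContinuationAlong γ f ∧ f 0 =ᶠ[𝓝 (γ 0)] G

/-- `φ` represents, near `z`, a branch of the multivalued function obtained from `G`. -/
def IsBranchAt (Λ : Finset ℂ) (ρ : ℝ) (G : ℂ → ℂ) (z : ℂ) (φ : ℂ → ℂ) : Prop :=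
  ∃ (γ : ℝ → ℂ) (f : ℝ → ℂ → ℂ), IsAdmissiblePath Λ ρ γ ∧ IsContinuationAlong γ f ∧
    f 0 =ᶠ[𝓝 (γ 0)] G ∧ γ 1 = z ∧ f 1 =ᶠ[𝓝 z] φ

/-! ### Local monodromy -/

/-- The half-plane `Re w < log δ`; through `w ↦ p + exp w` it is the universal covering of the
punctured disk `0 < |z - p| < δ`. -/
def logHalfPlane (δ : ℝ) : Set ℂ := {w | w.re < Real.log δ}

/-- The deck transformation `w ↦ w + 2πik` of the half-plane. -/
noncomputable def logShift (δ : ℝ) (k : ℤ) (w : logHalfPlane δ) : logHalfPlane δ :=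
  ⟨(w : ℂ) + k * (2 * Real.pi * Complex.I), by
    have hw := w.2
    simp only [logHalfPlane, Set.mem_ofPred_eq] at hw ⊢
    simpa using hw⟩

/-- The local monodromy: continuation once around the puncture, counterclockwise, acting on
functions on the universal covering of the punctured disk. -/
noncomputable def localMonodromy (δ : ℝ) : Module.End ℂ (logHalfPlane δ → ℂ) :=
  LinearMap.funLeft ℂ ℂ (logShift δ 1)

/-- `F` is a branch, near the point `p`, of the multivalued function obtained from `G`, written
in the coordinate `w = log (z - p)` on the universal covering of the punctured disk
`0 < |z - p| < δ`. -/
def IsLocalBranch (Λ : Finset ℂ) (ρ : ℝ) (G : ℂ → ℂ) (p : ℂ) (δ : ℝ) (F : ℂ → ℂ) : Prop :=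
  DifferentiableOn ℂ F (logHalfPlane δ) ∧
    ∃ w₀ ∈ logHalfPlane δ, ∃ φ : ℂ → ℂ, IsBranchAt Λ ρ G (p + Complex.exp w₀) φ ∧
      F =ᶠ[𝓝 w₀] fun w => φ (p + Complex.exp w)

/-- The space spanned by all continuations of `F` around the puncture. -/
noncomputable def determinations (δ : ℝ) (F : ℂ → ℂ) : Submodule ℂ (logHalfPlane δ → ℂ) :=
  Submodule.span ℂ (Set.range fun (k : ℤ) (w : logHalfPlane δ) => F (logShift δ k w))

/-- `F` has finite determination, and all eigenvalues of the local monodromy on the space spanned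
by its continuations are roots of unity. -/
def IsQuasiUnipotent (δ : ℝ) (F : ℂ → ℂ) : Prop :=
  FiniteDimensional ℂ (determinations δ F) ∧
    ∀ (μ : ℂ), ∀ v ∈ determinations δ F, v ≠ 0 → localMonodromy δ v = μ • v →
      ∃ N : ℕ, 0 < N ∧ μ ^ N = 1

/-- Moderate growth at the puncture: on every sector `|arg (z - p)| ≤ A` the function is bounded
by `C |z - p|^(-K)` for `z` close to `p`. -/
def HasModerateGrowth (δ : ℝ) (F : ℂ → ℂ) : Prop :=
  ∀ A : ℝ, ∃ C K ε : ℝ, 0 < ε ∧ ε ≤ δ ∧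
    ∀ w ∈ logHalfPlane ε, |w.im| ≤ A → ‖F w‖ ≤ C * Real.exp (-K * w.re)

/-- Quasi-unipotent local monodromy (at singularities of moderate growth): for every `p ∈ Λ` and
every punctured disk around `p` that contains no point of `Λ`, each branch there is
quasi-unipotent and of moderate growth. -/
def HasQuasiUnipotentLocalMonodromy (Λ : Finset ℂ) (ρ : ℝ) (G : ℂ → ℂ) : Prop :=
  ∀ p ∈ Λ, ∀ δ : ℝ, 0 < δ → (∀ q ∈ Λ, q ∈ Metric.ball p δ → q = p) →
    ∀ F : ℂ → ℂ, IsLocalBranch Λ ρ G p δ F → IsQuasiUnipotent δ F ∧ HasModerateGrowth δ F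

/-!
After rescaling, the circle of convergence of `∑ aₙ zⁿ` is the unit circle. At each of its
finitely many singular points `ζ`, finite determination and quasi-unipotence make the function
annihilated by a power of `T^N - 1`, with `T` the monodromy, so it is a polynomial in `log u`, `u
= 1 - z / ζ`, whose coefficients are invariant under `T^N`; moderate growth makes these
coefficients meromorphic in `u^(1/N)`. Darboux's method turns this into asymptotics of the
coefficients: subtracting finitely many terms `u^s (log u)^k` at each `ζ` leaves a function with
many bounded derivatives on the disk, hence with rapidly decaying coefficients.

The coefficients of `u^s (log u)^k` are read off from the binomial series `u^X` with `X = s + ε`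
in the algebra `ℂ[ε] / (ε^(k+1))`. After multiplication by `n^(1+X)` its coefficients satisfy a
first-order recurrence whose multiplier is `1 + O(n⁻²)`, analytic in `1 / n`, so they have an
expansion in powers of `1 / n`.

If all coefficients of the resulting expansion vanished, `(aₙ)` would decay rapidly, and the
function would have a Taylor expansion at each `ζ` along the radius. Uniqueness of expansions in
powers of `u` and `log u` then makes it analytic across the whole circle of convergence, which is
impossible.
-/

open Asymptotics

section Recurrence

lemma norm_le_of_norm_sub_le_sub {E : Type*} [NormedAddCommGroup E] {w : ℕ → E} {t : ℕ → ℝ}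
    {n₀ : ℕ} (hw : Tendsto w atTop (𝓝 0)) (ht : Tendsto t atTop (𝓝 0))
    (h : ∀ n ≥ n₀, ‖w (n + 1) - w n‖ ≤ t n - t (n + 1)) {n : ℕ} (hn : n₀ ≤ n) :
    ‖w n‖ ≤ t n := by
  have hanti : Antitone fun k => t (k + n) - ‖w (k + n)‖ := by
    refine antitone_nat_of_succ_le fun k => ?_
    have hstep := h (k + n) (by omega)
    have htri := norm_sub_norm_le (w (k + n)) (w (k + n + 1))
    rw [norm_sub_rev] at htri
    rw [Nat.add_right_comm]
    linarith
  have hlim : Tendsto (fun k => t (k + n) - ‖w (k + n)‖) atTop (𝓝 0) := by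
    simpa using ((tendsto_add_atTop_iff_nat n).mpr ht).sub
      ((tendsto_add_atTop_iff_nat n).mpr hw).norm
  simpa using hanti.le_of_tendsto hlim 0

lemma inv_pow_add_two_le (i : ℕ) {n : ℕ} (hn : n ≠ 0) :
    ((n : ℝ) ^ (i + 2))⁻¹ ≤
      2 ^ (i + 1) * (((n : ℝ) ^ (i + 1))⁻¹ - (((n + 1 : ℕ) : ℝ) ^ (i + 1))⁻¹) := by
  have hn1 : (1 : ℝ) ≤ n := by exact_mod_cast Nat.one_le_iff_ne_zero.mpr hn
  have : (0 : ℝ) < n := by linarith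
  have hgap : (n : ℝ) ^ i ≤ ((n + 1 : ℕ) : ℝ) ^ (i + 1) - n ^ (i + 1) := by
    have : (n : ℝ) ^ i ≤ ((n + 1 : ℕ) : ℝ) ^ i := by gcongr; omega
    rw [pow_succ, pow_succ]
    push_cast at this ⊢
    nlinarith
  have hle : ((n + 1 : ℕ) : ℝ) ^ (i + 1) ≤ 2 ^ (i + 1) * n ^ (i + 1) := by
    rw [← mul_pow]
    gcongr
    push_cast
    linarith
  have hpos : (0 : ℝ) < ((n + 1 : ℕ) : ℝ) ^ (i + 1) := by positivity
  rw [inv_sub_inv (by positivity) hpos.ne', ← mul_div_assoc, le_div_iff₀ (by positivity),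
    inv_mul_le_iff₀ (by positivity)]
  calc (n : ℝ) ^ (i + 1) * ((n + 1 : ℕ) : ℝ) ^ (i + 1)
      ≤ n ^ (i + 1) * (2 ^ (i + 1) * n ^ (i + 1)) := by gcongr
    _ = n ^ (i + 2) * (2 ^ (i + 1) * n ^ i) := by ring
    _ ≤ _ := by gcongr

lemma isBigO_inv_pow_of_sub {E : Type*} [NormedAddCommGroup E] {w : ℕ → E} {i : ℕ}
    (hw : Tendsto w atTop (𝓝 0))
    (h : (fun n => w (n + 1) - w n) =O[atTop] fun n => ((n : ℝ) ^ (i + 2))⁻¹) :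
    w =O[atTop] fun n => ((n : ℝ) ^ (i + 1))⁻¹ := by
  obtain ⟨C, hC0, hC⟩ := h.exists_nonneg
  obtain ⟨n₀, hn₀⟩ := eventually_atTop.mp (hC.bound.and (eventually_ne_atTop 0))
  refine IsBigO.of_bound (C * 2 ^ (i + 1)) (eventually_atTop.mpr ⟨n₀, fun n hn => ?_⟩)
  rw [Real.norm_of_nonneg (by positivity)]
  refine norm_le_of_norm_sub_le_sub (n₀ := n₀)
    (t := fun n => C * 2 ^ (i + 1) * ((n : ℝ) ^ (i + 1))⁻¹) hw ?_ (fun m hm => ?_) hn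
  · simpa [← inv_pow] using
      ((tendsto_inv_atTop_nhds_zero_nat (𝕜 := ℝ)).pow (i + 1)).const_mul (C * 2 ^ (i + 1))
  · obtain ⟨hbound, hm0⟩ := hn₀ m hm
    rw [Real.norm_of_nonneg (by positivity)] at hbound
    rw [← mul_sub, mul_assoc]
    exact hbound.trans (by gcongr; exact inv_pow_add_two_le i hm0)

lemma tendsto_of_recurrence {A : Type*} [NormedCommRing A] [NormOneClass A] [CompleteSpace A]
    {u a : ℕ → A} (hu : ∀ᶠ n in atTop, u (n + 1) = (1 + a n) * u n)
    (ha : Summable fun n => ‖a n‖) : ∃ L, Tendsto u atTop (𝓝 L) := by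
  obtain ⟨n₀, hn₀⟩ := eventually_atTop.mp hu
  have hprod (k : ℕ) : u (k + n₀) = (∏ i ∈ Finset.range k, (1 + a (i + n₀))) * u n₀ := by
    induction k with
    | zero => simp
    | succ k ih =>
      rw [Nat.add_right_comm, hn₀ _ (by omega), ih, Finset.prod_range_succ]
      ring
  have hmul := (multipliable_one_add_of_summable (f := fun n => a (n + n₀))
    ((summable_nat_add_iff n₀).mpr ha)).hasProd
  refine ⟨(∏' i, (1 + a (i + n₀))) * u n₀, (tendsto_add_atTop_iff_nat n₀).mp ?_⟩
  simpa only [hprod] using hmul.tendsto_prod_nat.mul_const (u n₀)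

lemma isBigO_inv_pow_of_recurrence {A : Type*} [NormedRing A] {w a b : ℕ → A} {I : ℕ}
    (hw : Tendsto w atTop (𝓝 0)) (hrec : ∀ᶠ n in atTop, w (n + 1) - w n = a n * w n + b n)
    (ha : a =O[atTop] fun n => ((n : ℝ) ^ 2)⁻¹)
    (hb : b =O[atTop] fun n => ((n : ℝ) ^ (I + 2))⁻¹) :
    w =O[atTop] fun n => ((n : ℝ) ^ (I + 1))⁻¹ := by
  suffices ∀ i ≤ I + 1, w =O[atTop] fun n => ((n : ℝ) ^ i)⁻¹ from this _ le_rfl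
  intro i
  induction i with
  | zero => exact fun _ => by simpa using hw.isBigO_one ℝ
  | succ i ih =>
    intro hi
    refine isBigO_inv_pow_of_sub hw (IsBigO.congr' (IsBigO.add ?_ (hb.trans ?_))
      (hrec.mono fun n hn => hn.symm) EventuallyEq.rfl)
    · refine (ha.mul (ih (by omega))).congr_right fun n => ?_
      rw [← mul_inv, ← pow_add, add_comm]
    · refine IsBigO.of_bound' ((eventually_ne_atTop 0).mono fun n hn => ?_)
      have hn1 : (1 : ℝ) ≤ n := by exact_mod_cast Nat.one_le_iff_ne_zero.mpr hn
      rw [Real.norm_of_nonneg (by positivity), Real.norm_of_nonneg (by positivity)]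
      exact inv_anti₀ (by positivity) (pow_le_pow_right₀ hn1 (by omega))

lemma analyticAt_dslope {E : Type*} [NormedAddCommGroup E] [NormedSpace ℂ E] {f : ℂ → E} {z : ℂ}
    (hf : AnalyticAt ℂ f z) : AnalyticAt ℂ (dslope f z) z := by
  obtain ⟨p, hp⟩ := hf
  exact hp.has_fpower_series_dslope_fslope.analyticAt

lemma eq_smul_dslope_zero {E : Type*} [NormedAddCommGroup E] [NormedSpace ℂ E] {f : ℂ → E}
    (hf : f 0 = 0) (y : ℂ) : f y = y • dslope f 0 y := by
  simpa [hf] using (sub_smul_dslope f 0 y).symm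

lemma isBigO_inv_pow_smul {E : Type*} [NormedAddCommGroup E] [NormedSpace ℂ E] {h : ℂ → E}
    (hh : AnalyticAt ℂ h 0) (j : ℕ) :
    (fun n : ℕ => ((n : ℂ)⁻¹) ^ j • h ((n : ℂ)⁻¹)) =O[atTop] fun n : ℕ => ((n : ℝ) ^ j)⁻¹ := by
  have hpow : (fun n : ℕ => ((n : ℂ)⁻¹) ^ j) =O[atTop] fun n : ℕ => ((n : ℝ) ^ j)⁻¹ :=
    IsBigO.of_bound' (Eventually.of_forall fun n => by simp)
  have hbdd : (fun n : ℕ => h ((n : ℂ)⁻¹)) =O[atTop] fun _ => (1 : ℝ) :=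
    (hh.continuousAt.tendsto.comp tendsto_inv_atTop_nhds_zero_nat).isBigO_one ℝ
  simpa using hpow.smul hbdd

variable {A : Type*} [NormedCommRing A] [NormedAlgebra ℂ A]

/-- The error `g`, in `P (y / (1 + y)) - (1 + y² h y) P y = y ^ (I + 2) g y`, of the `I`-th
approximate solution `P = formalSolution h I` of the functional equation `P (y / (1 + y)) =
(1 + y² h y) P y`; for `y = 1 / n` this is the recurrence `u (n + 1) = (1 + y² h y) u n`. -/
noncomputable def formalDefect (h : ℂ → A) : ℕ → ℂ → A
  | 0 => -h
  | I + 1 => dslope (fun y => formalDefect h I y +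
      (dslope (fun y : ℂ => ((1 + y)⁻¹) ^ (I + 1)) 0 y • 1 - y • h y) *
        (((I : ℂ) + 1)⁻¹ • formalDefect h I 0)) 0

/-- The coefficient of `y ^ (I + 1)` in the formal solution, with constant term `1`, of
`P (y / (1 + y)) = (1 + y² h y) P y`. -/
noncomputable def formalCoeff (h : ℂ → A) (I : ℕ) : A :=
  ((I : ℂ) + 1)⁻¹ • formalDefect h I 0

/-- The truncation of the formal solution of `P (y / (1 + y)) = (1 + y² h y) P y` at degree `I`. -/
noncomputable def formalSolution (h : ℂ → A) (I : ℕ) (y : ℂ) : A :=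
  1 + ∑ i ∈ Finset.range I, y ^ (i + 1) • formalCoeff h i

lemma analyticAt_inv_one_add_pow (n : ℕ) : AnalyticAt ℂ (fun y : ℂ => ((1 + y)⁻¹) ^ n) 0 :=
  ((analyticAt_const.add analyticAt_id).inv (by simp)).pow n

lemma dslope_inv_one_add_pow (n : ℕ) :
    dslope (fun y : ℂ => ((1 + y)⁻¹) ^ (n + 1)) 0 0 = -((n : ℂ) + 1) := by
  have h : HasDerivAt (fun y : ℂ => (1 + y)⁻¹) (-1 / (1 + 0) ^ 2) 0 :=
    ((hasDerivAt_id (0 : ℂ)).const_add 1).inv (by simp)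
  rw [dslope_same, (h.fun_pow (n + 1)).deriv]
  simp

lemma analyticAt_formalDefect {h : ℂ → A} (hh : AnalyticAt ℂ h 0) (I : ℕ) :
    AnalyticAt ℂ (formalDefect h I) 0 := by
  induction I with
  | zero => exact hh.neg
  | succ I ih =>
    exact analyticAt_dslope (ih.add ((((analyticAt_dslope (analyticAt_inv_one_add_pow _)).smul
      analyticAt_const).sub (analyticAt_id.smul hh)).mul analyticAt_const))

lemma formalDefect_succ (h : ℂ → A) (I : ℕ) (y : ℂ) :
    y • formalDefect h (I + 1) y = formalDefect h I y +
      (dslope (fun y : ℂ => ((1 + y)⁻¹) ^ (I + 1)) 0 y • 1 - y • h y) * formalCoeff h I := by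
  have hI : (I : ℂ) + 1 ≠ 0 := by exact_mod_cast I.succ_ne_zero
  refine (eq_smul_dslope_zero ?_ y).symm
  rw [dslope_inv_one_add_pow, zero_smul, sub_zero, smul_one_mul, smul_smul, neg_mul,
    mul_inv_cancel₀ hI, neg_one_smul, add_neg_cancel]

lemma formalSolution_succ (h : ℂ → A) (I : ℕ) (y : ℂ) :
    formalSolution h (I + 1) y = formalSolution h I y + y ^ (I + 1) • formalCoeff h I := by
  rw [formalSolution, Finset.sum_range_succ, ← add_assoc, formalSolution]

lemma formalSolution_sub (h : ℂ → A) (I : ℕ) (y : ℂ) :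
    formalSolution h I (y / (1 + y)) - (1 + y ^ 2 • h y) * formalSolution h I y =
      y ^ (I + 2) • formalDefect h I y := by
  induction I with
  | zero => simp [formalSolution, formalDefect]
  | succ I ih =>
    set k := dslope (fun y : ℂ => ((1 + y)⁻¹) ^ (I + 1)) 0 y with hk
    have hpow : (y / (1 + y)) ^ (I + 1) = y ^ (I + 1) * (1 + y * k) := by
      have := sub_smul_dslope (fun y : ℂ => ((1 + y)⁻¹) ^ (I + 1)) 0 y
      simp only [sub_zero, smul_eq_mul, add_zero, inv_one, one_pow, ← hk] at this
      rw [div_eq_mul_inv, mul_pow, this]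
      ring
    rw [formalSolution_succ, formalSolution_succ, hpow, add_right_comm I 1 2, pow_succ y (I + 2),
      mul_smul (y ^ (I + 2)) y, formalDefect_succ, smul_add, ← ih, ← hk]
    simp only [Algebra.smul_def, map_mul, map_add, map_pow, map_one]
    ring

/-- The asymptotic expansion `u n ∼ ∑ i, e i / n ^ i`. -/
def HasInvPowExpansion (u e : ℕ → A) : Prop :=
  ∀ I : ℕ, (fun n : ℕ => u n - ∑ i ∈ Finset.range I, ((n : ℂ)⁻¹) ^ i • e i) =O[atTop]
    fun n : ℕ => ((n : ℝ) ^ I)⁻¹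

lemma isBigO_sub_formalSolution_mul {h : ℂ → A} (hh : AnalyticAt ℂ h 0) {u : ℕ → A} {L : A}
    (hu : ∀ᶠ n : ℕ in atTop, u (n + 1) = (1 + ((n : ℂ)⁻¹) ^ 2 • h ((n : ℂ)⁻¹)) * u n)
    (hL : Tendsto u atTop (𝓝 L)) (I : ℕ) :
    (fun n : ℕ => u n - formalSolution h I ((n : ℂ)⁻¹) * L) =O[atTop]
      fun n : ℕ => ((n : ℝ) ^ (I + 1))⁻¹ := by
  have hcont : Continuous (formalSolution h I) := by
    unfold formalSolution
    fun_prop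
  have hlim : Tendsto (fun n : ℕ => formalSolution h I ((n : ℂ)⁻¹)) atTop (𝓝 1) := by
    have h0 : formalSolution h I 0 = 1 := by simp [formalSolution]
    exact h0 ▸ (hcont.tendsto 0).comp tendsto_inv_atTop_nhds_zero_nat
  have hdefect := (isBigO_inv_pow_smul (analyticAt_formalDefect hh I) (I + 2)).mul
    (isBigO_const_const (-L) (one_ne_zero (α := ℝ)) atTop)
  refine isBigO_inv_pow_of_recurrence
    (b := fun n => ((n : ℂ)⁻¹) ^ (I + 2) • formalDefect h I ((n : ℂ)⁻¹) * -L)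
    (by simpa using hL.sub (hlim.mul_const L)) ?_ (isBigO_inv_pow_smul hh 2)
    (hdefect.congr_right fun n => mul_one _)
  filter_upwards [hu, eventually_ne_atTop 0] with n hn hn0
  have hshift : ((n + 1 : ℕ) : ℂ)⁻¹ = (n : ℂ)⁻¹ / (1 + (n : ℂ)⁻¹) := by
    have h0 : (n : ℂ) ≠ 0 := by exact_mod_cast hn0
    have h1 : (n : ℂ) + 1 ≠ 0 := by exact_mod_cast n.succ_ne_zero
    push_cast
    field_simp
  rw [hshift, hn, ← formalSolution_sub]
  ring

theorem exists_hasInvPowExpansion_of_recurrence [NormOneClass A] [CompleteSpace A] {h : ℂ → A}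
    (hh : AnalyticAt ℂ h 0) {u : ℕ → A}
    (hu : ∀ᶠ n : ℕ in atTop, u (n + 1) = (1 + ((n : ℂ)⁻¹) ^ 2 • h ((n : ℂ)⁻¹)) * u n) :
    ∃ e : ℕ → A, HasInvPowExpansion u e := by
  obtain ⟨L, hL⟩ := tendsto_of_recurrence hu (summable_of_isBigO_nat
    (Real.summable_nat_pow_inv.mpr one_lt_two) (isBigO_inv_pow_smul hh 2).norm_left)
  refine ⟨fun i => Nat.casesOn i L fun j => formalCoeff h j * L, fun I => ?_⟩
  rcases I with _ | I
  · simpa using hL.isBigO_one ℝ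
  · refine (isBigO_sub_formalSolution_mul hh hu hL I).congr_left fun n => ?_
    rw [Finset.sum_range_succ', formalSolution, add_mul, Finset.sum_mul]
    simp [add_comm]

end Recurrence

/-! ### Binomial coefficients in a commutative Banach algebra -/

section BanachBinomial

variable {A : Type*} [NormedCommRing A] [NormedAlgebra ℂ A]

/-- The coefficient of `z ^ n` in `(1 - z) ^ (X - 1)`. -/
noncomputable def binomCoeff (X : A) (n : ℕ) : A :=
  ∏ j ∈ Finset.range n, (1 - ((j : ℂ) + 1)⁻¹ • X)

/-- The ratio `n ^ X * (1 - X / n) / (n - 1) ^ X`, in terms of `y = 1 / (n - 1)`. -/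
noncomputable def binomRatio (X : A) (y : ℂ) : A :=
  (1 - (y / (1 + y)) • X) * NormedSpace.exp (Complex.log (1 + y) • X)

lemma exists_eq_add_sq_smul {E : Type*} [NormedAddCommGroup E] [NormedSpace ℂ E] {f : ℂ → E}
    (hf : AnalyticAt ℂ f 0) (hf' : deriv f 0 = 0) :
    ∃ h : ℂ → E, AnalyticAt ℂ h 0 ∧ ∀ y, f y = f 0 + y ^ 2 • h y := by
  refine ⟨dslope (dslope f 0) 0, analyticAt_dslope (analyticAt_dslope hf), fun y => ?_⟩
  have h := sub_smul_dslope f 0 y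
  rw [eq_smul_dslope_zero (f := dslope f 0) (by rw [dslope_same, hf']), sub_zero, smul_smul,
    ← pow_two] at h
  rw [h, add_sub_cancel]

lemma one_sub_mem_slitPlane {z : ℂ} (hz : z ∈ Metric.ball (0 : ℂ) 1) :
    1 - z ∈ Complex.slitPlane := by
  simpa [sub_eq_add_neg] using Complex.mem_slitPlane_of_norm_lt_one (z := -z) (by simpa using hz)

lemma inv_smul_prod_sub_eq_binomCoeff (x : A) (n : ℕ) :
    (n.factorial : ℂ)⁻¹ • ∏ j ∈ Finset.range n, ((j : ℂ) • (1 : A) - x) =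
      binomCoeff (1 + x) n := by
  rw [binomCoeff]
  induction n with
  | zero => simp
  | succ n ih =>
    have hn : (n : ℂ) + 1 ≠ 0 := by exact_mod_cast Nat.succ_ne_zero n
    have hfactor : 1 - ((n : ℂ) + 1)⁻¹ • (1 + x) = ((n : ℂ) + 1)⁻¹ • ((n : ℂ) • (1 : A) - x) := by
      rw [eq_inv_smul_iff₀ hn, smul_sub, smul_inv_smul₀ hn, add_smul, one_smul]
      abel
    rw [Finset.prod_range_succ, Finset.prod_range_succ, ← ih, Nat.factorial_succ, Nat.cast_mul,
      mul_inv_rev, hfactor, smul_mul_smul_comm]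
    push_cast
    rfl

variable [CompleteSpace A]

lemma exp_add_complex (x y : A) :
    NormedSpace.exp (x + y) = NormedSpace.exp x * NormedSpace.exp y := by
  let _ := NormedAlgebra.restrictScalars ℚ ℂ A
  exact NormedSpace.exp_add

lemma analyticAt_exp_smul (x : A) {f : ℂ → ℂ} {y : ℂ} (hf : AnalyticAt ℂ f y) :
    AnalyticAt ℂ (fun z => NormedSpace.exp (f z • x)) y :=
  AnalyticAt.fun_comp (f := fun z => f z • x) (NormedSpace.exp_analytic (𝕂 := ℂ) (f y • x))
    (hf.smul analyticAt_const)

lemma hasDerivAt_exp_smul (x : A) {f : ℂ → ℂ} {f' y : ℂ} (hf : HasDerivAt f f' y) :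
    HasDerivAt (fun z => NormedSpace.exp (f z • x))
      (f' • (NormedSpace.exp (f y • x) * x)) y :=
  HasDerivAt.scomp y (hasDerivAt_exp_smul_const (𝕂 := ℂ) x (f y)) hf

lemma analyticAt_binomRatio (X : A) : AnalyticAt ℂ (binomRatio X) 0 := by
  have hadd : AnalyticAt ℂ (fun y : ℂ => 1 + y) 0 := analyticAt_const.add analyticAt_id
  exact (analyticAt_const.sub ((analyticAt_id.div hadd (by simp)).smul analyticAt_const)).mul
    (analyticAt_exp_smul X (hadd.clog (by simp)))

lemma deriv_binomRatio (X : A) : deriv (binomRatio X) 0 = 0 := by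
  have hadd : HasDerivAt (fun y : ℂ => 1 + y) 1 0 := (hasDerivAt_id (0 : ℂ)).const_add 1
  have hdiv := (hasDerivAt_id (0 : ℂ)).div hadd (by simp)
  have hexp := hasDerivAt_exp_smul X (hadd.clog (by simp))
  refine HasDerivAt.deriv ((((hdiv.smul_const X).const_sub 1).mul hexp).congr_deriv ?_)
  simp

lemma exp_log_succ_mul (X : A) {n : ℕ} (hn : n ≠ 0) :
    NormedSpace.exp ((Real.log (n + 1 : ℕ) : ℂ) • X) * (1 - ((n : ℂ) + 1)⁻¹ • X) =
      binomRatio X ((n : ℂ)⁻¹) * NormedSpace.exp ((Real.log n : ℂ) • X) := by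
  have hn0 : (n : ℂ) ≠ 0 := by exact_mod_cast hn
  have hn1 : (n : ℂ) + 1 ≠ 0 := by exact_mod_cast Nat.succ_ne_zero n
  have hdiv : (n : ℂ)⁻¹ / (1 + (n : ℂ)⁻¹) = ((n : ℂ) + 1)⁻¹ := by field_simp
  have hlog : Complex.log (1 + (n : ℂ)⁻¹) = ((Real.log (n + 1 : ℕ) - Real.log n : ℝ) : ℂ) := by
    rw [← Real.log_div (by positivity) (by positivity), Complex.ofReal_log (by positivity)]
    congr 1
    push_cast
    field_simp
  rw [binomRatio, hdiv, hlog, mul_assoc, ← exp_add_complex, ← add_smul]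
  push_cast
  rw [sub_add_cancel, mul_comm]

lemma exists_hasInvPowExpansion_binomCoeff [NormOneClass A] (X : A) : ∃ e : ℕ → A,
    HasInvPowExpansion
      (fun n => NormedSpace.exp ((Real.log n : ℂ) • X) * binomCoeff X n) e := by
  obtain ⟨h, hh, hratio⟩ := exists_eq_add_sq_smul (analyticAt_binomRatio X) (deriv_binomRatio X)
  refine exists_hasInvPowExpansion_of_recurrence hh ?_
  filter_upwards [eventually_ne_atTop 0] with n hn
  have hone : binomRatio X 0 = 1 := by simp [binomRatio]
  rw [← hone, ← hratio, binomCoeff, Finset.prod_range_succ, ← binomCoeff, mul_left_comm,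
    exp_log_succ_mul X hn]
  ring

lemma iteratedDeriv_exp_log_smul (x : A) (n : ℕ) {z : ℂ} (hz : z ∈ Metric.ball (0 : ℂ) 1) :
    iteratedDeriv n (fun z => NormedSpace.exp (Complex.log (1 - z) • x)) z =
      (((1 - z)⁻¹) ^ n • ∏ j ∈ Finset.range n, ((j : ℂ) • (1 : A) - x)) *
        NormedSpace.exp (Complex.log (1 - z) • x) := by
  induction n generalizing z with
  | zero => simp
  | succ n ih =>
    have hslit := one_sub_mem_slitPlane hz
    have hne : 1 - z ≠ 0 := Complex.slitPlane_ne_zero hslit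
    rw [iteratedDeriv_succ, (eventuallyEq_of_mem (Metric.isOpen_ball.mem_nhds hz) fun w hw =>
      ih hw).deriv_eq]
    have hsub : HasDerivAt (fun z : ℂ => 1 - z) (-1) z := by
      simpa using (hasDerivAt_id z).const_sub 1
    have hpow : HasDerivAt (fun z : ℂ => ((1 - z)⁻¹) ^ n) (((1 - z)⁻¹) ^ (n + 1) * n) z := by
      refine ((hsub.fun_inv hne).fun_pow n).congr_deriv ?_
      rcases n with _ | n
      · simp
      · simp only [Nat.add_sub_cancel, neg_neg, one_div, ← inv_pow]
        ring
    have hprod := (hpow.smul_const (∏ j ∈ Finset.range n, ((j : ℂ) • (1 : A) - x))).mul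
      (hasDerivAt_exp_smul x (hsub.clog hslit))
    refine hprod.deriv.trans ?_
    rw [neg_div, one_div, Finset.prod_range_succ]
    simp only [Algebra.smul_def, map_mul, map_neg, map_pow, mul_one]
    ring

theorem hasSum_binomCoeff (x : A) {z : ℂ} (hz : z ∈ Metric.ball (0 : ℂ) 1) :
    HasSum (fun n => z ^ n • binomCoeff (1 + x) n)
      (NormedSpace.exp (Complex.log (1 - z) • x)) := by
  have hd : DifferentiableOn ℂ (fun z => NormedSpace.exp (Complex.log (1 - z) • x))
      (Metric.ball 0 1) := fun w hw =>
    (analyticAt_exp_smul x ((analyticAt_const.sub analyticAt_id).clog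
      (one_sub_mem_slitPlane hw))).differentiableAt.differentiableWithinAt
  refine (Complex.hasSum_taylorSeries_on_ball hd hz).congr_fun fun n => ?_
  rw [iteratedDeriv_exp_log_smul x n (Metric.mem_ball_self one_pos), smul_comm]
  simp [← inv_smul_prod_sub_eq_binomCoeff]

end BanachBinomial

/-! ### Truncated polynomials as a Banach algebra -/

section Jet

open Polynomial

/-- The algebra `ℂ[ε] / (ε ^ (k + 1))`; a jet with argument `s + ε` collects the derivatives with
respect to `s` of order at most `k`. -/
abbrev Jet (k : ℕ) : Type := AdjoinRoot (X ^ (k + 1) : ℂ[X])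

attribute [local instance] Matrix.linftyOpNormedRing Matrix.linftyOpNormedAlgebra

/-- The regular representation of the jets by matrices; it induces their norm. -/
noncomputable def jetMatrix (k : ℕ) :
    letI dim := (AdjoinRoot.powerBasis' (monic_X_pow (R := ℂ) (k + 1))).dim
    Jet k →ₐ[ℂ] Matrix (Fin dim) (Fin dim) ℂ :=
  Algebra.leftMulMatrix (AdjoinRoot.powerBasis' (monic_X_pow (R := ℂ) (k + 1))).basis

noncomputable instance jetNormedCommRing (k : ℕ) : NormedCommRing (Jet k) :=
  NormedCommRing.induced (Jet k) _ (jetMatrix k) (Algebra.leftMulMatrix_injective _)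

noncomputable instance jetNormedAlgebra (k : ℕ) : NormedAlgebra ℂ (Jet k) :=
  NormedAlgebra.induced ℂ (Jet k) _ (jetMatrix k)

instance jetNormOneClass (k : ℕ) : NormOneClass (Jet k) where
  norm_one := by
    have hdim : Nonempty (Fin (AdjoinRoot.powerBasis' (monic_X_pow (R := ℂ) (k + 1))).dim) :=
      ⟨⟨0, by simp⟩⟩
    have := Matrix.linfty_opNormOneClass (α := ℂ)
      (n := Fin (AdjoinRoot.powerBasis' (monic_X_pow (R := ℂ) (k + 1))).dim)
    change ‖jetMatrix k 1‖ = 1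
    rw [map_one, norm_one]

instance jetFiniteDimensional (k : ℕ) : FiniteDimensional ℂ (Jet k) :=
  (AdjoinRoot.powerBasis' (monic_X_pow (R := ℂ) (k + 1))).finite

instance jetCompleteSpace (k : ℕ) : CompleteSpace (Jet k) := FiniteDimensional.complete ℂ (Jet k)

/-- The generator `ε`, with `ε ^ (k + 1) = 0`. -/
noncomputable def jetEps (k : ℕ) : Jet k := AdjoinRoot.root _

/-- The coefficient of `ε ^ k`. -/
noncomputable def jetTop (k : ℕ) : Jet k →L[ℂ] ℂ :=
  LinearMap.toContinuousLinearMap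
    ((lcoeff ℂ k).comp (AdjoinRoot.modByMonicHom (monic_X_pow (R := ℂ) (k + 1))))

lemma jetEps_pow_of_lt {k l : ℕ} (h : k < l) : jetEps k ^ l = 0 := by
  have hpow : jetEps k ^ (k + 1) = 0 := by
    have h := AdjoinRoot.eval₂_root (X ^ (k + 1) : ℂ[X])
    simp only [eval₂_pow, eval₂_X] at h
    exact h
  exact pow_eq_zero_of_le h hpow

lemma jetTop_eps_pow (k l : ℕ) : jetTop k (jetEps k ^ l) = if l = k then 1 else 0 := by
  rcases lt_or_ge k l with h | h
  · rw [jetEps_pow_of_lt h, map_zero, if_neg h.ne']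
  · have hmk : jetEps k ^ l = AdjoinRoot.mk (X ^ (k + 1) : ℂ[X]) (X ^ l) := by simp [jetEps]
    have hdeg : (X ^ l : ℂ[X]).degree < (X ^ (k + 1) : ℂ[X]).degree := by
      rw [degree_X_pow, degree_X_pow]
      exact_mod_cast Nat.lt_succ_of_le h
    rw [hmk, jetTop, LinearMap.coe_toContinuousLinearMap', LinearMap.comp_apply,
      AdjoinRoot.modByMonicHom_mk, lcoeff_apply, (modByMonic_eq_self_iff (monic_X_pow _)).mpr hdeg,
      coeff_X_pow]
    simp [eq_comm]

lemma exp_smul_jetEps (k : ℕ) (t : ℂ) : NormedSpace.exp (t • jetEps k) =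
    ∑ l ∈ Finset.range (k + 1), ((l.factorial : ℂ)⁻¹ * t ^ l) • jetEps k ^ l := by
  refine (NormedSpace.exp_series_hasSum_exp' (𝕂 := ℂ) (t • jetEps k)).unique ?_
  simp only [_root_.smul_pow, smul_smul]
  exact hasSum_sum_of_ne_finset_zero fun l hl => by
    rw [jetEps_pow_of_lt (by simpa using hl), smul_zero]

lemma exp_smul_add_jetEps (k : ℕ) (t s : ℂ) :
    NormedSpace.exp (t • (s • (1 : Jet k) + jetEps k)) =
      Complex.exp (t * s) • ∑ l ∈ Finset.range (k + 1),
        ((l.factorial : ℂ)⁻¹ * t ^ l) • jetEps k ^ l := by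
  rw [smul_add, exp_add_complex, smul_smul, ← Algebra.algebraMap_eq_smul_one,
    ← NormedSpace.algebraMap_exp_comm, ← Complex.exp_eq_exp_ℂ, exp_smul_jetEps,
    ← Algebra.smul_def]

end Jet

/-! ### Coefficients of `(1 - z) ^ s * log (1 - z) ^ k` -/

section Coefficients

/-- The exponent `s + ε` whose power `(1 - z) ^ (s + ε)` is the jet of `s ↦ (1 - z) ^ s`. -/
noncomputable def jetPoint (s : ℝ) (k : ℕ) : Jet k := (s : ℂ) • 1 + jetEps k

/-- The coefficient of `z ^ n` in `(1 - z) ^ s * log (1 - z) ^ k`. -/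
noncomputable def logCoeff (s : ℝ) (k n : ℕ) : ℂ :=
  k.factorial * jetTop k (binomCoeff (1 + jetPoint s k) n)

/-- The product `n ^ (1 + s + ε) * binomCoeff (1 + s + ε) n`, which has a limit. -/
noncomputable def normCoeff (s : ℝ) (k n : ℕ) : Jet k :=
  NormedSpace.exp ((Real.log n : ℂ) • (1 + jetPoint s k)) * binomCoeff (1 + jetPoint s k) n

theorem hasSum_logCoeff (s : ℝ) (k : ℕ) {z : ℂ} (hz : z ∈ Metric.ball (0 : ℂ) 1) :
    HasSum (fun n => logCoeff s k n * z ^ n)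
      (Complex.log (1 - z) ^ k * Complex.exp (s * Complex.log (1 - z))) := by
  have hsum := ((hasSum_binomCoeff (jetPoint s k) hz).mapL (jetTop k)).mul_left (k.factorial : ℂ)
  have hk : (k.factorial : ℂ) ≠ 0 := by exact_mod_cast k.factorial_ne_zero
  have hvalue : (k.factorial : ℂ) * jetTop k (NormedSpace.exp (Complex.log (1 - z) •
      jetPoint s k)) = Complex.log (1 - z) ^ k * Complex.exp (s * Complex.log (1 - z)) := by
    rw [jetPoint, exp_smul_add_jetEps, map_smul, map_sum]
    simp only [map_smul, jetTop_eps_pow, smul_eq_mul, mul_ite, mul_one, mul_zero,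
      Finset.sum_ite_eq', Finset.mem_range, Nat.lt_succ_self, if_true]
    rw [mul_comm (s : ℂ)]
    field_simp
  rw [hvalue] at hsum
  refine hsum.congr_fun fun n => ?_
  rw [logCoeff, map_smul, smul_eq_mul, mul_assoc, mul_comm (z ^ n)]

lemma exp_neg_log_smul (s : ℝ) (k : ℕ) {n : ℕ} (hn : n ≠ 0) :
    NormedSpace.exp (-(Real.log n : ℂ) • (1 + jetPoint s k)) =
      ((((n : ℝ) ^ (s + 1))⁻¹ : ℝ) : ℂ) • ∑ l ∈ Finset.range (k + 1),
        ((l.factorial : ℂ)⁻¹ * (-(Real.log n : ℂ)) ^ l) • jetEps k ^ l := by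
  have hpoint : (1 : Jet k) + jetPoint s k = ((s + 1 : ℝ) : ℂ) • 1 + jetEps k := by
    rw [jetPoint]
    push_cast
    rw [add_smul, one_smul]
    abel
  have hexp : Complex.exp (-(Real.log n : ℂ) * ((s + 1 : ℝ) : ℂ)) =
      (((n : ℝ) ^ (s + 1))⁻¹ : ℝ) := by
    rw [Real.rpow_def_of_pos (by positivity), ← Real.exp_neg]
    push_cast
    ring_nf
  rw [hpoint, exp_smul_add_jetEps, hexp]

lemma logCoeff_eq_sum (s : ℝ) (k : ℕ) {n : ℕ} (hn : n ≠ 0) :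
    logCoeff s k n = ((n : ℝ) ^ (s + 1))⁻¹ • ∑ l ∈ Finset.range (k + 1),
      ((Real.log n : ℂ) ^ l) • ((k.factorial * (l.factorial : ℂ)⁻¹ * (-1) ^ l) *
        jetTop k (jetEps k ^ l * normCoeff s k n)) := by
  have hbinom : binomCoeff (1 + jetPoint s k) n =
      NormedSpace.exp (-(Real.log n : ℂ) • (1 + jetPoint s k)) * normCoeff s k n := by
    rw [normCoeff, ← mul_assoc, ← exp_add_complex, ← add_smul]
    simp
  rw [logCoeff, hbinom, exp_neg_log_smul s k hn, smul_mul_assoc, Finset.sum_mul,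
    map_smul (jetTop k), map_sum, smul_eq_mul, mul_left_comm, Finset.mul_sum, Complex.real_smul]
  congr 1
  refine Finset.sum_congr rfl fun l _ => ?_
  rw [smul_mul_assoc, map_smul, smul_eq_mul, smul_eq_mul, neg_pow]
  ring

lemma isBigO_log_pow_smul {E : Type*} [NormedAddCommGroup E] [NormedSpace ℂ E] {r : ℕ → E}
    {g : ℕ → ℝ} {l k : ℕ} (hl : l ≤ k) (hr : r =O[atTop] g) :
    (fun n : ℕ => ((Real.log n : ℂ) ^ l) • r n) =O[atTop] fun n : ℕ => Real.log n ^ k * g n := by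
  have hpow : (fun n : ℕ => (Real.log n : ℂ) ^ l) =O[atTop] fun n : ℕ => Real.log n ^ k := by
    have hlog : ∀ᶠ n : ℕ in atTop, 1 ≤ Real.log n :=
      (Real.tendsto_log_atTop.comp tendsto_natCast_atTop_atTop).eventually_ge_atTop 1
    refine IsBigO.of_bound' (hlog.mono fun n hn => ?_)
    rw [norm_pow, Complex.norm_real, norm_pow, Real.norm_of_nonneg (by linarith)]
    exact pow_le_pow_right₀ hn hl
  exact hpow.smul hr

theorem exists_logCoeff_expansion (s : ℝ) (k : ℕ) : ∃ e : ℕ → ℕ → ℂ, ∀ I : ℕ,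
    (fun n : ℕ => logCoeff s k n - ∑ i ∈ Finset.range I, ∑ l ∈ Finset.range (k + 1),
      e i l * ((Real.log n ^ l / (n : ℝ) ^ (s + 1 + i) : ℝ) : ℂ)) =O[atTop]
        fun n : ℕ => Real.log n ^ k / (n : ℝ) ^ (s + 1 + I) := by
  obtain ⟨e, he⟩ : ∃ e, HasInvPowExpansion (normCoeff s k) e :=
    exists_hasInvPowExpansion_binomCoeff (1 + jetPoint s k)
  let c : ℕ → ℂ := fun l => k.factorial * (l.factorial : ℂ)⁻¹ * (-1) ^ l
  refine ⟨fun i l => c l * jetTop k (jetEps k ^ l * e i), fun I => ?_⟩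
  have hremainder : (fun n : ℕ => ((n : ℝ) ^ (s + 1))⁻¹ • ∑ l ∈ Finset.range (k + 1),
      ((Real.log n : ℂ) ^ l) • (c l * jetTop k (jetEps k ^ l * (normCoeff s k n -
        ∑ i ∈ Finset.range I, ((n : ℂ)⁻¹) ^ i • e i)))) =O[atTop]
      fun n : ℕ => ((n : ℝ) ^ (s + 1))⁻¹ * (Real.log n ^ k * ((n : ℝ) ^ I)⁻¹) := by
    refine (isBigO_refl (fun n : ℕ => ((n : ℝ) ^ (s + 1))⁻¹) _).smul (IsBigO.fun_sum fun l hl => ?_)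
    refine isBigO_log_pow_smul (Finset.mem_range_succ_iff.mp hl) (IsBigO.const_mul_left ?_ _)
    refine ((jetTop k).isBigO_comp _ _).trans ?_
    simpa using (isBigO_const_const (jetEps k ^ l) (one_ne_zero (α := ℝ)) atTop).mul (he I)
  refine hremainder.congr' ?_ ?_
  · filter_upwards [eventually_ne_atTop 0] with n hn
    have hn' : (0 : ℝ) < n := by positivity
    rw [logCoeff_eq_sum s k hn, Finset.sum_comm, Finset.smul_sum, Finset.smul_sum,
      ← Finset.sum_sub_distrib]
    refine Finset.sum_congr rfl fun l _ => ?_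
    rw [mul_sub, map_sub, Finset.mul_sum, map_sum, mul_sub, smul_sub, smul_sub, Finset.mul_sum,
      Finset.smul_sum, Finset.smul_sum]
    congr 1
    refine Finset.sum_congr rfl fun i _ => ?_
    rw [mul_smul_comm _ (jetEps k ^ l), map_smul (jetTop k), Real.rpow_add hn' (s + 1),
      Real.rpow_natCast, Complex.real_smul, smul_eq_mul, smul_eq_mul, inv_pow]
    push_cast
    field_simp
  · filter_upwards [eventually_ne_atTop 0] with n hn
    rw [Real.rpow_add (by positivity) (s + 1), Real.rpow_natCast]
    field_simp

end Coefficients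

/-! ### Quasi-unipotent functions of moderate growth on a half-plane -/

section HalfPlane

/-- The filter of going to infinity to the left in the strip `|Im w| ≤ A`. -/
def stripEnd (A : ℝ) : Filter ℂ := comap Complex.re atBot ⊓ 𝓟 {w | |w.im| ≤ A}

theorem eventually_stripEnd_iff {A : ℝ} {p : ℂ → Prop} :
    (∀ᶠ w in stripEnd A, p w) ↔ ∃ x : ℝ, ∀ w : ℂ, w.re < x → |w.im| ≤ A → p w := by
  rw [stripEnd, ((atBot_basis_Iio.comap Complex.re).inf_principal _).eventually_iff]
  simp

theorem tendsto_mul_add_stripEnd {a : ℝ} (ha : 0 < a) (κ : ℂ) (A : ℝ) :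
    Tendsto (fun w : ℂ => a * w + κ) (stripEnd A) (stripEnd (a * A + |κ.im|)) := by
  refine fun s hs => ?_
  obtain ⟨x, hx⟩ := eventually_stripEnd_iff.mp hs
  refine eventually_stripEnd_iff.mpr ⟨(x - κ.re) / a, fun w hw hA => hx _ ?_ ?_⟩
  · rw [lt_div_iff₀ ha] at hw
    simp only [Complex.add_re, Complex.re_ofReal_mul]
    linarith
  · simp only [Complex.add_im, Complex.im_ofReal_mul]
    refine (abs_add_le _ _).trans ?_
    rw [abs_mul, abs_of_pos ha]
    gcongr

theorem isBigO_exp_re_stripEnd (A : ℝ) {K K' : ℝ} (h : K ≤ K') :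
    (fun w : ℂ => Real.exp (-K * w.re)) =O[stripEnd A] fun w => Real.exp (-K' * w.re) := by
  refine IsBigO.of_bound' (eventually_stripEnd_iff.mpr ⟨0, fun w hw _ => ?_⟩)
  rw [Real.norm_eq_abs, Real.norm_eq_abs, Real.abs_exp, Real.abs_exp, Real.exp_le_exp]
  nlinarith

theorem isBigO_id_stripEnd (A : ℝ) :
    (fun w : ℂ => w) =O[stripEnd A] fun w => Real.exp (-1 * w.re) := by
  refine IsBigO.of_bound (1 + |A|) (eventually_stripEnd_iff.mpr ⟨0, fun w hre him => ?_⟩)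
  rw [Real.norm_eq_abs, Real.abs_exp]
  have hexp := Real.add_one_le_exp (-1 * w.re)
  have hnorm := Complex.norm_le_abs_re_add_abs_im w
  rw [abs_of_neg hre] at hnorm
  nlinarith [abs_nonneg A, le_abs_self A]

/-- The algebra of functions that are holomorphic on the half-plane `Re w < c` and of moderate
growth in `exp w`: bounded on every horizontal strip by a power of `exp (-Re w)`. -/
def moderateAlgebra (c : ℝ) : Subalgebra ℂ (ℂ → ℂ) where
  carrier := {f | DifferentiableOn ℂ f {w | w.re < c} ∧
    ∀ A : ℝ, ∃ K : ℝ, f =O[stripEnd A] fun w => Real.exp (-K * w.re)}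
  mul_mem' := by
    rintro f g ⟨hfd, hf⟩ ⟨hgd, hg⟩
    refine ⟨hfd.mul hgd, fun A => ?_⟩
    obtain ⟨K, hK⟩ := hf A
    obtain ⟨L, hL⟩ := hg A
    refine ⟨K + L, (hK.mul hL).congr_right fun w => ?_⟩
    rw [← Real.exp_add]
    ring_nf
  add_mem' := by
    rintro f g ⟨hfd, hf⟩ ⟨hgd, hg⟩
    refine ⟨hfd.add hgd, fun A => ?_⟩
    obtain ⟨K, hK⟩ := hf A
    obtain ⟨L, hL⟩ := hg A
    exact ⟨max K L, (hK.trans (isBigO_exp_re_stripEnd A (le_max_left _ _))).add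
      (hL.trans (isBigO_exp_re_stripEnd A (le_max_right _ _)))⟩
  algebraMap_mem' a := ⟨differentiableOn_const a, fun A =>
    ⟨0, by simpa [Pi.algebraMap_def] using isBigO_const_const a (one_ne_zero (α := ℝ)) _⟩⟩

theorem id_mem_moderateAlgebra (c : ℝ) : (fun w => w) ∈ moderateAlgebra c :=
  ⟨differentiableOn_id, fun A => ⟨1, isBigO_id_stripEnd A⟩⟩

theorem comp_mul_add_mem_moderateAlgebra {a c c' : ℝ} (ha : 0 < a) {κ : ℂ}
    (hc : a * c' + κ.re ≤ c) {f : ℂ → ℂ} (hf : f ∈ moderateAlgebra c) :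
    (fun w => f (a * w + κ)) ∈ moderateAlgebra c' := by
  refine ⟨hf.1.comp (by fun_prop) fun w (hw : w.re < c') => ?_, fun A => ?_⟩
  · have := mul_lt_mul_of_pos_left hw ha
    simp only [Set.mem_ofPred_eq, Complex.add_re, Complex.re_ofReal_mul]
    linarith
  · obtain ⟨K, hK⟩ := hf.2 (a * A + |κ.im|)
    refine ⟨K * a, (hK.comp_tendsto (tendsto_mul_add_stripEnd ha κ A)).trans ?_⟩
    refine (isBigO_const_mul_self (Real.exp (-K * κ.re)) _ _).congr_left fun w => ?_
    simp only [Function.comp, Complex.add_re, Complex.re_ofReal_mul]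
    rw [← Real.exp_add]
    ring_nf

variable {c : ℝ} {τ : ℂ}

theorem fwdDiff_iter_mem_moderateAlgebra (hτ : τ.re = 0) {f : ℂ → ℂ}
    (hf : f ∈ moderateAlgebra c) (m : ℕ) : (fwdDiff τ)^[m] f ∈ moderateAlgebra c := by
  induction m with
  | zero => exact hf
  | succ m ih =>
    rw [Function.iterate_succ_apply']
    have hshift := comp_mul_add_mem_moderateAlgebra (κ := τ) (c' := c) one_pos (by simp [hτ]) ih
    simp only [Complex.ofReal_one, one_mul] at hshift
    exact sub_mem hshift ih

theorem fwdDiff_iter_mul_periodic (hτ : τ.re = 0) {u : ℂ → ℂ}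
    (hu : ∀ w : ℂ, w.re < c → u (w + τ) = u w) (p : ℂ → ℂ) (j : ℕ) {w : ℂ} (hw : w.re < c) :
    (fwdDiff τ)^[j] (p * u) w = (fwdDiff τ)^[j] p w * u w := by
  induction j generalizing w with
  | zero => rfl
  | succ j ih =>
    rw [Function.iterate_succ_apply', Function.iterate_succ_apply', fwdDiff, fwdDiff, ih hw,
      ih (by simpa [hτ] using hw), hu w hw]
    ring

theorem fwdDiff_iter_sub (f g : ℂ → ℂ) (j : ℕ) :
    (fwdDiff τ)^[j] (f - g) = (fwdDiff τ)^[j] f - (fwdDiff τ)^[j] g := by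
  simpa only [fwdDiff_aux.coe_fwdDiffₗ_pow] using map_sub (fwdDiff_aux.fwdDiffₗ ℂ ℂ τ ^ j) f g

theorem fwdDiff_iter_comp_mul (p : ℂ → ℂ) (j : ℕ) (t : ℂ) :
    (fwdDiff τ)^[j] p (τ * t) = (fwdDiff 1)^[j] (fun t => p (τ * t)) t := by
  induction j generalizing t with
  | zero => rfl
  | succ j ih =>
    simp only [Function.iterate_succ_apply', fwdDiff, ← ih, mul_add, mul_one]

theorem fwdDiff_iter_pow_self (hτ : τ ≠ 0) (m : ℕ) (w : ℂ) :
    (fwdDiff τ)^[m] (fun w => w ^ m) w = τ ^ m * m.factorial := by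
  have hpow : (fun t : ℂ => (τ * t) ^ m) = τ ^ m • fun t : ℂ => t ^ m := by
    ext t
    simp [mul_pow]
  rw [← mul_div_cancel₀ w hτ, fwdDiff_iter_comp_mul, hpow, fwdDiff_iter_const_smul,
    fwdDiff_iter_eq_factorial]
  simp

/-- The top difference `Δ ^ m f` is periodic, and `w ^ m` times a multiple of it can be subtracted
from `f` to lower the order of the difference equation. -/
theorem exists_periodic_decomposition (hτ : τ.re = 0) (hτ0 : τ ≠ 0) (m : ℕ) {f : ℂ → ℂ}
    (hf : f ∈ moderateAlgebra c) (h : ∀ w : ℂ, w.re < c → (fwdDiff τ)^[m] f w = 0) :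
    ∃ u : ℕ → ℂ → ℂ, (∀ k < m, u k ∈ moderateAlgebra c ∧
      ∀ w : ℂ, w.re < c → u k (w + τ) = u k w) ∧
      ∀ w : ℂ, w.re < c → f w = ∑ k ∈ Finset.range m, w ^ k * u k w := by
  induction m generalizing f with
  | zero => exact ⟨0, by simp, by simpa using h⟩
  | succ m ih =>
    set v : ℂ → ℂ := (τ ^ m * m.factorial : ℂ)⁻¹ • (fwdDiff τ)^[m] f with hv
    have hv_mem : v ∈ moderateAlgebra c :=
      (moderateAlgebra c).smul_mem (fwdDiff_iter_mem_moderateAlgebra hτ hf m) _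
    have hv_periodic : ∀ w : ℂ, w.re < c → v (w + τ) = v w := fun w hw => by
      have htop := h w hw
      rw [Function.iterate_succ_apply', fwdDiff, sub_eq_zero] at htop
      simp only [hv, Pi.smul_apply, htop]
    have hpow_mem : (fun w => w ^ m) ∈ moderateAlgebra c := pow_mem (id_mem_moderateAlgebra c) m
    have hlower : ∀ w : ℂ, w.re < c →
        (fwdDiff τ)^[m] (f - (fun w => w ^ m) * v) w = 0 := fun w hw => by
      have hne : τ ^ m * (m.factorial : ℂ) ≠ 0 :=
        mul_ne_zero (pow_ne_zero _ hτ0) (Nat.cast_ne_zero.mpr m.factorial_ne_zero)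
      rw [fwdDiff_iter_sub, Pi.sub_apply, fwdDiff_iter_mul_periodic hτ hv_periodic _ _ hw,
        fwdDiff_iter_pow_self hτ0, hv, Pi.smul_apply, smul_eq_mul, mul_inv_cancel_left₀ hne,
        sub_self]
    obtain ⟨u, hu, hfu⟩ := ih (sub_mem hf (mul_mem hpow_mem hv_mem)) hlower
    refine ⟨Function.update u m v, fun k hk => ?_, fun w hw => ?_⟩
    · rcases Nat.lt_succ_iff_lt_or_eq.mp hk with hk | rfl
      · simpa only [Function.update_of_ne hk.ne] using hu k hk
      · simpa only [Function.update_self] using ⟨hv_mem, hv_periodic⟩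
    · have hfw : f w = _ + w ^ m * v w := sub_eq_iff_eq_add.mp (hfu w hw)
      rw [Finset.sum_range_succ, Function.update_self, hfw]
      congr 1
      refine Finset.sum_congr rfl fun k hk => ?_
      rw [Function.update_of_ne (Finset.mem_range.mp hk).ne]

theorem isBigO_one_of_periodic {u : ℂ → ℂ} (hp : Function.Periodic u (2 * Real.pi * Complex.I))
    (hu : u =O[stripEnd (2 * Real.pi)] fun _ => (1 : ℝ)) :
    u =O[comap Complex.re atBot] fun _ => (1 : ℝ) := by
  obtain ⟨C, hC⟩ := hu.bound
  obtain ⟨x, hx⟩ := eventually_stripEnd_iff.mp hC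
  refine IsBigO.of_bound C ?_
  filter_upwards [preimage_mem_comap (Iio_mem_atBot x)] with w hw
  set n : ℤ := ⌊w.im / (2 * Real.pi)⌋
  have him : (w - n * (2 * Real.pi * Complex.I)).im =
      2 * Real.pi * Int.fract (w.im / (2 * Real.pi)) := by
    rw [Int.fract, mul_sub, mul_div_cancel₀ _ Real.two_pi_pos.ne']
    simp [n, mul_comm]
  rw [← hp.sub_int_mul_eq n]
  refine hx _ (by simpa using hw) ?_
  rw [him, abs_of_nonneg (mul_nonneg Real.two_pi_pos.le (Int.fract_nonneg _))]
  exact mul_le_of_le_one_right Real.two_pi_pos.le (Int.fract_lt_one _).le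

theorem exists_analyticAt_comp_exp_of_periodic {u : ℂ → ℂ}
    (hd : DifferentiableOn ℂ u {w | w.re < c})
    (hp : Function.Periodic u (2 * Real.pi * Complex.I))
    (hu : u =O[stripEnd (2 * Real.pi)] fun _ => (1 : ℝ)) :
    ∃ H : ℂ → ℂ, AnalyticAt ℂ H 0 ∧ ∀ w : ℂ, u w = H (Complex.exp w) := by
  set f : ℂ → ℂ := fun z => u (2 * Real.pi * Complex.I * z) with hf
  have hfp : Function.Periodic f ((1 : ℝ) : ℂ) := fun z => by
    simp only [hf, Complex.ofReal_one, mul_add, mul_one]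
    exact hp _
  have htend : Tendsto (fun z : ℂ => 2 * Real.pi * Complex.I * z) (comap Complex.im atTop)
      (comap Complex.re atBot) := by
    refine tendsto_comap_iff.mpr ?_
    refine (tendsto_comap.const_mul_atTop_of_neg (neg_neg_of_pos Real.two_pi_pos)).congr fun z => ?_
    simp
  have hholo : ∀ᶠ z in comap Complex.im atTop, DifferentiableAt ℂ f z := by
    filter_upwards [htend (preimage_mem_comap (Iio_mem_atBot c))] with z hz
    refine (hd.differentiableAt ?_).comp z (by fun_prop)
    exact (isOpen_lt Complex.continuous_re continuous_const).mem_nhds hz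
  have hbdd : BoundedAtFilter (comap Complex.im atTop) f :=
    ((isBigO_one_of_periodic hp hu).comp_tendsto htend)
  refine ⟨Function.Periodic.cuspFunction 1 f, ?_, fun w => ?_⟩
  · rw [Complex.analyticAt_iff_eventually_differentiableAt, ← nhdsNE_sup_pure, eventually_sup]
    exact ⟨Function.Periodic.eventually_differentiableAt_cuspFunction_nhds_ne_zero one_pos hfp
      hholo, Function.Periodic.differentiableAt_cuspFunction_zero one_pos hfp hholo hbdd⟩
  · have hcusp := Function.Periodic.eq_cuspFunction one_ne_zero hfp (w / (2 * Real.pi * Complex.I))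
    have hq : Function.Periodic.qParam 1 (w / (2 * Real.pi * Complex.I)) = Complex.exp w := by
      rw [Function.Periodic.qParam, Complex.ofReal_one, div_one,
        mul_div_cancel₀ _ Complex.two_pi_I_ne_zero]
    rw [← hq, hcusp, hf]
    simp only [mul_div_cancel₀ _ Complex.two_pi_I_ne_zero]

theorem exists_analyticAt_comp_exp {u : ℂ → ℂ} (hd : DifferentiableOn ℂ u {w | w.re < c})
    (hp : ∀ w : ℂ, w.re < c → u (w + 2 * Real.pi * Complex.I) = u w)
    (hu : u =O[stripEnd (2 * Real.pi)] fun _ => (1 : ℝ)) :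
    ∃ H : ℂ → ℂ, AnalyticAt ℂ H 0 ∧ ∀ w : ℂ, w.re < c → u w = H (Complex.exp w) := by
  set v : ℂ → ℂ := {w | w.re < c}.indicator u with hv
  have hv_apply {w : ℂ} (hw : w.re < c) : v w = u w :=
    Set.indicator_of_mem (s := {w : ℂ | w.re < c}) hw u
  have hv_periodic : Function.Periodic v (2 * Real.pi * Complex.I) := fun w => by
    by_cases hw : w.re < c
    · rw [hv_apply hw, hv_apply (by simpa using hw), hp w hw]
    · rw [hv, Set.indicator_of_notMem (by simpa using hw),
        Set.indicator_of_notMem (by simpa using hw)]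
  obtain ⟨H, hH, hvH⟩ := exists_analyticAt_comp_exp_of_periodic
    (hd.congr fun w hw => hv_apply hw) hv_periodic
    ((isBigO_of_le _ fun w => norm_indicator_le_norm_self _ _).trans hu)
  exact ⟨H, hH, fun w hw => (hv_apply hw).symm.trans (hvH w)⟩

theorem exists_exp_mul_comp_exp_of_periodic {N : ℕ} (hN : N ≠ 0) {u : ℂ → ℂ}
    (hu : u ∈ moderateAlgebra c)
    (hp : ∀ w : ℂ, w.re < c → u (w + N * (2 * Real.pi * Complex.I)) = u w) :
    ∃ M₀ : ℕ, ∀ M ≥ M₀, ∃ H : ℂ → ℂ, AnalyticAt ℂ H 0 ∧ ∀ w : ℂ, w.re < c →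
      u w = Complex.exp (-(M / N) * w) * H (Complex.exp (w / N)) := by
  have hN' : (0 : ℝ) < N := Nat.cast_pos.mpr (Nat.pos_of_ne_zero hN)
  have hNc : (N : ℂ) ≠ 0 := Nat.cast_ne_zero.mpr hN
  have hscaled : (fun w => u (N * w)) ∈ moderateAlgebra (c / N) := by
    simpa using comp_mul_add_mem_moderateAlgebra hN' (κ := 0)
      (by simp [mul_div_cancel₀ c hN'.ne']) hu
  obtain ⟨K, hK⟩ := hscaled.2 (2 * Real.pi)
  refine ⟨⌈K⌉₊, fun M hM => ?_⟩
  have hperiodic (w : ℂ) (hw : w.re < c / N) :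
      Complex.exp (M * (w + 2 * Real.pi * Complex.I)) * u (N * (w + 2 * Real.pi * Complex.I)) =
        Complex.exp (M * w) * u (N * w) := by
    have hNw : (N * w).re < c := by
      rwa [← Complex.ofReal_natCast, Complex.re_ofReal_mul, mul_comm, ← lt_div_iff₀ hN']
    rw [mul_add, mul_add, hp _ hNw, Complex.exp_add, Complex.exp_nat_mul_two_pi_mul_I, mul_one]
  have hbdd : (fun w : ℂ => Complex.exp (M * w) * u (N * w)) =O[stripEnd (2 * Real.pi)]
      fun _ => (1 : ℝ) := by
    have hexp : (fun w : ℂ => Complex.exp (M * w)) =O[stripEnd (2 * Real.pi)]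
        fun w => Real.exp (-(-M) * w.re) :=
      IsBigO.of_norm_left ((isBigO_refl _ _).congr_left fun w => by simp [Complex.norm_exp])
    exact (hexp.mul (hK.trans (isBigO_exp_re_stripEnd _ ((Nat.le_ceil K).trans
      (Nat.cast_le.mpr hM))))).congr_right fun w => by rw [← Real.exp_add]; simp
  obtain ⟨H, hH, huH⟩ := exists_analyticAt_comp_exp
    (DifferentiableOn.fun_mul (by fun_prop) hscaled.1) hperiodic hbdd
  refine ⟨H, hH, fun w hw => ?_⟩
  have hwN : (w / N).re < c / N := by
    rw [← Complex.ofReal_natCast, Complex.div_ofReal_re]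
    gcongr
  rw [← huH _ hwN, ← mul_assoc, ← Complex.exp_add, mul_div_cancel₀ w hNc,
    show -(M / N : ℂ) * w + M * (w / N) = 0 by ring, Complex.exp_zero, one_mul]

/-- The sum `∑_{k<m} wᵏ e^(-Mw/N) Hₖ(e^(w/N))`, that is, a polynomial in `w = log u` whose
coefficients are Laurent series in `u^(1/N)`. -/
noncomputable def puiseuxLog (N M m : ℕ) (H : ℕ → ℂ → ℂ) (w : ℂ) : ℂ :=
  ∑ k ∈ Finset.range m, w ^ k * (Complex.exp (-(M / N) * w) * H k (Complex.exp (w / N)))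

theorem exists_log_expansion {N : ℕ} (hN : N ≠ 0) (m : ℕ) {f : ℂ → ℂ}
    (hf : f ∈ moderateAlgebra c)
    (h : ∀ w : ℂ, w.re < c → (fwdDiff (N * (2 * Real.pi * Complex.I)))^[m] f w = 0) :
    ∃ M₀ : ℕ, ∀ M ≥ M₀, ∃ H : ℕ → ℂ → ℂ, (∀ k, AnalyticAt ℂ (H k) 0) ∧
      ∀ w : ℂ, w.re < c → f w = puiseuxLog N M m H w := by
  obtain ⟨u, hu, hfu⟩ := exists_periodic_decomposition (by simp)
    (mul_ne_zero (Nat.cast_ne_zero.mpr hN) Complex.two_pi_I_ne_zero) m hf h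
  choose! M₀ hM₀ using fun k hk => exists_exp_mul_comp_exp_of_periodic hN (hu k hk).1 (hu k hk).2
  refine ⟨(Finset.range m).sup M₀, fun M hM => ?_⟩
  have hH (k : ℕ) : ∃ H : ℂ → ℂ, AnalyticAt ℂ H 0 ∧ (k < m → ∀ w : ℂ, w.re < c →
      u k w = Complex.exp (-(M / N) * w) * H (Complex.exp (w / N))) := by
    by_cases hk : k < m
    · obtain ⟨H, hH, huH⟩ := hM₀ k hk M ((Finset.le_sup (Finset.mem_range.mpr hk)).trans hM)
      exact ⟨H, hH, fun _ => huH⟩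
    · exact ⟨0, analyticAt_const, fun h => absurd h hk⟩
  choose H hH huH using hH
  refine ⟨H, hH, fun w hw => (hfu w hw).trans (Finset.sum_congr rfl fun k hk => ?_)⟩
  rw [huH k (Finset.mem_range.mp hk) w hw]

end HalfPlane

section LocalMonodromy

variable {δ : ℝ} {F : ℂ → ℂ}

theorem localMonodromy_pow_restrict (δ : ℝ) (N : ℕ) (f : ℂ → ℂ) :
    (localMonodromy δ ^ N) ((logHalfPlane δ).domRestrict f) =
      (logHalfPlane δ).domRestrict fun w => f (w + N * (2 * Real.pi * Complex.I)) := by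
  induction N with
  | zero => simp
  | succ N ih =>
    rw [pow_succ', Module.End.mul_apply, ih]
    ext w
    simp only [localMonodromy, LinearMap.funLeft_apply, Set.domRestrict_apply, logShift]
    congr 1
    push_cast
    ring

theorem localMonodromy_pow_sub_one_pow_restrict (δ : ℝ) (N m : ℕ) (f : ℂ → ℂ) :
    ((localMonodromy δ ^ N - 1) ^ m) ((logHalfPlane δ).domRestrict f) =
      (logHalfPlane δ).domRestrict ((fwdDiff (N * (2 * Real.pi * Complex.I)))^[m] f) := by
  induction m with
  | zero => rfl
  | succ m ih =>
    rw [pow_succ', Module.End.mul_apply, ih, Function.iterate_succ_apply', LinearMap.sub_apply,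
      localMonodromy_pow_restrict]
    rfl

theorem localMonodromy_mem_determinations {v : logHalfPlane δ → ℂ} (hv : v ∈ determinations δ F) :
    localMonodromy δ v ∈ determinations δ F := by
  suffices determinations δ F ≤ (determinations δ F).comap (localMonodromy δ) from this hv
  refine Submodule.span_le.mpr ?_
  rintro _ ⟨k, rfl⟩
  refine Submodule.subset_span ⟨k + 1, ?_⟩
  ext w
  simp only [localMonodromy, LinearMap.funLeft_apply, logShift]
  congr 1
  push_cast
  ring

theorem restrict_mem_determinations (δ : ℝ) (F : ℂ → ℂ) :
    (logHalfPlane δ).domRestrict F ∈ determinations δ F :=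
  Submodule.subset_span ⟨0, by ext w; simp [logShift, Set.domRestrict_apply]⟩

theorem exists_dvd_X_pow_sub_one_pow {P : Polynomial ℂ} (hP : P ≠ 0)
    (h : ∀ μ, P.IsRoot μ → ∃ N : ℕ, 0 < N ∧ μ ^ N = 1) :
    ∃ N₀ m₀ : ℕ, N₀ ≠ 0 ∧ ∀ N, N₀ ∣ N → ∀ m ≥ m₀, P ∣ (Polynomial.X ^ N - 1) ^ m := by
  choose! n hn_pos hn using h
  have hroot : ∀ μ ∈ P.roots, P.IsRoot μ := fun μ => Polynomial.isRoot_of_mem_roots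
  refine ⟨∏ μ ∈ P.roots.toFinset, n μ, P.roots.card, Finset.prod_ne_zero_iff.mpr fun μ hμ =>
    (hn_pos μ (hroot μ (Multiset.mem_toFinset.mp hμ))).ne', fun N hN m hm => ?_⟩
  have hfactor : ∀ μ ∈ P.roots,
      Polynomial.X - Polynomial.C μ ∣ (Polynomial.X ^ N - 1 : Polynomial ℂ) := fun μ hμ => by
    obtain ⟨k, rfl⟩ := (Finset.dvd_prod_of_mem n (Multiset.mem_toFinset.mpr hμ)).trans hN
    simp [Polynomial.dvd_iff_isRoot, pow_mul, hn μ (hroot μ hμ)]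
  have hunit : IsUnit (Polynomial.C P.leadingCoeff) :=
    Polynomial.isUnit_C.mpr (Polynomial.leadingCoeff_ne_zero.mpr hP).isUnit
  refine dvd_trans ?_ (pow_dvd_pow _ hm)
  rw [(IsAlgClosed.splits P).eq_prod_roots, hunit.mul_left_dvd, ← Multiset.prod_replicate,
    ← Multiset.map_const', (IsAlgClosed.splits P).eq_prod_roots.symm]
  exact Multiset.prod_dvd_prod_of_dvd _ _ hfactor

theorem IsQuasiUnipotent.exists_fwdDiff_eq_zero (hF : IsQuasiUnipotent δ F) :
    ∃ N₀ m₀ : ℕ, N₀ ≠ 0 ∧ ∀ N, N₀ ∣ N → ∀ m ≥ m₀, ∀ w ∈ logHalfPlane δ,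
      (fwdDiff (N * (2 * Real.pi * Complex.I)))^[m] F w = 0 := by
  obtain ⟨hfin, heig⟩ := hF
  set T : Module.End ℂ (determinations δ F) :=
    (localMonodromy δ).restrict fun _ => localMonodromy_mem_determinations with hT
  have hroot : ∀ μ, (minpoly ℂ T).IsRoot μ → ∃ N : ℕ, 0 < N ∧ μ ^ N = 1 := fun μ hμ => by
    obtain ⟨v, hv⟩ := (Module.End.hasEigenvalue_iff_isRoot.mpr hμ).exists_hasEigenvector
    exact heig μ v v.2 (fun h => hv.2 (Subtype.ext h)) (congrArg Subtype.val hv.apply_eq_smul)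
  obtain ⟨N₀, m₀, hN₀, hdvd⟩ := exists_dvd_X_pow_sub_one_pow
    (minpoly.ne_zero (Algebra.IsIntegral.isIntegral T)) hroot
  refine ⟨N₀, m₀, hN₀, fun N hN m hm w hw => ?_⟩
  have hzero : (T ^ N - 1) ^ m = 0 := by
    simpa using minpoly.dvd_iff.mp (hdvd N hN m hm)
  have hcoe : (((T ^ N - 1) ^ m) ⟨_, restrict_mem_determinations δ F⟩ : logHalfPlane δ → ℂ) =
      ((localMonodromy δ ^ N - 1) ^ m) ((logHalfPlane δ).domRestrict F) := by
    have hpow : ∀ v ∈ determinations δ F, (localMonodromy δ ^ N) v ∈ determinations δ F :=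
      Module.End.pow_apply_mem_of_forall_mem N fun _ => localMonodromy_mem_determinations
    have hrestrict : T ^ N - 1 =
        (localMonodromy δ ^ N - 1).restrict fun v hv => sub_mem (hpow v hv) hv := by
      rw [hT, Module.End.pow_restrict N _ hpow]
      rfl
    rw [hrestrict, Module.End.pow_restrict m]
    rfl
  rw [hzero, localMonodromy_pow_sub_one_pow_restrict] at hcoe
  exact (congrFun hcoe ⟨w, hw⟩).symm

theorem HasModerateGrowth.mem_moderateAlgebra (hd : DifferentiableOn ℂ F (logHalfPlane δ))
    (hF : HasModerateGrowth δ F) : F ∈ moderateAlgebra (Real.log δ) := by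
  refine ⟨hd, fun A => ?_⟩
  obtain ⟨C, K, ε, -, -, h⟩ := hF A
  refine ⟨K, IsBigO.of_bound C (eventually_stripEnd_iff.mpr ⟨Real.log ε, fun w hre him => ?_⟩)⟩
  rw [Real.norm_eq_abs, Real.abs_exp]
  exact h w hre him

theorem exists_puiseux_log_expansion (κ : ℂ) (hd : DifferentiableOn ℂ F (logHalfPlane δ))
    (hF : IsQuasiUnipotent δ F) (hg : HasModerateGrowth δ F) :
    ∃ N₀ m₀ : ℕ, N₀ ≠ 0 ∧ ∀ N, N ≠ 0 → N₀ ∣ N → ∀ m ≥ m₀, ∃ M₀ : ℕ, ∀ M ≥ M₀,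
      ∃ H : ℕ → ℂ → ℂ, (∀ k, AnalyticAt ℂ (H k) 0) ∧ ∀ w : ℂ, w.re < Real.log δ - κ.re →
        F (w + κ) = puiseuxLog N M m H w := by
  obtain ⟨N₀, m₀, hN₀, hdiff⟩ := hF.exists_fwdDiff_eq_zero
  refine ⟨N₀, m₀, hN₀, fun N hN hdvd m hm => ?_⟩
  have hmem : (fun w => F (w + κ)) ∈ moderateAlgebra (Real.log δ - κ.re) := by
    simpa using comp_mul_add_mem_moderateAlgebra one_pos (κ := κ) (by simp)
      (hg.mem_moderateAlgebra hd)
  refine exists_log_expansion hN m hmem fun w hw => ?_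
  rw [fwdDiff_iter_comp_add]
  exact hdiff N hdvd m hm _ (by simpa [logHalfPlane, lt_sub_iff_add_lt] using hw)

end LocalMonodromy

/-! ### Analytic continuation along paths -/

section Continuation

/-- Analytic continuation along a path whose parameter runs through a set of reals. -/
def ContinuationOn (γ : ℝ → ℂ) (f : ℝ → ℂ → ℂ) (I : Set ℝ) : Prop :=
  ∀ t ∈ I, AnalyticAt ℂ (f t) (γ t) ∧ ∀ᶠ s in 𝓝[I] t, f s =ᶠ[𝓝 (γ s)] f t

variable {γ : ℝ → ℂ} {f g : ℝ → ℂ → ℂ} {I J : Set ℝ}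

theorem ContinuationOn.mono (h : ContinuationOn γ f I) (hJ : J ⊆ I) : ContinuationOn γ f J :=
  fun t ht => ⟨(h t (hJ ht)).1, (h t (hJ ht)).2.filter_mono (nhdsWithin_mono t hJ)⟩

theorem continuationOn_const {g : ℂ → ℂ} (h : ∀ t ∈ I, AnalyticAt ℂ g (γ t)) :
    ContinuationOn γ (fun _ => g) I :=
  fun t ht => ⟨h t ht, Eventually.of_forall fun _ => EventuallyEq.rfl⟩

theorem ContinuationOn.congr {γ' : ℝ → ℂ} (h : ContinuationOn γ f I) (hγ : Set.EqOn γ γ' I) :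
    ContinuationOn γ' f I := by
  intro t ht
  rw [← hγ ht]
  refine ⟨(h t ht).1, ?_⟩
  filter_upwards [(h t ht).2, self_mem_nhdsWithin] with s hfs hs
  rwa [← hγ hs]

theorem ContinuationOn.comp (h : ContinuationOn γ f I) {u : ℝ → ℝ} (hu : ContinuousOn u J)
    (hJ : Set.MapsTo u J I) : ContinuationOn (γ ∘ u) (f ∘ u) J := fun t ht =>
  ⟨(h _ (hJ ht)).1, ((hu t ht).tendsto_nhdsWithin hJ).eventually (h _ (hJ ht)).2⟩

theorem ContinuationOn.pullback {e : ℂ → ℂ} (h : ContinuationOn (e ∘ γ) f I)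
    (he : ∀ t ∈ I, AnalyticAt ℂ e (γ t)) : ContinuationOn γ (fun t => f t ∘ e) I := by
  refine fun t ht => ⟨(h t ht).1.comp_of_eq (he t ht) rfl, ?_⟩
  filter_upwards [(h t ht).2, self_mem_nhdsWithin] with s hfs hs
  exact (he s hs).continuousAt.eventually hfs

theorem eventuallyEq_of_preconnected {U : Set ℂ} (hU : IsOpen U) (hc : IsPreconnected U)
    {f g : ℂ → ℂ} (hf : AnalyticOnNhd ℂ f U) (hg : AnalyticOnNhd ℂ g U) {x y : ℂ} (hx : x ∈ U)
    (hy : y ∈ U) (h : f =ᶠ[𝓝 x] g) : f =ᶠ[𝓝 y] g :=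
  eventuallyEq_of_mem (hU.mem_nhds hy) (hf.eqOn_of_preconnected_of_eventuallyEq hg hc hx h)

theorem exists_analyticOnNhd_ball {f : ℂ → ℂ} {z : ℂ} (hf : AnalyticAt ℂ f z) :
    ∃ r > 0, AnalyticOnNhd ℂ f (Metric.ball z r) :=
  Metric.eventually_nhds_iff_ball.mp hf.eventually_analyticAt

theorem ContinuationOn.unique (hf : ContinuationOn γ f I) (hg : ContinuationOn γ g I)
    (hI : IsPreconnected I) (hγ : ContinuousOn γ I) {s t : ℝ} (hs : s ∈ I) (ht : t ∈ I)
    (h : f s =ᶠ[𝓝 (γ s)] g s) : f t =ᶠ[𝓝 (γ t)] g t := by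
  refine (hI.induction₂ (P := fun s t => f s =ᶠ[𝓝 (γ s)] g s ↔ f t =ᶠ[𝓝 (γ t)] g t)
    (fun t ht => ?_) (fun _ _ _ _ _ _ => Iff.trans) (fun _ _ _ _ => Iff.symm) hs ht).mp h
  obtain ⟨r, hr, hball⟩ := Metric.eventually_nhds_iff_ball.mp
    ((hf t ht).1.eventually_analyticAt.and (hg t ht).1.eventually_analyticAt)
  have htransfer {x y : ℂ} (hx : x ∈ Metric.ball (γ t) r) (hy : y ∈ Metric.ball (γ t) r)
      (h : f t =ᶠ[𝓝 x] g t) : f t =ᶠ[𝓝 y] g t :=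
    eventuallyEq_of_preconnected Metric.isOpen_ball (convex_ball _ _).isPreconnected
      (fun z hz => (hball z hz).1) (fun z hz => (hball z hz).2) hx hy h
  have htmem := Metric.mem_ball_self (x := γ t) hr
  filter_upwards [(hf t ht).2, (hg t ht).2, hγ t ht (Metric.ball_mem_nhds _ hr)] with s hfs hgs hs
  exact ⟨fun h => hfs.trans ((htransfer htmem hs h).trans hgs.symm),
    fun h => htransfer hs htmem (hfs.symm.trans (h.trans hgs))⟩

theorem ContinuationOn.exists_radius (hf : ContinuationOn γ f I) (hI : IsCompact I)
    (hγ : ContinuousOn γ I) :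
    ∃ r > 0, ∀ t ∈ I, ∃ h : ℂ → ℂ, AnalyticOnNhd ℂ h (Metric.ball (γ t) r) ∧
      h =ᶠ[𝓝 (γ t)] f t := by
  refine hI.induction_on (p := fun s => ∃ r > 0, ∀ t ∈ s, ∃ h : ℂ → ℂ,
    AnalyticOnNhd ℂ h (Metric.ball (γ t) r) ∧ h =ᶠ[𝓝 (γ t)] f t) ?_ ?_ ?_ ?_
  · exact ⟨1, one_pos, fun t ht => absurd ht (Set.notMem_empty t)⟩
  · rintro s s' hss ⟨r, hr, h⟩
    exact ⟨r, hr, fun t ht => h t (hss ht)⟩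
  · rintro s s' ⟨r, hr, h⟩ ⟨r', hr', h'⟩
    refine ⟨min r r', lt_min hr hr', fun t ht => ?_⟩
    rcases ht with ht | ht
    · obtain ⟨k, hk, hkf⟩ := h t ht
      exact ⟨k, hk.mono (Metric.ball_subset_ball (min_le_left _ _)), hkf⟩
    · obtain ⟨k, hk, hkf⟩ := h' t ht
      exact ⟨k, hk.mono (Metric.ball_subset_ball (min_le_right _ _)), hkf⟩
  · intro t ht
    obtain ⟨r, hr, hball⟩ := exists_analyticOnNhd_ball (hf t ht).1
    refine ⟨_, inter_mem (hf t ht).2 (hγ t ht (Metric.ball_mem_nhds (γ t) (half_pos hr))),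
      r / 2, half_pos hr, fun s ⟨hsf, (hsγ : dist (γ s) (γ t) < r / 2)⟩ =>
        ⟨f t, hball.mono (Metric.ball_subset_ball' ?_), hsf.symm⟩⟩
    linarith

theorem ContinuationOn.exists_uniform (hf : ContinuationOn γ f I) (hI : IsCompact I)
    (hγ : ContinuousOn γ I) :
    ∃ r > 0, ∃ h : ℝ → ℂ → ℂ, (∀ t ∈ I, h t =ᶠ[𝓝 (γ t)] f t) ∧
      ∀ γ' : ℝ → ℂ, ContinuousOn γ' I → (∀ t ∈ I, γ' t ∈ Metric.ball (γ t) r) →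
        ContinuationOn γ' h I := by
  obtain ⟨r, hr, h⟩ := hf.exists_radius hI hγ
  choose! h hh hhf using h
  refine ⟨r, hr, h, hhf, fun γ' hγ' hclose t ht => ⟨hh t ht _ (hclose t ht), ?_⟩⟩
  filter_upwards [(hf t ht).2, hγ t ht (Metric.ball_mem_nhds (γ t) hr),
    hγ t ht (hhf t ht).eventually_nhds,
    hγ' t ht (Metric.isOpen_ball.mem_nhds (hclose t ht)), self_mem_nhdsWithin]
    with s hfs hγs hhs hγ's hs
  refine eventuallyEq_of_preconnected (Metric.isOpen_ball.inter Metric.isOpen_ball)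
    ((convex_ball (γ s) r).inter (convex_ball (γ t) r)).isPreconnected
    ((hh s hs).mono Set.inter_subset_left) ((hh t ht).mono Set.inter_subset_right)
    ⟨Metric.mem_ball_self hr, hγs⟩ ⟨hclose s hs, hγ's⟩ ?_
  exact (hhf s hs).trans (hfs.trans (EventuallyEq.symm hhs))

/-- The continuations along two nearby segments with the same origin are given by the same
analytic functions, so the germs at the end points fit together. -/
theorem exists_analyticOnNhd_of_continuation {U : Set ℂ} (hU : IsOpen U) {w₀ : ℂ} (hw₀ : w₀ ∈ U)
    {φ : ℂ → ℂ} (h : ∀ w ∈ U, ∃ f : ℝ → ℂ → ℂ,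
      ContinuationOn (AffineMap.lineMap w₀ w) f (Set.Icc (0 : ℝ) 1) ∧ f 0 =ᶠ[𝓝 w₀] φ) :
    ∃ F : ℂ → ℂ, AnalyticOnNhd ℂ F U ∧ F =ᶠ[𝓝 w₀] φ := by
  choose! f hf hf0 using h
  have h0 : (0 : ℝ) ∈ Set.Icc (0 : ℝ) 1 := Set.left_mem_Icc.mpr zero_le_one
  have h1 : (1 : ℝ) ∈ Set.Icc (0 : ℝ) 1 := Set.right_mem_Icc.mpr zero_le_one
  have hcont (w : ℂ) : ContinuousOn (AffineMap.lineMap w₀ w) (Set.Icc (0 : ℝ) 1) :=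
    AffineMap.lineMap_continuous.continuousOn
  have hlocal : ∀ w ∈ U, ∃ H : ℂ → ℂ, H =ᶠ[𝓝 w] f w 1 ∧ ∀ᶠ v in 𝓝 w, f v 1 v = H v := by
    intro w hw
    obtain ⟨r, hr, H, hHf, hH⟩ := (hf w hw).exists_uniform isCompact_Icc (hcont w)
    have hH1 := hHf 1 h1
    have hH0 := hHf 0 h0
    rw [AffineMap.lineMap_apply_one] at hH1
    rw [AffineMap.lineMap_apply_zero] at hH0
    refine ⟨H 1, hH1, ?_⟩
    filter_upwards [Metric.ball_mem_nhds w hr, hU.mem_nhds hw] with v hv hvU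
    have hHv := hH (AffineMap.lineMap w₀ v) (hcont v) fun t ht => by
      have hsub : (AffineMap.lineMap w₀ v t : ℂ) - AffineMap.lineMap w₀ w t = t • (v - w) := by
        simp only [AffineMap.lineMap_apply, vsub_eq_sub, vadd_eq_add, smul_sub]
        ring
      rw [Metric.mem_ball, dist_eq_norm, hsub, norm_smul, Real.norm_of_nonneg ht.1, ← dist_eq_norm]
      exact (mul_le_of_le_one_left dist_nonneg ht.2).trans_lt hv
    have hstart : f v 0 =ᶠ[𝓝 (AffineMap.lineMap w₀ v (0 : ℝ))] H 0 := by
      rw [AffineMap.lineMap_apply_zero]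
      exact (hf0 v hvU).trans ((hf0 w hw).symm.trans hH0.symm)
    have hend := (hf v hvU).unique hHv isPreconnected_Icc (hcont v) h0 h1 hstart
    rw [AffineMap.lineMap_apply_one] at hend
    exact hend.eq_of_nhds
  refine ⟨fun w => f w 1 w, fun w hw => ?_, ?_⟩
  · obtain ⟨H, hH, hFH⟩ := hlocal w hw
    have hf1 := (hf w hw 1 h1).1
    rw [AffineMap.lineMap_apply_one] at hf1
    exact hf1.congr (hH.symm.trans (EventuallyEq.symm hFH))
  · obtain ⟨H, hH, hFH⟩ := hlocal w₀ hw₀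
    have hconst := hf w₀ hw₀
    rw [AffineMap.lineMap_same] at hconst
    refine EventuallyEq.trans hFH (hH.trans ?_)
    exact (hconst.unique (continuationOn_const fun _ _ => (hconst 0 h0).1) isPreconnected_Icc
      continuousOn_const h0 h1 EventuallyEq.rfl).trans (hf0 w₀ hw₀)

end Continuation

/-! ### Branches near the circle of convergence -/

section Branches

variable {Λ : Finset ℂ} {ρ R δ : ℝ} {G g : ℂ → ℂ} {z p : ℂ}

/-- The starting points of the segments to `z` that meet `Λ` lie on finitely many real lines. -/
theorem exists_segment_avoiding (Λ : Finset ℂ) (hρ : 0 < ρ) (hz : z ∉ Λ) :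
    ∃ w ∈ Metric.ball (0 : ℂ) ρ, ∀ t ∈ Set.Icc (0 : ℝ) 1,
      (AffineMap.lineMap w z t : ℂ) ∉ Λ := by
  by_contra! hmeet
  have hcover : Metric.ball (0 : ℂ) ρ ⊆
      ⋃ q ∈ Λ, (AffineSubspace.mk' z (Submodule.span ℝ {q - z}) : Set ℂ) := by
    intro w hw
    obtain ⟨t, -, hq⟩ := hmeet w hw
    have hsub : (AffineMap.lineMap w z t : ℂ) - z = (1 - t) • (w - z) := by
      simp only [AffineMap.lineMap_apply, vsub_eq_sub, vadd_eq_add, Complex.real_smul]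
      push_cast
      ring
    have ht : 1 - t ≠ 0 := fun h => hz (by simpa [← sub_eq_zero.mp h] using hq)
    simp only [Set.mem_iUnion]
    refine ⟨_, hq, ?_⟩
    rw [SetLike.mem_coe, AffineSubspace.mem_mk', vsub_eq_sub, Submodule.mem_span_singleton]
    exact ⟨(1 - t)⁻¹, by rw [hsub, smul_smul, inv_mul_cancel₀ ht, one_smul]⟩
  have hnull : MeasureTheory.volume
      (⋃ q ∈ Λ, (AffineSubspace.mk' z (Submodule.span ℝ {q - z}) : Set ℂ)) = 0 := by
    refine (MeasureTheory.measure_biUnion_null_iff Λ.countable_toSet).mpr fun q _ => ?_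
    refine MeasureTheory.Measure.addHaar_affineSubspace _ _ fun htop => ?_
    have hdir := congrArg AffineSubspace.direction htop
    rw [AffineSubspace.direction_mk', AffineSubspace.direction_top] at hdir
    have hrank := finrank_span_le_card (R := ℝ) ({q - z} : Set ℂ)
    rw [hdir, finrank_top, Complex.finrank_real_complex] at hrank
    simp at hrank
  exact (Metric.measure_ball_pos MeasureTheory.volume (0 : ℂ) hρ).ne'
    (MeasureTheory.measure_mono_null hcover hnull)

theorem exists_admissible_segment (Λ : Finset ℂ) (hρ : 0 < ρ) (hz : z ∉ Λ) :
    ∃ w ∈ Metric.ball (0 : ℂ) ρ, IsAdmissiblePath Λ ρ (AffineMap.lineMap w z) := by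
  obtain ⟨w, hw, havoid⟩ := exists_segment_avoiding Λ hρ hz
  exact ⟨w, hw, AffineMap.lineMap_continuous.continuousOn, by simpa using hw, havoid⟩

section ConcatPath

variable {γ₁ γ₂ : ℝ → ℂ} {f : ℝ → ℂ → ℂ} {t : ℝ}

/-- The concatenation of two paths parametrized by `[0, 1]`, the second being translated to start
at the end of the first. -/
noncomputable def concatPath (γ₁ γ₂ : ℝ → ℂ) (t : ℝ) : ℂ :=
  γ₁ (min (2 * t) 1) + (γ₂ (max (2 * t - 1) 0) - γ₂ 0)

theorem concatPath_of_le (ht : t ≤ 1 / 2) : concatPath γ₁ γ₂ t = γ₁ (2 * t) := by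
  rw [concatPath, min_eq_left (by linarith), max_eq_right (by linarith), sub_self, add_zero]

theorem concatPath_of_ge (h : γ₁ 1 = γ₂ 0) (ht : 1 / 2 ≤ t) :
    concatPath γ₁ γ₂ t = γ₂ (2 * t - 1) := by
  rw [concatPath, min_eq_right (by linarith), max_eq_left (by linarith), h]
  ring

theorem continuousOn_concatPath (h₁ : ContinuousOn γ₁ (Set.Icc 0 1))
    (h₂ : ContinuousOn γ₂ (Set.Icc 0 1)) : ContinuousOn (concatPath γ₁ γ₂) (Set.Icc 0 1) := by
  refine ContinuousOn.add (h₁.comp (by fun_prop) fun t ht => ?_)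
    (ContinuousOn.sub (h₂.comp (by fun_prop) fun t ht => ?_) continuousOn_const)
  · exact ⟨le_min (by linarith [ht.1]) zero_le_one, min_le_right _ _⟩
  · exact ⟨le_max_right _ _, max_le (by linarith [ht.2]) zero_le_one⟩

theorem IsAdmissiblePath.concatPath (h₁ : IsAdmissiblePath Λ ρ γ₁)
    (h₂ : ContinuousOn γ₂ (Set.Icc 0 1)) (h₂Λ : ∀ t ∈ Set.Icc (0 : ℝ) 1, γ₂ t ∉ Λ)
    (h : γ₁ 1 = γ₂ 0) : IsAdmissiblePath Λ ρ (concatPath γ₁ γ₂) := by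
  refine ⟨continuousOn_concatPath h₁.1 h₂, ?_, fun t ht => ?_⟩
  · simpa [concatPath_of_le] using h₁.2.1
  · rcases le_total t (1 / 2) with ht' | ht'
    · rw [concatPath_of_le ht']
      exact h₁.2.2 _ ⟨by linarith [ht.1], by linarith⟩
    · rw [concatPath_of_ge h ht']
      exact h₂Λ _ ⟨by linarith, by linarith [ht.2]⟩

theorem ContinuationOn.left_of_concatPath
    (hf : ContinuationOn (concatPath γ₁ γ₂) f (Set.Icc 0 1)) :
    ContinuationOn γ₁ (fun t => f (t / 2)) (Set.Icc 0 1) := by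
  refine (ContinuationOn.comp hf (u := fun t => t / 2) (J := Set.Icc 0 1) (by fun_prop)
    fun t ht => ?_).congr fun t ht => ?_
  · exact ⟨by linarith [ht.1], by linarith [ht.2]⟩
  · rw [Function.comp_apply, concatPath_of_le (by linarith [ht.2]), mul_div_cancel₀ _ two_ne_zero]

theorem ContinuationOn.right_of_concatPath (h : γ₁ 1 = γ₂ 0)
    (hf : ContinuationOn (concatPath γ₁ γ₂) f (Set.Icc 0 1)) :
    ContinuationOn γ₂ (fun t => f ((t + 1) / 2)) (Set.Icc 0 1) := by
  refine (ContinuationOn.comp hf (u := fun t => (t + 1) / 2) (J := Set.Icc 0 1) (by fun_prop)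
    fun t ht => ?_).congr fun t ht => ?_
  · exact ⟨by linarith [ht.1], by linarith [ht.2]⟩
  · rw [Function.comp_apply, concatPath_of_ge h (by linarith [ht.1]),
      mul_div_cancel₀ _ two_ne_zero, add_sub_cancel_right]

end ConcatPath

theorem exists_mem_ball_inter_ball (hR : 0 < R) (hp : ‖p‖ = R) (hδ : 0 < δ) :
    ∃ z ∈ Metric.ball (0 : ℂ) R ∩ Metric.ball p δ, z ≠ p := by
  have hclosure : p ∈ closure (Metric.ball (0 : ℂ) R) := by
    rw [closure_ball _ hR.ne']
    simp [hp]
  obtain ⟨z, hzR, hzp⟩ := Metric.mem_closure_iff.mp hclosure δ hδ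
  refine ⟨z, ⟨hzR, by rwa [Metric.mem_ball, dist_comm]⟩, fun h => ?_⟩
  exact (mem_ball_zero_iff.mp hzR).ne (h ▸ hp)

/-- The branch of `log (z - p)` on the disk `|z| < |p|` that has the value `log (-p)` at `0`. -/
noncomputable def diskLog (p z : ℂ) : ℂ :=
  Complex.log (1 - z / p) + Complex.log (-p)

theorem one_sub_div_mem_slitPlane (hz : z ∈ Metric.ball 0 ‖p‖) :
    1 - z / p ∈ Complex.slitPlane := by
  rw [mem_ball_zero_iff] at hz
  refine one_sub_mem_slitPlane ?_
  rw [mem_ball_zero_iff, norm_div]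
  exact (div_lt_one ((norm_nonneg z).trans_lt hz)).mpr hz

theorem exp_diskLog (hz : z ∈ Metric.ball 0 ‖p‖) : Complex.exp (diskLog p z) = z - p := by
  have hp : p ≠ 0 := norm_pos_iff.mp (Metric.pos_of_mem_ball hz)
  rw [diskLog, Complex.exp_add, Complex.exp_log (neg_ne_zero.mpr hp),
    Complex.exp_log (Complex.slitPlane_ne_zero (one_sub_div_mem_slitPlane hz))]
  field_simp
  ring

theorem analyticAt_diskLog (hz : z ∈ Metric.ball 0 ‖p‖) : AnalyticAt ℂ (diskLog p) z :=
  ((analyticAt_const.sub (analyticAt_id.div_const)).clog (one_sub_div_mem_slitPlane hz)).add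
    analyticAt_const

theorem mem_logHalfPlane_iff (hδ : 0 < δ) {w : ℂ} :
    w ∈ logHalfPlane δ ↔ p + Complex.exp w ∈ Metric.ball p δ := by
  rw [mem_ball_iff_norm, add_sub_cancel_left, Complex.norm_exp, ← Real.lt_log_iff_exp_lt hδ]
  rfl

theorem diskLog_mem_logHalfPlane (hz : z ∈ Metric.ball 0 ‖p‖) (hzδ : z ∈ Metric.ball p δ) :
    diskLog p z ∈ logHalfPlane δ := by
  rwa [mem_logHalfPlane_iff (Metric.pos_of_mem_ball hzδ), exp_diskLog hz, add_sub_cancel]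

section Extension

variable (hρ : 0 < ρ) (hρR : ρ ≤ R) (hg : AnalyticOnNhd ℂ g (Metric.ball 0 R))
  (hGg : Set.EqOn G g (Metric.ball 0 ρ))

include hρ hρR hg hGg

theorem isBranchAt_of_mem_ball (hz : z ∈ Metric.ball 0 R) (hzΛ : z ∉ Λ) :
    IsBranchAt Λ ρ G z g := by
  obtain ⟨w, hw, hpath⟩ := exists_admissible_segment Λ hρ hzΛ
  refine ⟨_, fun _ => g, hpath, continuationOn_const fun t ht => hg _
    ((convex_ball (0 : ℂ) R).lineMap_mem (Metric.ball_subset_ball hρR hw) hz ht), ?_, by simp,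
    EventuallyEq.rfl⟩
  exact (hGg.eventuallyEq_of_mem (Metric.isOpen_ball.mem_nhds hpath.2.1)).symm

variable (hext : ExtendsMultivalued Λ ρ G)

include hext

theorem exists_continuationOn {γ : ℝ → ℂ} (hγ0 : γ 0 ∈ Metric.ball 0 R)
    (hγ : ContinuousOn γ (Set.Icc 0 1)) (hγΛ : ∀ t ∈ Set.Icc (0 : ℝ) 1, γ t ∉ Λ) :
    ∃ f : ℝ → ℂ → ℂ, ContinuationOn γ f (Set.Icc 0 1) ∧ f 0 =ᶠ[𝓝 (γ 0)] g := by
  obtain ⟨w, hw, hpath⟩ := exists_admissible_segment Λ hρ (hγΛ 0 ⟨le_rfl, zero_le_one⟩)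
  have hjoin : AffineMap.lineMap w (γ 0) (1 : ℝ) = γ 0 := AffineMap.lineMap_apply_one ..
  obtain ⟨f, hf, hfG⟩ := hext _ (hpath.concatPath hγ hγΛ hjoin)
  have hf' : ContinuationOn _ f (Set.Icc 0 1) := hf
  have hball : ∀ t ∈ Set.Icc (0 : ℝ) 1, (AffineMap.lineMap w (γ 0) t : ℂ) ∈ Metric.ball 0 R :=
    fun t ht => (convex_ball (0 : ℂ) R).lineMap_mem (Metric.ball_subset_ball hρR hw) hγ0 ht
  have hstart : f (0 / 2) =ᶠ[𝓝 (AffineMap.lineMap w (γ 0) (0 : ℝ))] g := by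
    rw [concatPath_of_le (by norm_num), mul_zero] at hfG
    rw [zero_div]
    exact hfG.trans (hGg.eventuallyEq_of_mem (Metric.isOpen_ball.mem_nhds hpath.2.1))
  have hmid := hf'.left_of_concatPath.unique
    (continuationOn_const fun t ht => hg _ (hball t ht)) isPreconnected_Icc hpath.1
    (Set.left_mem_Icc.mpr zero_le_one) (Set.right_mem_Icc.mpr zero_le_one) hstart
  rw [hjoin] at hmid
  exact ⟨_, hf'.right_of_concatPath hjoin, by simpa only [zero_add] using hmid⟩

theorem exists_analyticAt_of_notMem (hp : ‖p‖ = R) (hpΛ : p ∉ Λ) :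
    ∃ h : ℂ → ℂ, AnalyticAt ℂ h p ∧ g =ᶠ[𝓝[Metric.ball 0 R] p] h := by
  obtain ⟨ε, hε, hεΛ⟩ := Metric.isOpen_iff.mp Λ.finite_toSet.isClosed.isOpen_compl p hpΛ
  obtain ⟨z, ⟨hzR, hzp⟩, -⟩ := exists_mem_ball_inter_ball (hρ.trans_le hρR) hp hε
  obtain ⟨H, hH, hHg⟩ := exists_analyticOnNhd_of_continuation Metric.isOpen_ball hzp
    (φ := g) fun w hw => by
      have hseg : ∀ t ∈ Set.Icc (0 : ℝ) 1, (AffineMap.lineMap z w t : ℂ) ∉ Λ := fun t ht =>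
        hεΛ ((convex_ball p ε).lineMap_mem hzp hw ht)
      simpa only [AffineMap.lineMap_apply_zero] using exists_continuationOn hρ hρR hg hGg hext
        (by simpa using hzR) AffineMap.lineMap_continuous.continuousOn hseg
  have hEq : Set.EqOn g H (Metric.ball p ε ∩ Metric.ball 0 R) :=
    (hg.mono Set.inter_subset_right).eqOn_of_preconnected_of_eventuallyEq
      (hH.mono Set.inter_subset_left) ((convex_ball p ε).inter (convex_ball 0 R)).isPreconnected
      ⟨hzp, hzR⟩ hHg.symm
  refine ⟨H, hH p (Metric.mem_ball_self hε), ?_⟩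
  filter_upwards [self_mem_nhdsWithin, mem_nhdsWithin_of_mem_nhds (Metric.ball_mem_nhds p hε)]
    with y hyR hyp using hEq ⟨hyp, hyR⟩

theorem exists_analyticOnNhd_logHalfPlane (hδ : 0 < δ)
    (hΛ : ∀ q ∈ Λ, q ∈ Metric.ball p δ → q = p) {w₀ : ℂ} (hw₀ : w₀ ∈ logHalfPlane δ)
    (hw₀R : p + Complex.exp w₀ ∈ Metric.ball 0 R) :
    ∃ F : ℂ → ℂ, AnalyticOnNhd ℂ F (logHalfPlane δ) ∧
      F =ᶠ[𝓝 w₀] fun w => g (p + Complex.exp w) := by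
  have hopen : IsOpen (logHalfPlane δ) := isOpen_lt Complex.continuous_re continuous_const
  have hconv : Convex ℝ (logHalfPlane δ) := convex_halfSpace_lt Complex.reLm.isLinear _
  have he (w : ℂ) : AnalyticAt ℂ (fun w => p + Complex.exp w) w :=
    analyticAt_const.add analyticAt_cexp
  refine exists_analyticOnNhd_of_continuation hopen hw₀ fun w hw => ?_
  have havoid : ∀ t ∈ Set.Icc (0 : ℝ) 1,
      p + Complex.exp (AffineMap.lineMap w₀ w t) ∉ Λ := fun t ht hq => by
    simpa using hΛ _ hq ((mem_logHalfPlane_iff hδ).mp (hconv.lineMap_mem hw₀ hw ht))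
  obtain ⟨f, hf, hfg⟩ := exists_continuationOn hρ hρR hg hGg hext
    (γ := fun t => p + Complex.exp (AffineMap.lineMap w₀ w t)) (by simpa using hw₀R)
    (Continuous.continuousOn (by fun_prop)) havoid
  refine ⟨fun t w => f t (p + Complex.exp w), ContinuationOn.pullback hf fun t _ => he _, ?_⟩
  rw [AffineMap.lineMap_apply_zero] at hfg
  exact (he w₀).continuousAt.eventually hfg

theorem exists_isLocalBranch (hp : ‖p‖ = R) (hδ : 0 < δ)
    (hΛ : ∀ q ∈ Λ, q ∈ Metric.ball p δ → q = p) :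
    ∃ F : ℂ → ℂ, IsLocalBranch Λ ρ G p δ F ∧
      Set.EqOn g (F ∘ diskLog p) (Metric.ball 0 R ∩ Metric.ball p δ) := by
  obtain ⟨z, hz, hzp⟩ := exists_mem_ball_inter_ball (hρ.trans_le hρR) hp hδ
  subst hp
  have hmem : ∀ y ∈ Metric.ball 0 ‖p‖ ∩ Metric.ball p δ, diskLog p y ∈ logHalfPlane δ :=
    fun y hy => diskLog_mem_logHalfPlane hy.1 hy.2
  have hback {y : ℂ} (hy : y ∈ Metric.ball 0 ‖p‖) : p + Complex.exp (diskLog p y) = y := by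
    rw [exp_diskLog hy, add_sub_cancel]
  obtain ⟨F, hF, hFg⟩ := exists_analyticOnNhd_logHalfPlane hρ hρR hg hGg hext hδ hΛ (hmem z hz)
    (by rw [hback hz.1]; exact hz.1)
  refine ⟨F, ⟨hF.differentiableOn, _, hmem z hz, g, ?_, hFg⟩, ?_⟩
  · rw [hback hz.1]
    exact isBranchAt_of_mem_ball hρ hρR hg hGg hz.1 fun h => hzp (hΛ z h hz.2)
  · refine (hg.mono Set.inter_subset_left).eqOn_of_preconnected_of_eventuallyEq
      (fun y hy => (hF _ (hmem y hy)).comp (analyticAt_diskLog hy.1))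
      ((convex_ball _ _).inter (convex_ball _ _)).isPreconnected hz ?_
    filter_upwards [(analyticAt_diskLog hz.1).continuousAt.eventually hFg,
      Metric.isOpen_ball.mem_nhds hz.1] with y hFy hy
    rw [Function.comp_apply, hFy, hback hy]

end Extension

end Branches

/-! ### Coefficients and boundary behaviour of power series on the unit disk -/

section PowerSeries

variable {b : ℕ → ℂ} {f g : ℂ → ℂ} {r : ℝ} {D : ℕ}

theorem le_radius_ofScalars_of_summable {t : NNReal}
    (h : Summable fun n => b n * ((t : ℝ) : ℂ) ^ n) :
    (t : ℝ≥0∞) ≤ (FormalMultilinearSeries.ofScalars ℂ b).radius := by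
  refine FormalMultilinearSeries.le_radius_of_tendsto _ (l := 0) ?_
  have hnorm := h.tendsto_atTop_zero.norm
  rw [norm_zero] at hnorm
  refine hnorm.congr fun n => ?_
  rw [FormalMultilinearSeries.norm_apply_eq_norm_coef,
    FormalMultilinearSeries.coeff_ofScalars, norm_mul, norm_pow, Complex.norm_real]
  simp

theorem hasFPowerSeriesOnBall_of_hasSum (hr : 0 < r)
    (hf : ∀ z ∈ Metric.ball (0 : ℂ) r, HasSum (fun n => b n * z ^ n) (f z)) :
    HasFPowerSeriesOnBall f (FormalMultilinearSeries.ofScalars ℂ b) 0 (ENNReal.ofReal r) := by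
  refine ⟨?_, ENNReal.ofReal_pos.mpr hr, fun {y} hy => ?_⟩
  · refine ENNReal.le_of_forall_nnreal_lt fun t ht => le_radius_ofScalars_of_summable ?_
    have htr : (t : ℝ) < r := by
      rwa [← ENNReal.ofReal_coe_nnreal, ENNReal.ofReal_lt_ofReal_iff hr] at ht
    exact (hf _ (by simpa using htr)).summable
  · rw [Metric.eball_ofReal] at hy
    rw [zero_add]
    refine (hf y hy).congr_fun fun n => ?_
    rw [FormalMultilinearSeries.ofScalars_apply_eq, smul_eq_mul]

theorem analyticOnNhd_of_hasSum (hr : 0 < r)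
    (hf : ∀ z ∈ Metric.ball (0 : ℂ) r, HasSum (fun n => b n * z ^ n) (f z)) :
    AnalyticOnNhd ℂ f (Metric.ball 0 r) := by
  have h := (hasFPowerSeriesOnBall_of_hasSum hr hf).analyticOnNhd
  rwa [Metric.eball_ofReal] at h

theorem iteratedDeriv_zero_of_hasSum (hr : 0 < r)
    (hf : ∀ z ∈ Metric.ball (0 : ℂ) r, HasSum (fun n => b n * z ^ n) (f z)) (n : ℕ) :
    iteratedDeriv n f 0 = n.factorial * b n := by
  have h := (hasFPowerSeriesOnBall_of_hasSum hr hf).factorial_smul 1 n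
  rw [iteratedDeriv_eq_iteratedFDeriv, ← h, nsmul_eq_mul]
  congr 1
  exact FormalMultilinearSeries.coeff_ofScalars (𝕜 := ℂ) (p := b) (n := n)

theorem analyticOnNhd_iteratedDeriv {s : Set ℂ} (hf : AnalyticOnNhd ℂ f s) (n : ℕ) :
    AnalyticOnNhd ℂ (iteratedDeriv n f) s := by
  rw [iteratedDeriv_eq_iterate]
  exact hf.iterated_deriv n

/-- `f` is analytic, with bounded derivative of order `D`, in the part of the unit disk near `p`.
If this holds at every point of the closed disk, then the Taylor coefficients of `f` at `0` are
`O(n⁻ᴰ)`. -/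
def DerivBoundedAt (D : ℕ) (f : ℂ → ℂ) (p : ℂ) : Prop :=
  ∃ C : ℝ, ∀ᶠ z in 𝓝[Metric.ball 0 1] p, AnalyticAt ℂ f z ∧ ‖iteratedDeriv D f z‖ ≤ C

theorem derivBoundedAt_of_analyticAt {p : ℂ} (hf : AnalyticAt ℂ f p) (D : ℕ) :
    DerivBoundedAt D f p := by
  have hcont : ContinuousAt (iteratedDeriv D f) p := by
    rw [iteratedDeriv_eq_iterate]
    exact (hf.iterated_deriv D).continuousAt
  refine ⟨‖iteratedDeriv D f p‖ + 1, Eventually.filter_mono nhdsWithin_le_nhds ?_⟩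
  filter_upwards [hf.eventually_analyticAt, hcont.norm.eventually_lt_const (lt_add_one _)]
    with z hz hlt using ⟨hz, hlt.le⟩

theorem DerivBoundedAt.add {p : ℂ} (hf : DerivBoundedAt D f p) (hg : DerivBoundedAt D g p) :
    DerivBoundedAt D (fun z => f z + g z) p := by
  obtain ⟨C, hC⟩ := hf
  obtain ⟨C', hC'⟩ := hg
  refine ⟨C + C', ?_⟩
  filter_upwards [hC, hC'] with z hfz hgz
  refine ⟨hfz.1.add hgz.1, ?_⟩
  rw [iteratedDeriv_fun_add hfz.1.contDiffAt hgz.1.contDiffAt]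
  exact (norm_add_le _ _).trans (add_le_add hfz.2 hgz.2)

theorem DerivBoundedAt.sum {ι : Type*} {f : ι → ℂ → ℂ} {p : ℂ} (s : Finset ι)
    (hf : ∀ i ∈ s, DerivBoundedAt D (f i) p) : DerivBoundedAt D (fun z => ∑ i ∈ s, f i z) p := by
  classical
  induction s using Finset.induction_on with
  | empty => simpa using derivBoundedAt_of_analyticAt (analyticAt_const (v := (0 : ℂ))) D
  | insert i s hi ih =>
    simp only [Finset.sum_insert hi]
    exact (hf i (Finset.mem_insert_self i s)).add
      (ih fun j hj => hf j (Finset.mem_insert_of_mem hj))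

theorem DerivBoundedAt.congr {p : ℂ} (hf : DerivBoundedAt D f p)
    (h : f =ᶠ[𝓝[Metric.ball 0 1] p] g) : DerivBoundedAt D g p := by
  obtain ⟨C, hC⟩ := hf
  refine ⟨C, ?_⟩
  filter_upwards [hC, eventually_eventually_nhdsWithin.mpr h, self_mem_nhdsWithin]
    with z hfz hfg hz
  rw [Metric.isOpen_ball.nhdsWithin_eq hz] at hfg
  exact ⟨hfz.1.congr hfg, by rw [← EventuallyEq.iteratedDeriv_eq D hfg]; exact hfz.2⟩

theorem exists_bound_iteratedDeriv
    (h : ∀ p ∈ Metric.closedBall (0 : ℂ) 1, DerivBoundedAt D f p) :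
    ∃ C : ℝ, ∀ z ∈ Metric.ball (0 : ℂ) 1, ‖iteratedDeriv D f z‖ ≤ C := by
  obtain ⟨C, hC⟩ := (isCompact_closedBall (0 : ℂ) 1).induction_on
    (p := fun s => ∃ C : ℝ, ∀ z ∈ s ∩ Metric.ball (0 : ℂ) 1, ‖iteratedDeriv D f z‖ ≤ C)
    ⟨0, by simp⟩ (fun s t hst ⟨C, hC⟩ => ⟨C, fun z hz => hC z ⟨hst hz.1, hz.2⟩⟩)
    (fun s t ⟨C, hC⟩ ⟨C', hC'⟩ => ⟨max C C', fun z hz => hz.1.elim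
      (fun hs => (hC z ⟨hs, hz.2⟩).trans (le_max_left _ _))
      (fun ht => (hC' z ⟨ht, hz.2⟩).trans (le_max_right _ _))⟩)
    (fun p hp => by
      obtain ⟨C, hC⟩ := h p hp
      obtain ⟨U, hU, hUC⟩ := mem_nhdsWithin_iff_exists_mem_nhds_inter.mp hC
      exact ⟨U, mem_nhdsWithin_of_mem_nhds hU, C, fun z hz => (hUC hz).2⟩)
  exact ⟨C, fun z hz => hC z ⟨Metric.ball_subset_closedBall hz, hz⟩⟩

theorem factorial_mul_norm_coeff_le {C : ℝ}
    (hf : ∀ z ∈ Metric.ball (0 : ℂ) 1, HasSum (fun n => b n * z ^ n) (f z))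
    (hC : ∀ z ∈ Metric.ball (0 : ℂ) 1, ‖iteratedDeriv D f z‖ ≤ C) (n : ℕ) :
    ((n + D).factorial : ℝ) * ‖b (n + D)‖ ≤ n.factorial * C := by
  have hderiv : iteratedDeriv n (iteratedDeriv D f) 0 = (n + D).factorial * b (n + D) := by
    rw [← iteratedDeriv_zero_of_hasSum one_pos hf, iteratedDeriv_eq_iterate,
      iteratedDeriv_eq_iterate, iteratedDeriv_eq_iterate, ← Function.iterate_add_apply]
  have hcauchy : ∀ r : ℝ, 0 < r → r < 1 →
      ((n + D).factorial : ℝ) * ‖b (n + D)‖ ≤ n.factorial * C / r ^ n := by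
    intro r hr hr1
    have hsub : Metric.closedBall (0 : ℂ) r ⊆ Metric.ball 0 1 :=
      Metric.closedBall_subset_ball hr1
    have han := analyticOnNhd_iteratedDeriv (analyticOnNhd_of_hasSum one_pos hf) D
    have hle := Complex.norm_iteratedDeriv_le_of_forall_mem_sphere_norm_le n hr
      (DifferentiableOn.diffContOnCl (by
        rw [closure_ball _ hr.ne']
        exact (han.mono hsub).differentiableOn))
      (fun z hz => hC z (hsub (Metric.sphere_subset_closedBall hz)))
    rwa [hderiv, norm_mul, Complex.norm_natCast] at hle
  have hlim : Tendsto (fun r : ℝ => n.factorial * C / r ^ n) (𝓝[<] 1)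
      (𝓝 (n.factorial * C / 1 ^ n)) :=
    (tendsto_const_nhds.div (tendsto_id.pow n) (by simp)).mono_left nhdsWithin_le_nhds
  rw [one_pow, div_one] at hlim
  refine ge_of_tendsto hlim ?_
  filter_upwards [Ioo_mem_nhdsLT one_pos] with r hr using hcauchy r hr.1 hr.2

theorem isBigO_inv_pow_of_factorial_mul_norm_le {E : Type*} [NormedAddCommGroup E] {b : ℕ → E}
    {C : ℝ} (h : ∀ n : ℕ, ((n + D).factorial : ℝ) * ‖b (n + D)‖ ≤ n.factorial * C) :
    b =O[atTop] fun n => ((n : ℝ) ^ D)⁻¹ := by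
  refine IsBigO.of_bound (C * (D + 1) ^ D) (eventually_atTop.mpr ⟨D + 1, fun m hm => ?_⟩)
  obtain ⟨n, rfl⟩ : ∃ n, m = n + D := ⟨m - D, by omega⟩
  have hfac : (n.factorial : ℝ) * (n + 1) ^ D ≤ (n + D).factorial := by
    rw [← Nat.factorial_mul_ascFactorial n D]
    exact_mod_cast Nat.mul_le_mul_left _ (Nat.pow_succ_le_ascFactorial (n + 1) D)
  have hbound : ((n : ℝ) + 1) ^ D * ‖b (n + D)‖ ≤ C := by
    refine le_of_mul_le_mul_left ?_ (Nat.cast_pos.mpr n.factorial_pos)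
    calc _ = (n.factorial : ℝ) * (n + 1) ^ D * ‖b (n + D)‖ := by ring
      _ ≤ (n + D).factorial * ‖b (n + D)‖ := by gcongr
      _ ≤ _ := h n
  have hm0 : (0 : ℝ) < ((n + D : ℕ) : ℝ) := by exact_mod_cast (by omega : 0 < n + D)
  have hle : ((n + D : ℕ) : ℝ) ≤ (n + 1) * (D + 1) := by
    push_cast
    nlinarith [(by positivity : (0 : ℝ) ≤ n * D)]
  rw [Real.norm_of_nonneg (by positivity), ← div_eq_mul_inv, le_div_iff₀ (by positivity)]
  calc ‖b (n + D)‖ * ((n + D : ℕ) : ℝ) ^ D ≤ ‖b (n + D)‖ * ((n + 1) * (D + 1)) ^ D := by gcongr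
    _ = ((n : ℝ) + 1) ^ D * ‖b (n + D)‖ * (D + 1) ^ D := by rw [mul_pow]; ring
    _ ≤ _ := by gcongr

theorem isBigO_coeff_of_derivBoundedAt
    (hf : ∀ z ∈ Metric.ball (0 : ℂ) 1, HasSum (fun n => b n * z ^ n) (f z))
    (h : ∀ p ∈ Metric.sphere (0 : ℂ) 1, DerivBoundedAt D f p) :
    b =O[atTop] fun n => ((n : ℝ) ^ D)⁻¹ := by
  obtain ⟨C, hC⟩ := exists_bound_iteratedDeriv fun p hp => by
    rcases (mem_closedBall_zero_iff.mp hp).lt_or_eq with hlt | heq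
    · exact derivBoundedAt_of_analyticAt
        (analyticOnNhd_of_hasSum one_pos hf p (mem_ball_zero_iff.mpr hlt)) D
    · exact h p (mem_sphere_zero_iff_norm.mpr heq)
  exact isBigO_inv_pow_of_factorial_mul_norm_le (factorial_mul_norm_coeff_le hf hC)

theorem exists_uniform_analytic_extension {K U : Set ℂ} (hK : IsCompact K)
    (hext : ∀ p ∈ K, ∃ h : ℂ → ℂ, AnalyticAt ℂ h p ∧ g =ᶠ[𝓝[U] p] h) :
    ∃ ε > 0, ∀ p ∈ K, ∃ h : ℂ → ℂ, AnalyticOnNhd ℂ h (Metric.ball p ε) ∧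
      Set.EqOn g h (U ∩ Metric.ball p ε) := by
  have hlocal : ∀ p : K, ∃ r > 0, ∃ h : ℂ → ℂ, ∀ z ∈ Metric.ball (p : ℂ) r,
      AnalyticAt ℂ h z ∧ (z ∈ U → g z = h z) := by
    rintro ⟨p, hp⟩
    obtain ⟨h, hh, hgh⟩ := hext p hp
    obtain ⟨r, hr, hball⟩ := Metric.eventually_nhds_iff_ball.mp
      (hh.eventually_analyticAt.and (eventually_nhdsWithin_iff.mp hgh))
    exact ⟨r, hr, h, hball⟩
  choose r hr h hball using hlocal
  obtain ⟨ε, hε, hleb⟩ := lebesgue_number_lemma_of_metric hK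
    (fun p : K => Metric.isOpen_ball (x := (p : ℂ)) (ε := r p))
    (fun p hp => Set.mem_iUnion.mpr ⟨⟨p, hp⟩, Metric.mem_ball_self (hr _)⟩)
  refine ⟨ε, hε, fun p hp => ?_⟩
  obtain ⟨q, hq⟩ := hleb p hp
  exact ⟨h q, fun z hz => (hball q z (hq hz)).1, fun z hz => (hball q z (hq hz.2)).2 hz.1⟩

theorem exists_continuationOn_radius (hg : AnalyticOnNhd ℂ g (Metric.ball 0 1)) {ε : ℝ}
    (h : ∀ p ∈ Metric.sphere (0 : ℂ) 1, ∃ h : ℂ → ℂ, AnalyticOnNhd ℂ h (Metric.ball p ε) ∧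
      Set.EqOn g h (Metric.ball 0 1 ∩ Metric.ball p ε))
    {w : ℂ} (hw : w ∈ Metric.ball (0 : ℂ) (1 + ε)) :
    ∃ f : ℝ → ℂ → ℂ, ContinuationOn (AffineMap.lineMap 0 w) f (Set.Icc (0 : ℝ) 1) ∧ f 0 = g := by
  classical
  rcases eq_or_ne w 0 with rfl | hw0
  · exact ⟨fun _ => g, continuationOn_const fun t _ => hg _ (by simp), rfl⟩
  have hnorm : ‖w‖ ≠ 0 := norm_ne_zero_iff.mpr hw0
  obtain ⟨k, hk, hgk⟩ := h (w / ‖w‖) (by simp [hw0])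
  have hray (t : ℝ) : (AffineMap.lineMap 0 w t : ℂ) = t * w := by
    simp [AffineMap.lineMap_apply]
  have hinside {t : ℝ} (ht : t * ‖w‖ < 1) (ht0 : 0 ≤ t) : (t * w : ℂ) ∈ Metric.ball 0 1 := by
    simpa [abs_of_nonneg ht0] using ht
  have hnear {t : ℝ} (ht : |t * ‖w‖ - 1| < ε) : (t * w : ℂ) ∈ Metric.ball (w / ‖w‖) ε := by
    have hsub : (t * w - w / ‖w‖ : ℂ) = ((t * ‖w‖ - 1 : ℝ) : ℂ) * (w / ‖w‖) := by
      have hnorm' : (‖w‖ : ℂ) ≠ 0 := Complex.ofReal_ne_zero.mpr hnorm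
      push_cast
      field_simp
    rwa [mem_ball_iff_norm, hsub, norm_mul, Complex.norm_real, norm_div, Complex.norm_real,
      norm_norm, div_self hnorm, mul_one]
  refine ⟨fun t => if t * ‖w‖ < 1 then g else k, fun t ht => ?_, by simp⟩
  have hcont : Continuous fun t : ℝ => t * ‖w‖ := by fun_prop
  simp only [hray]
  split_ifs with ht1
  · refine ⟨hg _ (hinside ht1 ht.1), mem_nhdsWithin_of_mem_nhds ?_⟩
    filter_upwards [hcont.continuousAt.eventually_lt_const ht1] with s hs
    rw [if_pos hs]
  · have htε : |t * ‖w‖ - 1| < ε := by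
      rw [abs_of_nonneg (by linarith), sub_lt_iff_lt_add']
      exact (mul_le_of_le_one_left (norm_nonneg w) ht.2).trans_lt (by simpa using hw)
    refine ⟨hk _ (hnear htε), ?_⟩
    filter_upwards [self_mem_nhdsWithin, mem_nhdsWithin_of_mem_nhds
      ((hcont.sub continuous_const).abs.continuousAt.eventually_lt_const htε)] with s hs hsε
    split_ifs with hs1
    · exact hgk.eventuallyEq_of_mem ((Metric.isOpen_ball.inter Metric.isOpen_ball).mem_nhds
        ⟨hinside hs1 hs.1, hnear hsε⟩)
    · rfl

theorem exists_summable_of_analytic_extension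
    (hg : ∀ z ∈ Metric.ball (0 : ℂ) 1, HasSum (fun n => b n * z ^ n) (g z))
    (hext : ∀ p ∈ Metric.sphere (0 : ℂ) 1, ∃ h : ℂ → ℂ, AnalyticAt ℂ h p ∧
      g =ᶠ[𝓝[Metric.ball 0 1] p] h) :
    ∃ r : ℝ, 1 < r ∧ Summable fun n => b n * (r : ℂ) ^ n := by
  obtain ⟨ε, hε, h⟩ := exists_uniform_analytic_extension (isCompact_sphere (0 : ℂ) 1) hext
  obtain ⟨F, hF, hFg⟩ := exists_analyticOnNhd_of_continuation (φ := g) Metric.isOpen_ball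
    (Metric.mem_ball_self (by positivity : 0 < 1 + ε)) fun w hw => by
      obtain ⟨f, hf, rfl⟩ := exists_continuationOn_radius (analyticOnNhd_of_hasSum one_pos hg) h hw
      exact ⟨f, hf, EventuallyEq.rfl⟩
  refine ⟨1 + ε / 2, by linarith, ?_⟩
  have hmem : ((1 + ε / 2 : ℝ) : ℂ) ∈ Metric.ball (0 : ℂ) (1 + ε) := by
    rw [mem_ball_zero_iff, Complex.norm_real, Real.norm_of_nonneg (by linarith)]
    linarith
  refine (Complex.hasSum_taylorSeries_on_ball hF.differentiableOn hmem).summable.congr fun n => ?_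
  rw [EventuallyEq.iteratedDeriv_eq n hFg, iteratedDeriv_zero_of_hasSum one_pos hg, sub_zero,
    smul_eq_mul, smul_eq_mul]
  have hfac : (n.factorial : ℂ) ≠ 0 := Nat.cast_ne_zero.mpr n.factorial_ne_zero
  field_simp

end PowerSeries

/-! ### Logarithmic singularities on the unit circle -/

section Singularities

/-- The function `(log u)ᵏ uˢ`, with principal values. -/
noncomputable def logPower (s : ℝ) (k : ℕ) (u : ℂ) : ℂ :=
  Complex.log u ^ k * Complex.exp (s * Complex.log u)

theorem analyticAt_logPower (s : ℝ) (k : ℕ) {u : ℂ} (hu : u ∈ Complex.slitPlane) :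
    AnalyticAt ℂ (logPower s k) u :=
  ((analyticAt_clog hu).pow k).mul ((analyticAt_const.mul (analyticAt_clog hu)).cexp)

theorem tendsto_log_norm_atBot : Tendsto (fun v : ℂ => Real.log ‖v‖) (𝓝[≠] 0) atBot :=
  Real.tendsto_log_nhdsGT_zero.comp tendsto_norm_nhdsNE_zero

theorem isBigO_clog_log_norm : Complex.log =O[𝓝[≠] 0] fun v => Real.log ‖v‖ := by
  refine IsBigO.of_bound (1 + Real.pi) ?_
  filter_upwards [tendsto_log_norm_atBot.eventually_le_atBot (-1)] with v hv
  have habs : 1 ≤ |Real.log ‖v‖| := by rw [abs_of_neg (by linarith)]; linarith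
  calc ‖Complex.log v‖ ≤ |Real.log ‖v‖| + |v.arg| := by
        simpa only [Complex.log_re, Complex.log_im] using
          Complex.norm_le_abs_re_add_abs_im (Complex.log v)
    _ ≤ |Real.log ‖v‖| + Real.pi * |Real.log ‖v‖| := by
        gcongr
        exact (Complex.abs_arg_le_pi v).trans (le_mul_of_one_le_right Real.pi_pos.le habs)
    _ = _ := by rw [Real.norm_eq_abs]; ring

theorem isBigO_logPower {s t : ℝ} (hts : t < s) (k : ℕ) :
    logPower s k =O[𝓝[≠] 0] fun v => ‖v‖ ^ t := by
  have hlog : (fun v : ℂ => Real.log ‖v‖ ^ k) =O[𝓝[≠] 0] fun v => ‖v‖ ^ (t - s) := by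
    have h := ((isLittleO_abs_log_rpow_rpow_nhdsGT_zero k (sub_neg.mpr hts)).comp_tendsto
      (tendsto_norm_nhdsNE_zero (E := ℂ))).isBigO
    have hnorm : (fun v : ℂ => ‖Real.log ‖v‖ ^ k‖) =O[𝓝[≠] 0] fun v => ‖v‖ ^ (t - s) :=
      h.congr_left fun v => by simp
    exact hnorm.of_norm_left
  have hexp : (fun v : ℂ => Complex.exp (s * Complex.log v)) =O[𝓝[≠] 0] fun v => ‖v‖ ^ s := by
    refine IsBigO.of_bound' (eventually_mem_nhdsWithin.mono fun v hv => ?_)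
    rw [Complex.norm_exp, Complex.re_ofReal_mul, Complex.log_re,
      Real.rpow_def_of_pos (norm_pos_iff.mpr hv), mul_comm]
    exact le_abs_self _
  refine (((isBigO_clog_log_norm.pow k).trans hlog).mul hexp).congr' EventuallyEq.rfl ?_
  filter_upwards [self_mem_nhdsWithin] with v hv
  rw [← Real.rpow_add (norm_pos_iff.mpr hv), sub_add_cancel]

theorem tendsto_exp_log_div {N : ℕ} (hN : N ≠ 0) :
    Tendsto (fun v : ℂ => Complex.exp (Complex.log v / N)) (𝓝[≠] 0) (𝓝 0) := by
  rw [Complex.tendsto_exp_nhds_zero_iff]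
  refine (tendsto_log_norm_atBot.atBot_div_const (Nat.cast_pos.mpr hN.pos)).congr fun v => ?_
  rw [Complex.div_natCast_re, Complex.log_re]

theorem mem_slitPlane_of_dist_le {u v : ℂ} (hu : 0 < u.re) (h : dist v u ≤ ‖u‖ / 2) :
    v ∈ Complex.slitPlane := by
  by_contra hv
  rw [Complex.mem_slitPlane_iff] at hv
  push Not at hv
  have hpos : 0 < ‖u‖ := norm_pos_iff.mpr fun h0 => by simp [h0] at hu
  have hle : ‖u‖ ≤ ‖u - v‖ := by
    rw [Complex.norm_def, Complex.norm_def]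
    refine Real.sqrt_le_sqrt ?_
    rw [Complex.normSq_apply, Complex.normSq_apply, Complex.sub_re, Complex.sub_im, hv.2]
    nlinarith [hv.1]
  rw [dist_comm, dist_eq_norm] at h
  linarith

theorem norm_iteratedDeriv_le_of_norm_le_dist_pow {f : ℂ → ℂ} {z p : ℂ} {C : ℝ} {D : ℕ}
    (hzp : z ≠ p) (hf : ∀ x ∈ Metric.closedBall z (dist z p / 2),
      AnalyticAt ℂ f x ∧ ‖f x‖ ≤ C * dist x p ^ D) :
    ‖iteratedDeriv D f z‖ ≤ D.factorial * (3 ^ D * C) := by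
  have hpos : 0 < dist z p := dist_pos.mpr hzp
  have hC : 0 ≤ C := nonneg_of_mul_nonneg_left ((norm_nonneg _).trans
    (hf z (Metric.mem_closedBall_self (by positivity))).2) (by positivity)
  have hsphere (x : ℂ) (hx : x ∈ Metric.sphere z (dist z p / 2)) :
      ‖f x‖ ≤ C * (3 * (dist z p / 2)) ^ D := by
    refine (hf x (Metric.sphere_subset_closedBall hx)).2.trans ?_
    gcongr
    have := dist_triangle x z p
    rw [Metric.mem_sphere] at hx
    linarith
  have hd : DiffContOnCl ℂ f (Metric.ball z (dist z p / 2)) := by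
    refine DifferentiableOn.diffContOnCl ?_
    rw [closure_ball _ (by positivity)]
    exact fun x hx => (hf x hx).1.differentiableAt.differentiableWithinAt
  refine (Complex.norm_iteratedDeriv_le_of_forall_mem_sphere_norm_le D (by positivity) hd
    hsphere).trans_eq ?_
  rw [mul_pow]
  field_simp

theorem dist_one_sub_div {ζ : ℂ} (hζ : ‖ζ‖ = 1) (x y : ℂ) :
    dist (1 - x / ζ) (1 - y / ζ) = dist x y := by
  rw [dist_sub_left, dist_eq_norm, dist_eq_norm, ← sub_div, norm_div, hζ, div_one]

theorem tendsto_one_sub_div {ζ : ℂ} (hζ : ζ ≠ 0) :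
    Tendsto (fun z => 1 - z / ζ) (𝓝[Metric.ball 0 ‖ζ‖] ζ) (𝓝[Complex.slitPlane] 0) := by
  refine tendsto_nhdsWithin_iff.mpr ⟨?_, eventually_mem_nhdsWithin.mono fun z =>
    one_sub_div_mem_slitPlane⟩
  have hcont : ContinuousAt (fun z : ℂ => 1 - z / ζ) ζ := by fun_prop
  simpa [div_self hζ] using hcont.tendsto.mono_left nhdsWithin_le_nhds

theorem nhdsWithin_slitPlane_le : 𝓝[Complex.slitPlane] (0 : ℂ) ≤ 𝓝[≠] 0 :=
  nhdsWithin_mono _ fun _ => Complex.slitPlane_ne_zero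

theorem derivBoundedAt_of_isBigO {φ : ℂ → ℂ} {D : ℕ} {ζ : ℂ} (hζ : ‖ζ‖ = 1)
    (han : ∀ᶠ v in 𝓝[Complex.slitPlane] 0, AnalyticAt ℂ φ v)
    (hφ : φ =O[𝓝[Complex.slitPlane] 0] fun v => ‖v‖ ^ D) :
    DerivBoundedAt D (fun z => φ (1 - z / ζ)) ζ := by
  have hζ0 : ζ ≠ 0 := norm_pos_iff.mp (hζ ▸ one_pos)
  obtain ⟨C, hC⟩ := hφ.bound
  obtain ⟨ε, hε, hball⟩ := Metric.mem_nhdsWithin_iff.mp (han.and hC)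
  refine ⟨D.factorial * (3 ^ D * C), ?_⟩
  filter_upwards [self_mem_nhdsWithin, mem_nhdsWithin_of_mem_nhds
    (Metric.ball_mem_nhds ζ (half_pos hε))] with z hz hzε
  have hnorm (x : ℂ) : ‖1 - x / ζ‖ = dist x ζ := by
    simpa [div_self hζ0] using dist_one_sub_div hζ x ζ
  have hre : 0 < (1 - z / ζ).re := by
    have hlt : ‖z / ζ‖ < 1 := by simpa [hζ] using hz
    simpa using (Complex.re_le_norm _).trans_lt hlt
  have hnear (x : ℂ) (hx : x ∈ Metric.closedBall z (dist z ζ / 2)) :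
      AnalyticAt ℂ (fun z => φ (1 - z / ζ)) x ∧ ‖φ (1 - x / ζ)‖ ≤ C * dist x ζ ^ D := by
    rw [Metric.mem_closedBall] at hx
    have hx' : dist (1 - x / ζ) (1 - z / ζ) ≤ ‖1 - z / ζ‖ / 2 := by
      rwa [dist_one_sub_div hζ, hnorm]
    have hlt : ‖1 - x / ζ‖ < ε := by
      have := dist_triangle x z ζ
      rw [Metric.mem_ball] at hzε
      rw [hnorm]
      linarith
    obtain ⟨hφx, hle⟩ := hball ⟨mem_ball_zero_iff.mpr hlt, mem_slitPlane_of_dist_le hre hx'⟩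
    refine ⟨AnalyticAt.fun_comp hφx (analyticAt_const.sub analyticAt_id.div_const), ?_⟩
    simpa [hnorm] using hle
  have hzζ : z ≠ ζ := by
    rintro rfl
    simp [hζ] at hz
  exact ⟨(hnear z (Metric.mem_closedBall_self (by positivity))).1,
    norm_iteratedDeriv_le_of_norm_le_dist_pow hzζ hnear⟩

theorem derivBoundedAt_logPower_mul {s : ℝ} {D : ℕ} (hs : D < s) (k : ℕ) {N : ℕ} (hN : N ≠ 0)
    {Q : ℂ → ℂ} (hQ : AnalyticAt ℂ Q 0) {ζ : ℂ} (hζ : ‖ζ‖ = 1) :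
    DerivBoundedAt D (fun z => logPower s k (1 - z / ζ) *
      Q (Complex.exp (Complex.log (1 - z / ζ) / N))) ζ := by
  have hexp := (tendsto_exp_log_div hN).mono_left nhdsWithin_slitPlane_le
  refine derivBoundedAt_of_isBigO
    (φ := fun v => logPower s k v * Q (Complex.exp (Complex.log v / N))) hζ ?_ ?_
  · filter_upwards [self_mem_nhdsWithin, hexp.eventually hQ.eventually_analyticAt] with v hv hQv
    exact (analyticAt_logPower s k hv).mul
      (AnalyticAt.fun_comp hQv ((analyticAt_clog hv).div_const).cexp)
  · simpa using ((isBigO_logPower hs k).mono nhdsWithin_slitPlane_le).mul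
      ((hQ.continuousAt.tendsto.comp hexp).isBigO_one ℝ)

end Singularities

/-! ### Darboux's method -/

section Taylor

variable {H : ℂ → ℂ}

/-- The function `(H y - ∑_{j<J} βⱼ yʲ) / yᴶ`, where `βⱼ` are the Taylor coefficients of `H` at the
origin. -/
noncomputable def taylorRemainder (H : ℂ → ℂ) (J : ℕ) : ℂ → ℂ :=
  (Function.swap dslope 0)^[J] H

/-- The Taylor coefficients at the origin. -/
noncomputable def taylorCoeff (H : ℂ → ℂ) (j : ℕ) : ℂ := taylorRemainder H j 0

theorem analyticAt_taylorRemainder (hH : AnalyticAt ℂ H 0) (J : ℕ) :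
    AnalyticAt ℂ (taylorRemainder H J) 0 := by
  obtain ⟨p, hp⟩ := hH
  exact (hp.has_fpower_series_iterate_dslope_fslope J).analyticAt

theorem eq_sum_taylorCoeff_add (H : ℂ → ℂ) (J : ℕ) (y : ℂ) :
    H y = ∑ j ∈ Finset.range J, taylorCoeff H j * y ^ j + y ^ J * taylorRemainder H J y := by
  induction J with
  | zero => simp [taylorRemainder]
  | succ J ih =>
    have hstep := sub_smul_dslope (taylorRemainder H J) 0 y
    rw [sub_zero, smul_eq_mul] at hstep
    rw [Finset.sum_range_succ, taylorRemainder, Function.iterate_succ_apply', Function.swap,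
      ← taylorRemainder, pow_succ, mul_assoc, hstep, taylorCoeff]
    linear_combination ih

end Taylor

section Darboux

variable {N M m : ℕ} {g : ℂ → ℂ} {b : ℕ → ℂ} {Z : Finset ℂ} {ζ : ℂ}

/-- The boundary behaviour, on the unit disk, of a function with finitely many singularities `ζ ∈ Z`
on the unit circle, at which it is a polynomial in `log u` with coefficients that are Laurent series
in `u^(1/N)`, where `u = 1 - z / ζ`. -/
structure HasPuiseuxLogSingularities (N M m : ℕ) (Z : Finset ℂ) (H : ℂ → ℕ → ℂ → ℂ)
    (g : ℂ → ℂ) : Prop where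
  ne_zero : N ≠ 0
  norm_eq_one : ∀ ζ ∈ Z, ‖ζ‖ = 1
  analyticAt_coeff : ∀ ζ ∈ Z, ∀ k, AnalyticAt ℂ (H ζ k) 0
  exists_extension : ∀ p ∈ Metric.sphere (0 : ℂ) 1, p ∉ Z →
    ∃ h : ℂ → ℂ, AnalyticAt ℂ h p ∧ g =ᶠ[𝓝[Metric.ball 0 1] p] h
  eventuallyEq : ∀ ζ ∈ Z,
    g =ᶠ[𝓝[Metric.ball 0 1] ζ] fun z => puiseuxLog N M m (H ζ) (Complex.log (1 - z / ζ))

theorem logPower_mul_exp_pow (M N k j : ℕ) (u : ℂ) :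
    Complex.log u ^ k * (Complex.exp (-(M / N) * Complex.log u) *
      Complex.exp (Complex.log u / N) ^ j) = logPower ((j - M) / N) k u := by
  rw [logPower, ← Complex.exp_nat_mul, ← Complex.exp_add]
  congr 2
  push_cast
  ring

theorem analyticAt_logPower_one_sub_div (s : ℝ) (k : ℕ) (hζ : ‖ζ‖ = 1) {p : ℂ}
    (hp : ‖p‖ = 1) (hne : p ≠ ζ) : AnalyticAt ℂ (fun z => logPower s k (1 - z / ζ)) p := by
  have hζ0 : ζ ≠ 0 := norm_pos_iff.mp (hζ ▸ one_pos)
  have hslit : 1 - p / ζ ∈ Complex.slitPlane := by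
    refine Complex.mem_slitPlane_iff.mpr (or_iff_not_imp_left.mpr fun hre him => ?_)
    have hre' : (p / ζ).re = 1 := by
      refine le_antisymm ((Complex.re_le_norm _).trans_eq (by simp [hp, hζ])) ?_
      simpa using hre
    refine hne ((div_eq_one_iff_eq hζ0).mp (Complex.ext hre' ?_))
    simpa using him
  exact AnalyticAt.fun_comp (analyticAt_logPower s k hslit)
    (analyticAt_const.sub analyticAt_id.div_const)

theorem hasSum_logPower_one_sub_div (s : ℝ) (k : ℕ) (hζ : ‖ζ‖ = 1) {z : ℂ}
    (hz : z ∈ Metric.ball (0 : ℂ) 1) :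
    HasSum (fun n => logCoeff s k n * ζ⁻¹ ^ n * z ^ n) (logPower s k (1 - z / ζ)) := by
  have h : z / ζ ∈ Metric.ball (0 : ℂ) 1 := by simpa [hζ] using hz
  refine (hasSum_logCoeff s k h).congr_fun fun n => ?_
  rw [div_pow, inv_pow]
  ring

/-- The terms with `j < J` of the expansion of `puiseuxLog N M m H` at `log (1 - z / ζ)` into the
functions `(log u)ᵏ u^((j-M)/N)`, `u = 1 - z / ζ`. -/
noncomputable def singularPart (N M m : ℕ) (H : ℕ → ℂ → ℂ) (J : ℕ) (ζ z : ℂ) : ℂ :=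
  ∑ k ∈ Finset.range m, ∑ j ∈ Finset.range J,
    taylorCoeff (H k) j * logPower ((j - M) / N) k (1 - z / ζ)

/-- The Taylor coefficients at the origin of `singularPart N M m H J ζ`. -/
noncomputable def singularCoeff (N M m : ℕ) (H : ℕ → ℂ → ℂ) (J : ℕ) (ζ : ℂ) (n : ℕ) : ℂ :=
  ∑ k ∈ Finset.range m, ∑ j ∈ Finset.range J,
    taylorCoeff (H k) j * (logCoeff ((j - M) / N) k n * ζ⁻¹ ^ n)

theorem hasSum_singularPart (H : ℕ → ℂ → ℂ) (J : ℕ) (hζ : ‖ζ‖ = 1) {z : ℂ}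
    (hz : z ∈ Metric.ball (0 : ℂ) 1) :
    HasSum (fun n => singularCoeff N M m H J ζ n * z ^ n) (singularPart N M m H J ζ z) := by
  simp only [singularPart, singularCoeff, Finset.sum_mul, mul_assoc (taylorCoeff _ _)]
  exact hasSum_sum fun k _ => hasSum_sum fun j _ =>
    (hasSum_logPower_one_sub_div _ k hζ hz).mul_left _

theorem analyticAt_singularPart (H : ℕ → ℂ → ℂ) (J : ℕ) (hζ : ‖ζ‖ = 1) {p : ℂ} (hp : ‖p‖ = 1)
    (hne : p ≠ ζ) : AnalyticAt ℂ (singularPart N M m H J ζ) p :=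
  Finset.analyticAt_fun_sum _ fun k _ => Finset.analyticAt_fun_sum _ fun _ _ =>
    analyticAt_const.mul (analyticAt_logPower_one_sub_div _ k hζ hp hne)

theorem puiseuxLog_log_one_sub_div (H : ℕ → ℂ → ℂ) (J : ℕ) (ζ z : ℂ) :
    puiseuxLog N M m H (Complex.log (1 - z / ζ)) = singularPart N M m H J ζ z +
      ∑ k ∈ Finset.range m, logPower ((J - M) / N) k (1 - z / ζ) *
        taylorRemainder (H k) J (Complex.exp (Complex.log (1 - z / ζ) / N)) := by
  rw [puiseuxLog, singularPart, ← Finset.sum_add_distrib]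
  refine Finset.sum_congr rfl fun k _ => ?_
  rw [eq_sum_taylorCoeff_add (H k) J, mul_add, mul_add, Finset.mul_sum, Finset.mul_sum,
    ← logPower_mul_exp_pow]
  congr 1
  · refine Finset.sum_congr rfl fun j _ => ?_
    rw [← logPower_mul_exp_pow]
    ring
  · ring

theorem derivBoundedAt_sub_singularPart {H : ℕ → ℂ → ℂ} (hN : N ≠ 0) (hζ : ‖ζ‖ = 1)
    (hH : ∀ k, AnalyticAt ℂ (H k) 0)
    (hg : g =ᶠ[𝓝[Metric.ball 0 1] ζ] fun z => puiseuxLog N M m H (Complex.log (1 - z / ζ)))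
    {J D : ℕ} (hD : (D : ℝ) < (J - M) / N) :
    DerivBoundedAt D (fun z => g z + -singularPart N M m H J ζ z) ζ := by
  refine DerivBoundedAt.congr (DerivBoundedAt.sum (Finset.range m) fun k _ =>
    derivBoundedAt_logPower_mul hD k hN (analyticAt_taylorRemainder (hH k) J) hζ) ?_
  filter_upwards [hg] with z hz
  rw [hz, puiseuxLog_log_one_sub_div H J, add_comm, neg_add_cancel_left]

theorem HasPuiseuxLogSingularities.derivBoundedAt {H : ℂ → ℕ → ℂ → ℂ}
    (h : HasPuiseuxLogSingularities N M m Z H g) {J D : ℕ} (hD : (D : ℝ) < (J - M) / N) {p : ℂ}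
    (hp : p ∈ Metric.sphere (0 : ℂ) 1) :
    DerivBoundedAt D (fun z => g z + ∑ ζ ∈ Z, -singularPart N M m (H ζ) J ζ z) p := by
  have hp1 : ‖p‖ = 1 := mem_sphere_zero_iff_norm.mp hp
  have hother (ζ : ℂ) (hζ : ζ ∈ Z) (hne : p ≠ ζ) :
      DerivBoundedAt D (fun z => -singularPart N M m (H ζ) J ζ z) p :=
    derivBoundedAt_of_analyticAt
      (analyticAt_singularPart (H ζ) J (h.norm_eq_one ζ hζ) hp1 hne).fun_neg D
  by_cases hpZ : p ∈ Z
  · have hlocal := derivBoundedAt_sub_singularPart h.ne_zero hp1 (h.analyticAt_coeff p hpZ)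
      (h.eventuallyEq p hpZ) hD
    refine (hlocal.add (DerivBoundedAt.sum (Z.erase p) fun ζ hζ =>
      hother ζ (Finset.mem_of_mem_erase hζ) (Finset.ne_of_mem_erase hζ).symm)).congr ?_
    filter_upwards with z
    rw [← Finset.add_sum_erase Z _ hpZ, add_assoc]
  · obtain ⟨k, hk, hgk⟩ := h.exists_extension p hp hpZ
    exact ((derivBoundedAt_of_analyticAt hk D).congr hgk.symm).add
      (DerivBoundedAt.sum Z fun ζ hζ => hother ζ hζ fun heq => hpZ (heq ▸ hζ))

theorem HasPuiseuxLogSingularities.isBigO_sub_singularCoeff {H : ℂ → ℕ → ℂ → ℂ}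
    (h : HasPuiseuxLogSingularities N M m Z H g)
    (hg : ∀ z ∈ Metric.ball (0 : ℂ) 1, HasSum (fun n => b n * z ^ n) (g z))
    {J D : ℕ} (hD : (D : ℝ) < (J - M) / N) :
    (fun n => b n + ∑ ζ ∈ Z, -singularCoeff N M m (H ζ) J ζ n) =O[atTop]
      fun n => ((n : ℝ) ^ D)⁻¹ := by
  refine isBigO_coeff_of_derivBoundedAt (fun z hz => ?_) fun p hp => h.derivBoundedAt hD hp
  simp only [add_mul, Finset.sum_mul, neg_mul]
  exact (hg z hz).add (hasSum_sum fun ζ hζ =>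
    (hasSum_singularPart (H ζ) J (h.norm_eq_one ζ hζ) hz).neg)

end Darboux

/-! ### Rapidly decaying coefficients -/

section RadialExpansion

variable {b : ℕ → ℂ}

theorem norm_one_sub_pow_sub_sum_choose_le {u : ℂ} (hu : ‖1 - u‖ ≤ 1) (n D : ℕ) :
    ‖(1 - u) ^ n - ∑ i ∈ Finset.range D, (n.choose i : ℂ) * (-u) ^ i‖ ≤ n.choose D * ‖u‖ ^ D := by
  induction n generalizing D with
  | zero => cases D <;> simp [Finset.sum_range_succ', Nat.choose_zero_succ]
  | succ n ih =>
    cases D with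
    | zero => simpa using pow_le_one₀ (norm_nonneg _) hu
    | succ D =>
      have hpascal : (1 - u) ^ (n + 1) -
          ∑ i ∈ Finset.range (D + 1), ((n + 1).choose i : ℂ) * (-u) ^ i =
          ((1 - u) ^ n - ∑ i ∈ Finset.range (D + 1), (n.choose i : ℂ) * (-u) ^ i) +
          (-u) * ((1 - u) ^ n - ∑ i ∈ Finset.range D, (n.choose i : ℂ) * (-u) ^ i) := by
        rw [Finset.sum_range_succ', Finset.sum_range_succ' _ D, mul_sub, Finset.mul_sum]
        simp only [Nat.choose_succ_succ, Nat.cast_add, add_mul, Finset.sum_add_distrib,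
          Nat.choose_zero_right]
        have hshift : ∑ i ∈ Finset.range D, (n.choose i : ℂ) * (-u) ^ (i + 1) =
            ∑ i ∈ Finset.range D, -u * ((n.choose i : ℂ) * (-u) ^ i) :=
          Finset.sum_congr rfl fun i _ => by ring
        rw [hshift]
        ring
      calc _ ≤ (n.choose (D + 1) : ℝ) * ‖u‖ ^ (D + 1) + ‖u‖ * (n.choose D * ‖u‖ ^ D) := by
            rw [hpascal]
            refine (norm_add_le _ _).trans (add_le_add (ih _) ?_)
            rw [norm_mul, norm_neg]
            exact mul_le_mul_of_nonneg_left (ih D) (norm_nonneg u)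
        _ = (n + 1).choose (D + 1) * ‖u‖ ^ (D + 1) := by
            rw [Nat.choose_succ_succ]
            push_cast
            ring

theorem summable_norm_mul_choose (hb : ∀ D : ℕ, b =O[atTop] fun n => ((n : ℝ) ^ D)⁻¹) (i : ℕ) :
    Summable fun n => ‖b n‖ * (n.choose i : ℝ) := by
  have hchoose : (fun n : ℕ => (n.choose i : ℝ)) =O[atTop] fun n : ℕ => (n : ℝ) ^ i :=
    isBigO_of_le _ fun n => by
      rw [Real.norm_natCast, norm_pow, Real.norm_natCast]
      exact_mod_cast Nat.choose_le_pow n i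
  refine summable_of_isBigO_nat (Real.summable_nat_pow_inv.mpr one_lt_two)
    (((hb (i + 2)).norm_left.mul hchoose).congr' .rfl ?_)
  filter_upwards [eventually_ne_atTop 0] with n hn
  have : (n : ℝ) ≠ 0 := Nat.cast_ne_zero.mpr hn
  rw [pow_add]
  field_simp

theorem exists_taylor_tsum_one_sub_pow
    (hb : ∀ D : ℕ, b =O[atTop] fun n => ((n : ℝ) ^ D)⁻¹) :
    ∃ t : ℕ → ℂ, ∀ D : ℕ, ∃ C : ℝ, ∀ u : ℂ, ‖1 - u‖ ≤ 1 →
      ‖∑' n, b n * (1 - u) ^ n - ∑ i ∈ Finset.range D, t i * u ^ i‖ ≤ C * ‖u‖ ^ D := by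
  have hchoose (i : ℕ) : Summable fun n => b n * (n.choose i : ℂ) :=
    .of_norm (by simpa using summable_norm_mul_choose hb i)
  refine ⟨fun i => ∑' n, b n * n.choose i * (-1) ^ i, fun D =>
    ⟨∑' n, ‖b n‖ * n.choose D, fun u hu => ?_⟩⟩
  have hpow : Summable fun n => b n * (1 - u) ^ n := by
    refine .of_norm_bounded (by simpa using summable_norm_mul_choose hb 0) fun n => ?_
    rw [norm_mul, norm_pow]
    exact mul_le_of_le_one_right (norm_nonneg _) (pow_le_one₀ (norm_nonneg _) hu)
  have hremainder : HasSum
      (fun n => b n * ((1 - u) ^ n - ∑ i ∈ Finset.range D, (n.choose i : ℂ) * (-u) ^ i))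
      (∑' n, b n * (1 - u) ^ n -
        ∑ i ∈ Finset.range D, (∑' n, b n * n.choose i * (-1) ^ i) * u ^ i) := by
    simp only [mul_sub, Finset.mul_sum]
    refine hpow.hasSum.sub (hasSum_sum fun i _ => ?_)
    refine ((((hchoose i).mul_right ((-1) ^ i)).hasSum).mul_right (u ^ i)).congr_fun fun n => ?_
    rw [neg_pow u]
    ring
  have hmajorant := (summable_norm_mul_choose hb D).hasSum.mul_right (‖u‖ ^ D)
  refine hremainder.norm_le_of_bounded hmajorant fun n => ?_
  rw [norm_mul, mul_assoc]
  exact mul_le_mul_of_nonneg_left (norm_one_sub_pow_sub_sum_choose_le hu n D) (norm_nonneg _)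

end RadialExpansion

section Uniqueness

theorem eventually_eq_zero_of_isBigO_pow {f : ℂ → ℂ} (hf : AnalyticAt ℂ f 0)
    (h : ∀ D : ℕ, f =O[𝓝 0] fun y => y ^ D) : ∀ᶠ y in 𝓝 0, f y = 0 := by
  by_contra hne
  obtain ⟨n, g, hg, hg0, hfg⟩ := hf.exists_eventuallyEq_pow_smul_nonzero_iff.mpr hne
  simp only [sub_zero, smul_eq_mul] at hfg
  refine hg0 (tendsto_nhds_unique (hg.continuousAt.tendsto.mono_left nhdsWithin_le_nhds)
    (?_ : Tendsto g (𝓝[≠] 0) (𝓝 0)))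
  have hquot : g =O[𝓝[≠] 0] fun y => y := by
    have hprod := ((isBigO_refl (fun y : ℂ => (y ^ n)⁻¹) (𝓝[≠] 0)).mul
      ((h (n + 1)).mono nhdsWithin_le_nhds))
    refine hprod.congr' ?_ ?_
    · filter_upwards [hfg.filter_mono nhdsWithin_le_nhds, self_mem_nhdsWithin] with y hy hy0
      rw [hy, inv_mul_cancel_left₀ (pow_ne_zero n hy0)]
    · filter_upwards [self_mem_nhdsWithin] with y hy0
      rw [pow_succ, inv_mul_cancel_left₀ (pow_ne_zero n hy0)]
  exact hquot.trans_tendsto (tendsto_id.mono_left nhdsWithin_le_nhds)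

theorem polynomial_eq_zero_of_tendsto_atBot {P : Polynomial ℂ}
    (h : Tendsto (fun x : ℝ => P.eval (x : ℂ)) atBot (𝓝 0)) : P = 0 := by
  have hdeg : P.degree ≤ 0 := not_lt.mp fun hdeg => by
    refine not_tendsto_nhds_of_tendsto_atTop (P.tendsto_norm_atTop hdeg ?_) _ h.norm
    simpa using tendsto_abs_atBot_atTop
  rw [Polynomial.eq_C_of_degree_le_zero hdeg] at h ⊢
  simp only [Polynomial.eval_C, tendsto_const_nhds_iff] at h
  rw [h, Polynomial.C_0]

theorem tendsto_ofReal_pow_mul_exp_atBot (k : ℕ) :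
    Tendsto (fun x : ℝ => (x : ℂ) ^ k * Complex.exp x) atBot (𝓝 0) := by
  refine tendsto_zero_iff_norm_tendsto_zero.mpr
    (((Real.tendsto_pow_mul_exp_neg_atTop_nhds_zero k).comp tendsto_neg_atBot_atTop).congr'
      ?_)
  filter_upwards [eventually_le_atBot 0] with x hx
  rw [Function.comp_apply, neg_neg, norm_mul, norm_pow, Complex.norm_real, Complex.norm_exp,
    Real.norm_of_nonpos hx, Complex.ofReal_re]

theorem tendsto_cexp_ofReal_atBot :
    Tendsto (fun x : ℝ => Complex.exp x) atBot (𝓝 0) := by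
  simpa using tendsto_ofReal_pow_mul_exp_atBot 0

theorem apply_zero_eq_zero_of_tendsto_sum_pow_mul_comp_exp {m : ℕ} {A : ℕ → ℂ → ℂ}
    (hA : ∀ k, AnalyticAt ℂ (A k) 0)
    (h : Tendsto (fun x : ℝ => ∑ k ∈ Finset.range m, (x : ℂ) ^ k * A k (Complex.exp x)) atBot
      (𝓝 0)) {k : ℕ} (hk : k < m) : A k 0 = 0 := by
  have hremainder : Tendsto (fun x : ℝ => ∑ k ∈ Finset.range m,
      (x : ℂ) ^ k * Complex.exp x * dslope (A k) 0 (Complex.exp x)) atBot (𝓝 0) := by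
    rw [← Finset.sum_const_zero (s := Finset.range m)]
    refine tendsto_finsetSum _ fun k _ => ?_
    simpa using (tendsto_ofReal_pow_mul_exp_atBot k).mul
      ((analyticAt_dslope (hA k)).continuousAt.tendsto.comp tendsto_cexp_ofReal_atBot)
  have hP : (∑ k ∈ Finset.range m, Polynomial.monomial k (A k 0)) = 0 := by
    refine polynomial_eq_zero_of_tendsto_atBot ?_
    have hsub := h.sub hremainder
    rw [sub_zero (0 : ℂ)] at hsub
    refine hsub.congr fun x => ?_
    rw [← Finset.sum_sub_distrib, Polynomial.eval_finsetSum]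
    refine Finset.sum_congr rfl fun k _ => ?_
    have hslope := sub_smul_dslope (A k) 0 (Complex.exp x)
    rw [sub_zero, smul_eq_mul] at hslope
    rw [Polynomial.eval_monomial]
    linear_combination -(x : ℂ) ^ k * hslope
  simpa [Polynomial.finsetSum_coeff, Polynomial.coeff_monomial, hk] using
    congrArg (Polynomial.coeff · k) hP

theorem isBigO_pow_of_sum_pow_mul_comp_exp {m : ℕ} (J : ℕ) {A : ℕ → ℂ → ℂ}
    (hA : ∀ k, AnalyticAt ℂ (A k) 0)
    (h : (fun x : ℝ => ∑ k ∈ Finset.range m, (x : ℂ) ^ k * A k (Complex.exp x)) =O[atBot]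
      fun x => Complex.exp x ^ J) {k : ℕ} (hk : k < m) :
    A k =O[𝓝 0] fun y => y ^ J := by
  induction J generalizing A with
  | zero => simpa using (hA k).continuousAt.norm.isBoundedUnder_le.isBigO_one ℂ
  | succ J ih =>
    have hzero (k : ℕ) (hk : k < m) : A k 0 = 0 := by
      refine apply_zero_eq_zero_of_tendsto_sum_pow_mul_comp_exp hA (h.trans_tendsto ?_) hk
      simpa using tendsto_cexp_ofReal_atBot.pow (J + 1)
    have hslope := ih (A := fun k => dslope (A k) 0) (fun k => analyticAt_dslope (hA k)) ?_
    · refine ((isBigO_refl (fun y : ℂ => y) (𝓝 0)).mul hslope).congr (fun y => ?_) fun y => ?_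
      · exact (eq_smul_dslope_zero (hzero k hk) y).symm
      · rw [pow_succ']
    · refine ((isBigO_refl (fun x : ℝ => (Complex.exp x)⁻¹) atBot).mul h).congr (fun x => ?_)
        fun x => ?_
      · rw [Finset.mul_sum]
        refine Finset.sum_congr rfl fun k hk => ?_
        rw [eq_smul_dslope_zero (hzero k (Finset.mem_range.mp hk)), smul_eq_mul, mul_left_comm,
          inv_mul_cancel_left₀ (Complex.exp_ne_zero _)]
      · rw [pow_succ', inv_mul_cancel_left₀ (Complex.exp_ne_zero _)]

end Uniqueness

section AnalyticContinuation

variable {N M m : ℕ} {t : ℕ → ℂ} {H : ℕ → ℂ → ℂ}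

theorem exp_neg_div_mul_mul_exp_div_pow (N M : ℕ) (w : ℂ) :
    Complex.exp (-(M / N) * w) * Complex.exp (w / N) ^ M = 1 := by
  rw [← Complex.exp_nat_mul, ← Complex.exp_add, ← Complex.exp_zero]
  congr 1
  ring

theorem isBigO_coeff_of_puiseuxLog (hN : N ≠ 0) (hH : ∀ k, AnalyticAt ℂ (H k) 0)
    (h : ∀ D : ℕ, (fun x : ℝ => puiseuxLog N M m H x -
      ∑ i ∈ Finset.range D, t i * Complex.exp x ^ i) =O[atBot] fun x => Complex.exp x ^ D)
    (D : ℕ) {k : ℕ} (hk : k < m) :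
    (fun y => (N : ℂ) ^ k * H k y -
      if k = 0 then y ^ M * ∑ i ∈ Finset.range D, t i * (y ^ N) ^ i else 0) =O[𝓝 0]
        fun y => y ^ D := by
  have hNc : (N : ℂ) ≠ 0 := Nat.cast_ne_zero.mpr hN
  refine isBigO_pow_of_sum_pow_mul_comp_exp D (A := fun k y => (N : ℂ) ^ k * H k y -
    if k = 0 then y ^ M * ∑ i ∈ Finset.range D, t i * (y ^ N) ^ i else 0) (fun k => ?_) ?_ hk
  · refine (analyticAt_const.mul (hH k)).sub ?_
    split_ifs <;> fun_prop
  have hscaled := (h D).comp_tendsto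
    (tendsto_id.const_mul_atBot (Nat.cast_pos.mpr (Nat.pos_of_ne_zero hN) : (0 : ℝ) < N))
  refine (((isBigO_refl (fun x : ℝ => Complex.exp x ^ M) atBot).mul hscaled).congr_left
    fun x => ?_).trans (IsBigO.of_bound 1 ?_)
  · have hm : 0 ∈ Finset.range m := Finset.mem_range.mpr (by omega)
    simp only [Function.comp_apply, id, puiseuxLog, mul_sub, mul_ite, mul_zero,
      Finset.sum_sub_distrib, Finset.sum_ite_eq', hm, if_true, Complex.ofReal_mul,
      Complex.ofReal_natCast, Finset.mul_sum, pow_zero, one_mul, Complex.exp_nat_mul,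
      mul_div_cancel_left₀ _ hNc]
    congr 1
    refine Finset.sum_congr rfl fun k _ => ?_
    have hcancel := exp_neg_div_mul_mul_exp_div_pow N M (N * x)
    rw [mul_div_cancel_left₀ _ hNc] at hcancel
    linear_combination ((N : ℂ) * x) ^ k * H k (Complex.exp x) * hcancel
  · filter_upwards [eventually_le_atBot 0] with x hx
    have hexp : ‖Complex.exp x‖ ≤ 1 := by simpa [Complex.norm_exp] using hx
    rw [Function.comp_apply, id, Complex.ofReal_mul, Complex.ofReal_natCast, Complex.exp_nat_mul,
      ← pow_mul, ← pow_add, one_mul, norm_pow, norm_pow]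
    exact pow_le_pow_of_le_one (norm_nonneg _) hexp
      (le_add_left (Nat.le_mul_of_pos_left D (Nat.pos_of_ne_zero hN)))

theorem eventually_comp_mul_eq_pow_mul {B : ℂ → ℂ} (hB : AnalyticAt ℂ B 0)
    (h : ∀ D : ℕ, (fun y => B y - y ^ M * ∑ i ∈ Finset.range D, t i * (y ^ N) ^ i) =O[𝓝 0]
      fun y => y ^ D) {η : ℂ} (hη : η ^ N = 1) :
    ∀ᶠ y in 𝓝 0, B (η * y) = η ^ M * B y := by
  have htend : Tendsto (fun y : ℂ => η * y) (𝓝 0) (𝓝 0) := by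
    simpa using (continuous_const_mul η).tendsto 0
  have hcomp : AnalyticAt ℂ (fun y => B (η * y)) 0 :=
    AnalyticAt.fun_comp (by simpa using hB) (by fun_prop)
  refine (eventually_eq_zero_of_isBigO_pow (hcomp.sub (analyticAt_const.mul hB))
    fun D => ?_).mono fun y hy => sub_eq_zero.mp hy
  have hrotated : (fun y => B (η * y) -
      (η * y) ^ M * ∑ i ∈ Finset.range D, t i * ((η * y) ^ N) ^ i) =O[𝓝 0] fun y => y ^ D :=
    ((h D).comp_tendsto htend).trans (IsBigO.of_bound (‖η‖ ^ D) (.of_forall fun y => by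
      simp [mul_pow]))
  refine (hrotated.sub ((h D).const_mul_left (η ^ M))).congr_left fun y => ?_
  simp only [mul_pow _ _ N, hη, one_mul]
  simp only [Pi.sub_apply, Pi.mul_apply]
  ring

theorem exists_comp_exp_of_invariant (hN : N ≠ 0) {B : ℂ → ℂ} (hB : AnalyticAt ℂ B 0)
    (hM : B =O[𝓝 0] fun y => y ^ M)
    (hinv : ∀ᶠ y in 𝓝 0, B (Complex.exp (2 * Real.pi * Complex.I / N) * y) =
      Complex.exp (2 * Real.pi * Complex.I / N) ^ M * B y) :
    ∃ h : ℂ → ℂ, AnalyticAt ℂ h 0 ∧ ∃ c : ℝ, ∀ w : ℂ, w.re < c →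
      Complex.exp (-(M / N) * w) * B (Complex.exp (w / N)) = h (Complex.exp w) := by
  obtain ⟨C, hC⟩ := hM.bound
  obtain ⟨r, hr, hball⟩ := Metric.eventually_nhds_iff_ball.mp
    (hB.eventually_analyticAt.and (hinv.and hC))
  set c : ℝ := N * Real.log r
  have hmem {w : ℂ} (hw : w.re < c) : Complex.exp (w / N) ∈ Metric.ball (0 : ℂ) r := by
    rwa [mem_ball_zero_iff, Complex.norm_exp, ← Real.lt_log_iff_exp_lt hr, Complex.div_natCast_re,
      div_lt_iff₀' (Nat.cast_pos.mpr (Nat.pos_of_ne_zero hN))]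
  have hperiodic (w : ℂ) (hw : w.re < c) :
      Complex.exp (-(M / N) * (w + 2 * Real.pi * Complex.I)) *
          B (Complex.exp ((w + 2 * Real.pi * Complex.I) / N)) =
        Complex.exp (-(M / N) * w) * B (Complex.exp (w / N)) := by
    rw [add_div, mul_add, Complex.exp_add, Complex.exp_add, mul_comm (Complex.exp (w / N)),
      (hball _ (hmem hw)).2.1]
    linear_combination Complex.exp (-(M / N) * w) * B (Complex.exp (w / N)) *
      exp_neg_div_mul_mul_exp_div_pow N M (2 * Real.pi * Complex.I)
  have hdiff : DifferentiableOn ℂ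
      (fun w => Complex.exp (-(M / N) * w) * B (Complex.exp (w / N))) {w | w.re < c} :=
    fun w hw => (DifferentiableAt.mul (by fun_prop) (DifferentiableAt.fun_comp' w
      (hball _ (hmem hw)).1.differentiableAt (by fun_prop))).differentiableWithinAt
  have hbdd (w : ℂ) (hw : w.re < c) :
      ‖Complex.exp (-(M / N) * w) * B (Complex.exp (w / N))‖ ≤ C := by
    rw [norm_mul]
    refine (mul_le_mul_of_nonneg_left (hball _ (hmem hw)).2.2 (norm_nonneg _)).trans_eq ?_
    rw [mul_left_comm, ← norm_mul, exp_neg_div_mul_mul_exp_div_pow, norm_one, mul_one]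
  obtain ⟨h, hh, hBh⟩ := exists_analyticAt_comp_exp hdiff hperiodic
    (IsBigO.of_bound C (eventually_stripEnd_iff.mpr ⟨c, fun w hw _ => by
      simpa using hbdd w hw⟩))
  exact ⟨h, hh, c, hBh⟩

theorem exists_eventually_puiseuxLog_eq_comp_exp (hN : N ≠ 0) (hH : ∀ k, AnalyticAt ℂ (H k) 0)
    (h : ∀ D : ℕ, (fun x : ℝ => puiseuxLog N M m H x -
      ∑ i ∈ Finset.range D, t i * Complex.exp x ^ i) =O[atBot] fun x => Complex.exp x ^ D) :
    ∃ h : ℂ → ℂ, AnalyticAt ℂ h 0 ∧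
      ∀ᶠ w in comap Complex.re atBot, puiseuxLog N M m H w = h (Complex.exp w) := by
  rcases m with _ | m
  · exact ⟨0, analyticAt_const, .of_forall fun w => by simp [puiseuxLog]⟩
  have hcoeff := isBigO_coeff_of_puiseuxLog hN hH h
  have hpositive (k : ℕ) (hk : k ∈ Finset.range m) : ∀ᶠ y in 𝓝 0, H (k + 1) y = 0 := by
    refine (eventually_eq_zero_of_isBigO_pow (analyticAt_const.mul (hH (k + 1))) fun D => by
      simpa [Pi.mul_def] using hcoeff D (Nat.succ_lt_succ (Finset.mem_range.mp hk))).mono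
        fun y hy => ?_
    exact (mul_eq_zero.mp hy).resolve_left (pow_ne_zero _ (Nat.cast_ne_zero.mpr hN))
  have hzero (D : ℕ) : (fun y => H 0 y - y ^ M * ∑ i ∈ Finset.range D, t i * (y ^ N) ^ i)
      =O[𝓝 0] fun y => y ^ D := by simpa using hcoeff D m.succ_pos
  have hpole : H 0 =O[𝓝 0] fun y => y ^ M := by
    have hpoly : (fun y : ℂ => ∑ i ∈ Finset.range M, t i * (y ^ N) ^ i) =O[𝓝 0]
        fun _ => (1 : ℂ) := (Continuous.tendsto (by fun_prop) 0).isBigO_one ℂ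
    have hprod := (isBigO_refl (fun y : ℂ => y ^ M) (𝓝 0)).mul hpoly
    simp only [mul_one] at hprod
    simpa using (hzero M).add hprod
  have hroot : Complex.exp (2 * Real.pi * Complex.I / N) ^ N = 1 := by
    rw [← Complex.exp_nat_mul, mul_div_cancel₀ _ (Nat.cast_ne_zero.mpr hN),
      Complex.exp_two_pi_mul_I]
  obtain ⟨h, hh, c, hHh⟩ := exists_comp_exp_of_invariant hN (hH 0) hpole
    (eventually_comp_mul_eq_pow_mul (hH 0) hzero hroot)
  have hexp : Tendsto (fun w : ℂ => Complex.exp (w / N)) (comap Complex.re atBot) (𝓝 0) := by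
    refine Complex.tendsto_exp_nhds_zero_iff.mpr ?_
    simp only [Complex.div_natCast_re]
    exact tendsto_comap.atBot_div_const (Nat.cast_pos.mpr hN.pos)
  refine ⟨h, hh, ?_⟩
  filter_upwards [hexp.eventually ((Finset.eventually_all (Finset.range m)).mpr hpositive),
    tendsto_comap.eventually (eventually_lt_atBot c)] with w hw hwc
  rw [puiseuxLog, Finset.sum_range_succ', Finset.sum_eq_zero fun k hk => by
    rw [hw k hk, mul_zero, mul_zero], zero_add, pow_zero, one_mul, hHh w hwc]

theorem tendsto_log_one_sub_div {ζ : ℂ} (hζ : ζ ≠ 0) :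
    Tendsto (fun z => Complex.log (1 - z / ζ)) (𝓝[Metric.ball 0 ‖ζ‖] ζ)
      (comap Complex.re atBot) :=
  tendsto_comap_iff.mpr (by
    simpa [Function.comp_def, Complex.log_re] using tendsto_log_norm_atBot.comp
      ((tendsto_one_sub_div hζ).mono_right nhdsWithin_slitPlane_le))

variable {g : ℂ → ℂ} {b : ℕ → ℂ} {Z : Finset ℂ}

theorem exists_isBigO_puiseuxLog_sub {ζ : ℂ} (hζ : ‖ζ‖ = 1)
    (hgH : g =ᶠ[𝓝[Metric.ball 0 1] ζ] fun z => puiseuxLog N M m H (Complex.log (1 - z / ζ)))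
    (hg : ∀ z ∈ Metric.ball (0 : ℂ) 1, HasSum (fun n => b n * z ^ n) (g z))
    (hb : ∀ D : ℕ, b =O[atTop] fun n => ((n : ℝ) ^ D)⁻¹) :
    ∃ t : ℕ → ℂ, ∀ D : ℕ, (fun x : ℝ => puiseuxLog N M m H x -
      ∑ i ∈ Finset.range D, t i * Complex.exp x ^ i) =O[atBot] fun x => Complex.exp x ^ D := by
  have hζ0 : ζ ≠ 0 := norm_pos_iff.mp (hζ ▸ one_pos)
  obtain ⟨t, ht⟩ := exists_taylor_tsum_one_sub_pow (b := fun n => b n * ζ ^ n) fun D =>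
    IsBigO.of_norm_left ((hb D).norm_left.congr_left fun n => by simp [hζ])
  refine ⟨t, fun D => ?_⟩
  obtain ⟨C, hC⟩ := ht D
  have hradial : Tendsto (fun x : ℝ => ζ * (1 - Complex.exp x)) atBot
      (𝓝[Metric.ball 0 1] ζ) := by
    refine tendsto_nhdsWithin_iff.mpr ⟨?_, ?_⟩
    · simpa using ((tendsto_const_nhds (x := (1 : ℂ))).sub tendsto_cexp_ofReal_atBot).const_mul ζ
    · filter_upwards [eventually_lt_atBot 0] with x hx
      have hx1 : Real.exp x < 1 := by simpa using hx
      rw [mem_ball_zero_iff, norm_mul, hζ, one_mul, ← Complex.ofReal_exp, ← Complex.ofReal_one,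
        ← Complex.ofReal_sub, Complex.norm_real, Real.norm_of_nonneg (sub_nonneg.mpr hx1.le)]
      linarith [Real.exp_pos x]
  refine IsBigO.of_bound C ?_
  filter_upwards [hradial.eventually hgH, hradial.eventually self_mem_nhdsWithin] with x hx hball
  have hlog : Complex.log (1 - ζ * (1 - Complex.exp x) / ζ) = x := by
    rw [mul_div_cancel_left₀ _ hζ0, sub_sub_cancel, ← Complex.ofReal_exp, ← Complex.ofReal_log
      (Real.exp_pos x).le, Real.log_exp]
  rw [hlog] at hx
  have hsum := (hg _ hball).tsum_eq
  simp only [mul_pow, ← mul_assoc] at hsum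
  rw [← hx, ← hsum, norm_pow]
  have hnorm := mem_ball_zero_iff.mp hball
  rw [norm_mul, hζ, one_mul] at hnorm
  exact hC _ hnorm.le

theorem HasPuiseuxLogSingularities.exists_extension_of_isBigO {H : ℂ → ℕ → ℂ → ℂ}
    (h : HasPuiseuxLogSingularities N M m Z H g)
    (hg : ∀ z ∈ Metric.ball (0 : ℂ) 1, HasSum (fun n => b n * z ^ n) (g z))
    (hb : ∀ D : ℕ, b =O[atTop] fun n => ((n : ℝ) ^ D)⁻¹) {ζ : ℂ} (hζ : ζ ∈ Z) :
    ∃ φ : ℂ → ℂ, AnalyticAt ℂ φ ζ ∧ g =ᶠ[𝓝[Metric.ball 0 1] ζ] φ := by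
  have hζ1 := h.norm_eq_one ζ hζ
  have hζ0 : ζ ≠ 0 := norm_pos_iff.mp (hζ1 ▸ one_pos)
  obtain ⟨t, ht⟩ := exists_isBigO_puiseuxLog_sub hζ1 (h.eventuallyEq ζ hζ) hg hb
  obtain ⟨φ, hφ, hHφ⟩ :=
    exists_eventually_puiseuxLog_eq_comp_exp h.ne_zero (h.analyticAt_coeff ζ hζ) ht
  have hlog := tendsto_log_one_sub_div hζ0
  have hu := tendsto_one_sub_div hζ0
  rw [hζ1] at hlog hu
  refine ⟨fun z => φ (1 - z / ζ), AnalyticAt.fun_comp (by simpa [hζ0] using hφ)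
    (analyticAt_const.sub analyticAt_id.div_const), ?_⟩
  filter_upwards [h.eventuallyEq ζ hζ, hlog.eventually hHφ, hu.eventually self_mem_nhdsWithin]
    with z hgz hHz hslit
  rw [hgz, hHz, Complex.exp_log (Complex.slitPlane_ne_zero hslit)]

theorem HasPuiseuxLogSingularities.exists_summable_of_isBigO {H : ℂ → ℕ → ℂ → ℂ}
    (h : HasPuiseuxLogSingularities N M m Z H g)
    (hg : ∀ z ∈ Metric.ball (0 : ℂ) 1, HasSum (fun n => b n * z ^ n) (g z))
    (hb : ∀ D : ℕ, b =O[atTop] fun n => ((n : ℝ) ^ D)⁻¹) :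
    ∃ r : ℝ, 1 < r ∧ Summable fun n => b n * (r : ℂ) ^ n := by
  refine exists_summable_of_analytic_extension hg fun p hp => ?_
  by_cases hpZ : p ∈ Z
  · exact h.exists_extension_of_isBigO hg hb hpZ
  · exact h.exists_extension p hp hpZ

end AnalyticContinuation

/-! ### Expansions along an arithmetic progression of exponents -/

section Grid

theorem isBigO_nilssonMonomial (α : ℚ) {l l' : ℕ} (h : l' ≤ l) :
    nilssonMonomial (α, l') =O[atTop] nilssonMonomial (α, l) := by
  refine IsBigO.of_bound 1 ?_
  filter_upwards [(Real.tendsto_log_atTop.comp tendsto_natCast_atTop_atTop).eventually_ge_atTop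
    (1 : ℝ)] with n hn
  have hlog : 1 ≤ Real.log n := hn
  have : 0 ≤ Real.log n := zero_le_one.trans hlog
  rw [one_mul, nilssonMonomial, nilssonMonomial, Real.norm_of_nonneg (by positivity),
    Real.norm_of_nonneg (by positivity)]
  gcongr

theorem isLittleO_nilssonMonomial_of_exponent_lt {α α' : ℚ} (h : α < α') (l l' : ℕ) :
    nilssonMonomial (α', l') =o[atTop] nilssonMonomial (α, l) := by
  refine IsLittleO.trans_isBigO ?_ (isBigO_nilssonMonomial α (Nat.zero_le l))
  have hlog := ((isLittleO_log_rpow_rpow_atTop (l' : ℝ)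
    (sub_pos.mpr (Rat.cast_lt.mpr h) : (0 : ℝ) < α' - α)).comp_tendsto
      (tendsto_natCast_atTop_atTop (R := ℝ))).mul_isBigO
        (isBigO_refl (fun n : ℕ => ((n : ℝ) ^ (α' : ℝ))⁻¹) atTop)
  refine hlog.congr' (.of_forall fun n => ?_) ?_
  · simp only [Function.comp_apply, nilssonMonomial, Real.rpow_natCast, div_eq_mul_inv]
  · filter_upwards [eventually_gt_atTop 0] with n hn
    have hn0 : (0 : ℝ) < n := Nat.cast_pos.mpr hn
    rw [Function.comp_apply, nilssonMonomial, pow_zero, ← Real.rpow_neg hn0.le,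
      ← Real.rpow_add hn0, one_div, ← Real.rpow_neg hn0.le]
    congr 1
    ring

theorem isLittleO_nilssonMonomial_of_log_lt (α : ℚ) {l l' : ℕ} (h : l' < l) :
    nilssonMonomial (α, l') =o[atTop] nilssonMonomial (α, l) := by
  have hlog : (fun _ : ℕ => (1 : ℝ)) =o[atTop] fun n : ℕ => Real.log n ^ (l - l') :=
    isLittleO_one_left_iff ℝ |>.mpr <| tendsto_norm_atTop_atTop.comp <|
      (tendsto_pow_atTop (Nat.sub_ne_zero_of_lt h)).comp <|
        Real.tendsto_log_atTop.comp tendsto_natCast_atTop_atTop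
  refine ((isBigO_refl (nilssonMonomial (α, l')) atTop).mul_isLittleO hlog).congr
    (fun n => mul_one _) fun n => ?_
  rw [nilssonMonomial, nilssonMonomial, div_mul_eq_mul_div, ← pow_add,
    Nat.add_sub_cancel' h.le]

theorem isBigO_nilssonMonomial_of_le {α α' : ℚ} {l l' : ℕ} (hα : α ≤ α') (hl : l' ≤ l) :
    nilssonMonomial (α', l') =O[atTop] nilssonMonomial (α, l) := by
  rcases hα.lt_or_eq with h | rfl
  · exact (isLittleO_nilssonMonomial_of_exponent_lt h l l').isBigO
  · exact isBigO_nilssonMonomial α hl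

/-- The `q`-th exponent of `1 / n` in the expansion of the coefficients of a function whose
singularities are Puiseux series in `u ^ (1 / N)` starting with `u ^ (- M / N)`. The summand `1`
is the one in `[z ^ n] (1 - z) ^ s ≈ n ^ (- s - 1)`. -/
def puiseuxExponent (N M q : ℕ) : ℚ := ((q : ℚ) - M) / N + 1

variable {N : ℕ}

theorem puiseuxExponent_add_mul (hN : N ≠ 0) (M j i : ℕ) :
    puiseuxExponent N M (j + i * N) = puiseuxExponent N M j + i := by
  have hN0 : (N : ℚ) ≠ 0 := Nat.cast_ne_zero.mpr hN
  rw [puiseuxExponent, puiseuxExponent]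
  push_cast
  field_simp
  ring

theorem puiseuxExponent_strictMono (hN : N ≠ 0) (M : ℕ) : StrictMono (puiseuxExponent N M) := by
  intro p q h
  have : (0 : ℚ) < N := Nat.cast_pos.mpr (Nat.pos_of_ne_zero hN)
  rw [puiseuxExponent, puiseuxExponent]
  gcongr

theorem floor_puiseuxExponent (hN : N ≠ 0) (M q : ℕ) :
    ⌊(puiseuxExponent N M q - 1) * N + M⌋₊ = q := by
  rw [puiseuxExponent, add_sub_cancel_right, div_mul_cancel₀ _ (Nat.cast_ne_zero.mpr hN),
    sub_add_cancel, Nat.floor_natCast]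

theorem mem_nilssonIndex_image_puiseuxExponent_iff (hN : N ≠ 0) {M d : ℕ} {ω : ℚ × ℕ} :
    ω ∈ nilssonIndex ((Finset.range N).image (puiseuxExponent N M)) d ↔
      ∃ q, ω.1 = puiseuxExponent N M q ∧ ω.2 ≤ d := by
  rw [nilssonIndex, Set.mem_ofPred_eq]
  constructor
  · rintro ⟨⟨s, hs, k, hk⟩, hd⟩
    obtain ⟨q, -, rfl⟩ := Finset.mem_image.mp hs
    exact ⟨q + k * N, by rw [hk, puiseuxExponent_add_mul hN], hd⟩
  · rintro ⟨q, hq, hd⟩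
    have hmod := Finset.mem_range.mpr (Nat.mod_lt q (Nat.pos_of_ne_zero hN))
    refine ⟨⟨_, Finset.mem_image_of_mem _ hmod, q / N, ?_⟩, hd⟩
    rw [← puiseuxExponent_add_mul hN, hq, Nat.mul_comm, Nat.mod_add_div]

theorem sum_nilssonInitial_puiseuxExponent {E : Type*} [AddCommMonoid E] (hN : N ≠ 0)
    (M d q β : ℕ) (f : ℚ × ℕ → E) :
    ∑ ω ∈ nilssonInitial ((Finset.range N).image (puiseuxExponent N M)) d
        (puiseuxExponent N M q, β), f ω =
      ∑ p ∈ Finset.range (q + 1) ×ˢ Finset.range (d + 1) with p.1 < q ∨ β ≤ p.2,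
        f (puiseuxExponent N M p.1, p.2) := by
  have hmono := puiseuxExponent_strictMono hN M
  have hmem (p l : ℕ) : (puiseuxExponent N M p, l) ∈ nilssonInitial
      ((Finset.range N).image (puiseuxExponent N M)) d (puiseuxExponent N M q, β) ↔
        l ≤ d ∧ (p < q ∨ p = q ∧ β ≤ l) := by
    simp [nilssonInitial, mem_nilssonIndex_image_puiseuxExponent_iff hN, NilssonLE,
      hmono.lt_iff_lt, hmono.injective.eq_iff]
  refine (Finset.sum_of_injOn (fun p : ℕ × ℕ => (puiseuxExponent N M p.1, p.2)) ?_ ?_ ?_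
    fun p _ => rfl).symm
  · rintro ⟨p, l⟩ _ ⟨p', l'⟩ _ h
    simpa [hmono.injective.eq_iff] using h
  · rintro ⟨p, l⟩ h
    simp only [Finset.coe_filter, Finset.mem_product, Finset.mem_range, Set.mem_ofPred_eq] at h
    exact (hmem p l).mpr (by omega)
  · rintro ⟨α, l⟩ hα hnot
    obtain ⟨p, rfl : α = _, -⟩ := (mem_nilssonIndex_image_puiseuxExponent_iff hN).mp
      ((nilssonInitial_finite _ _ _).mem_toFinset.mp hα).1
    refine absurd ⟨(p, l), ?_, rfl⟩ hnot
    have := (hmem p l).mp hα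
    simp only [Finset.coe_filter, Finset.mem_product, Finset.mem_range, Set.mem_ofPred_eq]
    omega

/-- The partial sum of length `Q` of the formal expansion with coefficients `c q l` along the
monomials with exponents `puiseuxExponent N M q` and at most `d` logarithms. -/
noncomputable def gridSum (N M d : ℕ) (c : ℕ → ℕ → ℂ) (Q n : ℕ) : ℂ :=
  ∑ q ∈ Finset.range Q, ∑ l ∈ Finset.range (d + 1),
    c q l * (nilssonMonomial (puiseuxExponent N M q, l) n : ℂ)

/-- The sequence `b` is asymptotic to `∑ u ∈ U, gridSum N M d (C u) ∞ n * u ^ n`. -/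
def HasGridExpansion (N M d : ℕ) (U : Finset ℂ) (C : ℂ → ℕ → ℕ → ℂ) (b : ℕ → ℂ) : Prop :=
  ∀ Q : ℕ, (fun n => b n - ∑ u ∈ U, gridSum N M d (C u) Q n * u ^ n) =O[atTop]
    nilssonMonomial (puiseuxExponent N M Q, d)

theorem gridSum_congr {M d Q : ℕ} {c c' : ℕ → ℕ → ℂ}
    (h : ∀ q < Q, ∀ l ≤ d, c q l = c' q l) (n : ℕ) : gridSum N M d c Q n = gridSum N M d c' Q n :=
  Finset.sum_congr rfl fun q hq => Finset.sum_congr rfl fun l hl => by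
    rw [h q (Finset.mem_range.mp hq) l (Nat.lt_succ_iff.mp (Finset.mem_range.mp hl))]

theorem gridSum_sum_mul {ι : Type*} (s : Finset ι) (x : ι → ℂ) (c : ι → ℕ → ℕ → ℂ)
    (M d Q n : ℕ) :
    gridSum N M d (fun q l => ∑ i ∈ s, x i * c i q l) Q n =
      ∑ i ∈ s, x i * gridSum N M d (c i) Q n := by
  simp only [gridSum, Finset.sum_mul, Finset.mul_sum, mul_assoc]
  rw [Finset.sum_comm (s := s)]
  exact Finset.sum_congr rfl fun q _ => Finset.sum_comm

theorem sum_gridSum_mul_pow (U : Finset ℂ) (C : ℂ → ℕ → ℕ → ℂ) (M d Q n : ℕ) :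
    ∑ u ∈ U, gridSum N M d (C u) Q n * u ^ n =
      ∑ p ∈ Finset.range Q ×ˢ Finset.range (d + 1),
        (nilssonMonomial (puiseuxExponent N M p.1, p.2) n : ℂ) *
          ∑ u ∈ U, C u p.1 p.2 * u ^ n := by
  simp only [gridSum, Finset.sum_product, Finset.sum_mul, Finset.mul_sum]
  rw [Finset.sum_comm]
  refine Finset.sum_congr rfl fun q _ => Finset.sum_comm.trans ?_
  exact Finset.sum_congr rfl fun l _ => Finset.sum_congr rfl fun u _ => by ring

theorem sum_range_extend {α E : Type*} [Zero α] [AddCommMonoid E] {φ : ℕ → ℕ}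
    (hφ : Function.Injective φ) {I Q : ℕ} (hI : ∀ i, i < I ↔ φ i < Q) (e : ℕ → α)
    (f : ℕ → α → E) (hf : ∀ q, f q 0 = 0) :
    ∑ q ∈ Finset.range Q, f q (Function.extend φ e 0 q) = ∑ i ∈ Finset.range I, f (φ i) (e i) := by
  refine (Finset.sum_of_injOn φ hφ.injOn (fun i hi => ?_) (fun q hq hnot => ?_) fun i _ => ?_).symm
  · simpa using (hI i).mp (by simpa using hi)
  · rw [Function.extend_apply', Pi.zero_apply, hf]
    rintro ⟨i, rfl⟩
    exact hnot ⟨i, by simpa using (hI i).mpr (Finset.mem_range.mp hq), rfl⟩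
  · rw [hφ.extend_apply]

theorem lt_sub_ceilDiv_iff (hN : N ≠ 0) {j Q i : ℕ} : i < (Q - j) ⌈/⌉ N ↔ j + i * N < Q := by
  rw [← not_le, ceilDiv_le_iff_le_mul (Nat.pos_of_ne_zero hN), Nat.sub_le_iff_le_add', not_le,
    mul_comm]

theorem gridSum_extend (hN : N ≠ 0) {k d : ℕ} (hk : k ≤ d) (M j Q n : ℕ) (e : ℕ → ℕ → ℂ) :
    gridSum N M d
        (Function.extend (fun i => j + i * N) (fun i l => if l ≤ k then e i l else 0) 0) Q n =
      ∑ i ∈ Finset.range ((Q - j) ⌈/⌉ N), ∑ l ∈ Finset.range (k + 1),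
        e i l * (nilssonMonomial (puiseuxExponent N M (j + i * N), l) n : ℂ) := by
  have hinj : Function.Injective fun i => j + i * N := fun i i' h =>
    Nat.eq_of_mul_eq_mul_right (Nat.pos_of_ne_zero hN) (Nat.add_left_cancel h)
  have hfilter : {l ∈ Finset.range (d + 1) | l ≤ k} = Finset.range (k + 1) := by
    ext l
    simp only [Finset.mem_filter, Finset.mem_range]
    omega
  refine (sum_range_extend hinj (fun i => lt_sub_ceilDiv_iff hN) _
    (fun q (c : ℕ → ℂ) => ∑ l ∈ Finset.range (d + 1),
      c l * (nilssonMonomial (puiseuxExponent N M q, l) n : ℂ)) (by simp)).trans ?_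
  simp only [ite_mul, zero_mul, ← Finset.sum_filter, hfilter]

theorem exists_logCoeff_grid_expansion (hN : N ≠ 0) (M j : ℕ) {k d : ℕ} (hk : k ≤ d) :
    ∃ ε : ℕ → ℕ → ℂ, (∀ q < j, ε q = 0) ∧
      ∀ Q : ℕ, (fun n => logCoeff ((j - M) / N) k n - gridSum N M d ε Q n) =O[atTop]
        nilssonMonomial (puiseuxExponent N M Q, d) := by
  obtain ⟨e, he⟩ := exists_logCoeff_expansion ((j - M) / N) k
  have hmonomial (i l n : ℕ) : Real.log n ^ l / (n : ℝ) ^ ((j - M) / N + 1 + i : ℝ) =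
      nilssonMonomial (puiseuxExponent N M (j + i * N), l) n := by
    rw [nilssonMonomial, puiseuxExponent_add_mul hN, puiseuxExponent]
    push_cast
    rfl
  simp only [hmonomial] at he
  refine ⟨Function.extend (fun i => j + i * N) (fun i l => if l ≤ k then e i l else 0) 0,
    fun q hq => Function.extend_apply' _ _ _ ?_, fun Q => ?_⟩
  · rintro ⟨i, rfl⟩
    exact absurd hq (Nat.le_add_right j _).not_gt
  · simp only [gridSum_extend hN hk]
    exact (he _).trans (isBigO_nilssonMonomial_of_le ((puiseuxExponent_strictMono hN M).monotone
      (not_lt.mp fun h => lt_irrefl _ ((lt_sub_ceilDiv_iff hN).mpr h))) hk)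

theorem isLittleO_sum_nilssonMonomial {U : Finset ℂ} (hU : ∀ u ∈ U, ‖u‖ = 1) (c : ℂ → ℂ)
    {ω ω' : ℚ × ℕ} (h : nilssonMonomial ω' =o[atTop] nilssonMonomial ω) :
    (fun n => (nilssonMonomial ω' n : ℂ) * ∑ u ∈ U, c u * u ^ n) =o[atTop]
      nilssonMonomial ω := by
  have hbdd : (fun n => ∑ u ∈ U, c u * u ^ n) =O[atTop] fun _ : ℕ => (1 : ℝ) := by
    refine IsBigO.of_bound (∑ u ∈ U, ‖c u‖) (.of_forall fun n => ?_)
    rw [norm_one, mul_one]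
    refine norm_sum_le_of_le _ fun u hu => ?_
    rw [norm_mul, norm_pow, hU u hu, one_pow, mul_one]
  have hcast : (fun n => (nilssonMonomial ω' n : ℂ)) =o[atTop] nilssonMonomial ω :=
    IsLittleO.of_norm_left (h.norm_left.congr_left fun n => (Complex.norm_real _).symm)
  simpa only [mul_one] using hcast.mul_isBigO hbdd

theorem HasGridExpansion.tendsto {M d : ℕ} {U : Finset ℂ} {C : ℂ → ℕ → ℕ → ℂ} {b : ℕ → ℂ}
    (hb : HasGridExpansion N M d U C b) (hN : N ≠ 0) (hU : ∀ u ∈ U, ‖u‖ = 1) (q β : ℕ) :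
    Tendsto (fun n => (b n - ∑ p ∈ Finset.range (q + 1) ×ˢ Finset.range (d + 1) with
      p.1 < q ∨ β ≤ p.2, (nilssonMonomial (puiseuxExponent N M p.1, p.2) n : ℂ) *
        ∑ u ∈ U, C u p.1 p.2 * u ^ n) / nilssonMonomial (puiseuxExponent N M q, β) n)
      atTop (𝓝 0) := by
  have hnext : (fun n => b n - ∑ u ∈ U, gridSum N M d (C u) (q + 1) n * u ^ n) =o[atTop]
      nilssonMonomial (puiseuxExponent N M q, β) :=
    (hb (q + 1)).trans_isLittleO (isLittleO_nilssonMonomial_of_exponent_lt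
      (puiseuxExponent_strictMono hN M q.lt_succ_self) _ _)
  have hrest : (fun n => ∑ p ∈ Finset.range (q + 1) ×ˢ Finset.range (d + 1) with
      ¬(p.1 < q ∨ β ≤ p.2), (nilssonMonomial (puiseuxExponent N M p.1, p.2) n : ℂ) *
        ∑ u ∈ U, C u p.1 p.2 * u ^ n) =o[atTop] nilssonMonomial (puiseuxExponent N M q, β) := by
    refine IsLittleO.fun_sum fun p hp => isLittleO_sum_nilssonMonomial hU _ ?_
    simp only [Finset.mem_filter, Finset.mem_product, Finset.mem_range, not_or] at hp
    rw [show p.1 = q by omega]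
    exact isLittleO_nilssonMonomial_of_log_lt _ (not_le.mp hp.2.2)
  have hcast := IsLittleO.of_norm_right ((hnext.add hrest).norm_right.congr_right
    fun n => (Complex.norm_real _).symm)
  refine (hcast.congr_left fun n => ?_).tendsto_div_nhds_zero
  rw [sum_gridSum_mul_pow, ← Finset.sum_filter_add_sum_filter_not _ fun p => p.1 < q ∨ β ≤ p.2]
  ring

theorem HasGridExpansion.hasNilssonExpansion {M d : ℕ} {U : Finset ℂ} {C : ℂ → ℕ → ℕ → ℂ}
    {b : ℕ → ℂ} (hb : HasGridExpansion N M d U C b) (hN : N ≠ 0) (hU : ∀ u ∈ U, ‖u‖ = 1)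
    (hC : ∃ u ∈ U, ∃ q, ∃ l ≤ d, C u q l ≠ 0) :
    HasNilssonExpansion b ((Finset.range N).image (puiseuxExponent N M)) d U 1
      fun ω u => C u ⌊(ω.1 - 1) * N + M⌋₊ ω.2 := by
  constructor
  · rintro ⟨α, β⟩ hω
    obtain ⟨q, rfl : α = _, -⟩ := (mem_nilssonIndex_image_puiseuxExponent_iff hN).mp hω
    refine (hb.tendsto hN hU q β).congr fun n => ?_
    simp only [sum_nilssonInitial_puiseuxExponent hN, floor_puiseuxExponent hN,
      Complex.ofReal_one, inv_one, one_pow, mul_one, mul_one_div]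
  · obtain ⟨u, hu, q, l, hl, hc⟩ := hC
    refine ⟨(puiseuxExponent N M q, l),
      (mem_nilssonIndex_image_puiseuxExponent_iff hN).mpr ⟨q, rfl, hl⟩, u, hu, ?_⟩
    simpa only [floor_puiseuxExponent hN] using hc

end Grid

theorem IsNilssonType.mul_geometric {b : ℕ → ℂ} (h : IsNilssonType b) {r : ℝ} (hr : 0 < r) :
    IsNilssonType fun n => b n * (r : ℂ) ^ n := by
  obtain ⟨S, d, Λ, t, c, ht, hΛ, hlim, ω, hω, μ, hμ, hc⟩ := h
  have hr0 : (r : ℂ) ≠ 0 := Complex.ofReal_ne_zero.mpr hr.ne'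
  classical
  refine ⟨S, d, Λ.image fun μ => r * μ, r * t, fun ω μ => c ω (μ / r), mul_pos hr ht, ?_, ?_,
    ω, hω, r * μ, Finset.mem_image_of_mem _ hμ, by simpa only [mul_div_cancel_left₀ _ hr0]⟩
  · intro μ hμ
    obtain ⟨ν, hν, rfl⟩ := Finset.mem_image.mp hμ
    rw [norm_mul, Complex.norm_real, Real.norm_of_nonneg hr.le, hΛ ν hν]
  · have hscale (x : ℂ) : r * x * ((r * t : ℝ) : ℂ)⁻¹ = x * (t : ℂ)⁻¹ := by
      rw [Complex.ofReal_mul, mul_inv, mul_mul_mul_comm, mul_inv_cancel₀ hr0, one_mul]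
    intro ω hω
    refine (hlim ω hω).congr fun n => ?_
    simp only [Finset.sum_image fun _ _ _ _ hxy => mul_left_cancel₀ hr0 hxy,
      mul_div_cancel_left₀ _ hr0, hscale]
    rw [mul_assoc (b n), ← mul_pow, ← mul_one (r : ℂ), hscale, one_mul]

/-! ### Nilsson type of coefficient sequences -/

section Transfer

variable {N M m : ℕ} {b : ℕ → ℂ}

theorem nilssonMonomial_natCast_zero (D n : ℕ) :
    nilssonMonomial ((D : ℚ), 0) n = ((n : ℝ) ^ D)⁻¹ := by
  rw [nilssonMonomial, pow_zero, one_div, Rat.cast_natCast, Real.rpow_natCast]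

theorem HasGridExpansion.isBigO_inv_pow_of_eq_zero {d : ℕ} {U : Finset ℂ} {C : ℂ → ℕ → ℕ → ℂ}
    (hb : HasGridExpansion N M d U C b) (hN : N ≠ 0) (hC : ∀ u ∈ U, ∀ q, ∀ l ≤ d, C u q l = 0)
    (D : ℕ) : b =O[atTop] fun n => ((n : ℝ) ^ D)⁻¹ := by
  have hzero (n : ℕ) : ∑ u ∈ U, gridSum N M d (C u) (D * N + M) n * u ^ n = 0 := by
    refine Finset.sum_eq_zero fun u hu => ?_
    rw [gridSum_congr (c' := 0) fun q _ l hl => hC u hu q l hl]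
    simp [gridSum]
  have hexponent : (D : ℚ) < puiseuxExponent N M (D * N + M) := by
    rw [puiseuxExponent]
    push_cast
    rw [add_sub_cancel_right, mul_div_cancel_right₀ _ (Nat.cast_ne_zero.mpr hN)]
    exact lt_add_one _
  simp only [← nilssonMonomial_natCast_zero]
  refine IsBigO.trans ?_ (isLittleO_nilssonMonomial_of_exponent_lt hexponent 0 d).isBigO
  simpa only [hzero, sub_zero] using hb (D * N + M)

theorem exists_singularCoeff_grid_expansion (hN : N ≠ 0) (M m : ℕ) (H : ℕ → ℂ → ℂ) :
    ∃ c : ℕ → ℕ → ℂ, ∀ ζ : ℂ, ‖ζ‖ = 1 → ∀ J Q : ℕ, Q ≤ J →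
      (fun n => singularCoeff N M m H J ζ n - gridSum N M m c Q n * ζ⁻¹ ^ n) =O[atTop]
        nilssonMonomial (puiseuxExponent N M Q, m) := by
  choose! ε hlt hε using fun j k (hk : k ≤ m) => exists_logCoeff_grid_expansion hN M j hk
  refine ⟨fun q l => ∑ k ∈ Finset.range m, ∑ j ∈ Finset.range (q + 1),
    taylorCoeff (H k) j * ε j k q l, fun ζ hζ J Q hQ => ?_⟩
  set P : Finset (ℕ × ℕ) := Finset.range m ×ˢ Finset.range J
  have htruncate : ∀ q < Q, ∀ l ≤ m, (∑ k ∈ Finset.range m, ∑ j ∈ Finset.range (q + 1),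
      taylorCoeff (H k) j * ε j k q l) =
        ∑ p ∈ P, taylorCoeff (H p.1) p.2 * ε p.2 p.1 q l := by
    intro q hq l _
    rw [Finset.sum_product]
    refine Finset.sum_congr rfl fun k hk => Finset.sum_subset
      (Finset.range_mono (hq.trans_le hQ)) fun j _ hj => ?_
    rw [hlt j k (Finset.mem_range.mp hk).le q (by simpa using hj), Pi.zero_apply, mul_zero]
  have hterm : (fun n => ∑ p ∈ P, taylorCoeff (H p.1) p.2 *
      ((logCoeff ((p.2 - M) / N) p.1 n - gridSum N M m (ε p.2 p.1) Q n) * ζ⁻¹ ^ n)) =O[atTop]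
        nilssonMonomial (puiseuxExponent N M Q, m) := by
    refine IsBigO.fun_sum fun p hp => IsBigO.const_mul_left (IsBigO.trans ?_
      (hε p.2 p.1 (Finset.mem_range.mp (Finset.mem_product.mp hp).1).le Q)) _
    exact IsBigO.of_bound 1 (.of_forall fun n => by simp [hζ])
  refine hterm.congr_left fun n => ?_
  rw [gridSum_congr htruncate, gridSum_sum_mul, singularCoeff, ← Finset.sum_product',
    Finset.sum_mul, ← Finset.sum_sub_distrib]
  exact Finset.sum_congr rfl fun p _ => by ring

theorem exists_lt_sub_div (hN : N ≠ 0) (M D Q : ℕ) : ∃ J ≥ Q, (D : ℝ) < (J - M) / N := by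
  refine ⟨D * N + M + 1 + Q, Nat.le_add_left _ _, ?_⟩
  rw [lt_div_iff₀ (Nat.cast_pos.mpr (Nat.pos_of_ne_zero hN))]
  push_cast
  linarith [(Nat.cast_nonneg Q : (0 : ℝ) ≤ Q)]

variable {g : ℂ → ℂ} {Z : Finset ℂ} {H : ℂ → ℕ → ℂ → ℂ}

theorem HasPuiseuxLogSingularities.exists_hasGridExpansion
    (h : HasPuiseuxLogSingularities N M m Z H g)
    (hg : ∀ z ∈ Metric.ball (0 : ℂ) 1, HasSum (fun n => b n * z ^ n) (g z)) :
    ∃ C : ℂ → ℕ → ℕ → ℂ, HasGridExpansion N M m (Z.image fun ζ => ζ⁻¹) C b := by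
  choose c hc using fun ζ => exists_singularCoeff_grid_expansion h.ne_zero M m (H ζ)
  refine ⟨fun u => c u⁻¹, fun Q => ?_⟩
  obtain ⟨D, hD⟩ := exists_nat_ge (puiseuxExponent N M Q)
  obtain ⟨J, hJQ, hJ⟩ := exists_lt_sub_div h.ne_zero M D Q
  have hsingular : (fun n => b n + ∑ ζ ∈ Z, -singularCoeff N M m (H ζ) J ζ n) =O[atTop]
      nilssonMonomial (puiseuxExponent N M Q, m) := by
    refine (h.isBigO_sub_singularCoeff hg hJ).trans ?_
    exact (isBigO_nilssonMonomial_of_le hD (Nat.zero_le m)).congr_left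
      (nilssonMonomial_natCast_zero D)
  have hgrid : (fun n => ∑ ζ ∈ Z, (singularCoeff N M m (H ζ) J ζ n -
      gridSum N M m (c ζ) Q n * ζ⁻¹ ^ n)) =O[atTop]
        nilssonMonomial (puiseuxExponent N M Q, m) :=
    IsBigO.fun_sum fun ζ hζ => hc ζ ζ (h.norm_eq_one ζ hζ) J Q hJQ
  refine (hsingular.add hgrid).congr_left fun n => ?_
  simp only [Finset.sum_image fun _ _ _ _ h => inv_injective h, inv_inv, Finset.sum_neg_distrib,
    Finset.sum_sub_distrib]
  ring

theorem HasPuiseuxLogSingularities.isNilssonType (h : HasPuiseuxLogSingularities N M m Z H g)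
    (hg : ∀ z ∈ Metric.ball (0 : ℂ) 1, HasSum (fun n => b n * z ^ n) (g z))
    (hb : ∀ r : ℝ, 1 < r → ¬ Summable fun n => b n * (r : ℂ) ^ n) : IsNilssonType b := by
  obtain ⟨C, hC⟩ := h.exists_hasGridExpansion hg
  have hnorm : ∀ u ∈ Z.image fun ζ => ζ⁻¹, ‖u‖ = 1 := by
    intro u hu
    obtain ⟨ζ, hζ, rfl⟩ := Finset.mem_image.mp hu
    rw [norm_inv, h.norm_eq_one ζ hζ, inv_one]
  refine ⟨_, m, Z.image fun ζ => ζ⁻¹, 1, _, one_pos, hnorm,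
    hC.hasNilssonExpansion h.ne_zero hnorm ?_⟩
  by_contra! hzero
  obtain ⟨r, hr, hsum⟩ := h.exists_summable_of_isBigO hg
    (hC.isBigO_inv_pow_of_eq_zero h.ne_zero hzero)
  exact hb r hr hsum

end Transfer

section Rescaling

theorem radius_ofScalars_ne_top {a : ℕ → ℂ}
    (hlim : 0 < limsup (fun n : ℕ => ‖a n‖ₑ ^ (1 / (n : ℝ))) atTop) :
    (FormalMultilinearSeries.ofScalars ℂ a).radius ≠ ⊤ := by
  intro htop
  have hinv := (FormalMultilinearSeries.ofScalars ℂ a).radius_inv_eq_limsup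
  rw [htop, ENNReal.inv_top] at hinv
  refine (hinv ▸ hlim).ne' (limsup_congr (.of_forall fun n => ?_))
  rw [ENNReal.coe_rpow_of_nonneg _ (by positivity), ← enorm_eq_nnnorm, ← ofReal_norm,
    ← ofReal_norm, FormalMultilinearSeries.norm_apply_eq_norm_coef,
    FormalMultilinearSeries.coeff_ofScalars]

theorem exists_hasSum_on_maximal_ball {a : ℕ → ℂ} {G : ℂ → ℂ} {ρ : ℝ} (hρ : 0 < ρ)
    (hG : ∀ z ∈ Metric.ball (0 : ℂ) ρ, HasSum (fun n : ℕ => a n * z ^ n) (G z))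
    (hlim : 0 < limsup (fun n : ℕ => ‖a n‖ₑ ^ (1 / (n : ℝ))) atTop) :
    ∃ (R : ℝ) (g : ℂ → ℂ), ρ ≤ R ∧
      (∀ z ∈ Metric.ball (0 : ℂ) R, HasSum (fun n : ℕ => a n * z ^ n) (g z)) ∧
      ∀ r : ℝ, R < r → ¬ Summable fun n => a n * (r : ℂ) ^ n := by
  set p := FormalMultilinearSeries.ofScalars ℂ a with hp
  have hfinite : p.radius ≠ ⊤ := radius_ofScalars_ne_top hlim
  have hρR : ENNReal.ofReal ρ ≤ p.radius := (hasFPowerSeriesOnBall_of_hasSum hρ hG).r_le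
  refine ⟨p.radius.toReal, p.sum, (ENNReal.ofReal_le_iff_le_toReal hfinite).mp hρR,
    fun z hz => ?_, fun r hr hsum => ?_⟩
  · rw [← Metric.eball_ofReal, ENNReal.ofReal_toReal hfinite] at hz
    refine (p.hasSum hz).congr_fun fun n => ?_
    rw [hp, FormalMultilinearSeries.ofScalars_apply_eq, smul_eq_mul]
  · lift r to NNReal using ENNReal.toReal_nonneg.trans hr.le
    exact hr.not_ge (ENNReal.toReal_mono hfinite (le_radius_ofScalars_of_summable hsum))

theorem tendsto_mul_nhdsWithin_ball {R : ℝ} (hR : 0 < R) (p : ℂ) :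
    Tendsto (fun z : ℂ => R * z) (𝓝[Metric.ball 0 1] p) (𝓝[Metric.ball 0 R] (R * p)) := by
  refine (continuous_const_mul (R : ℂ)).continuousWithinAt.tendsto_nhdsWithin fun z hz => ?_
  rw [mem_ball_zero_iff] at hz ⊢
  rw [norm_mul, Complex.norm_real, Real.norm_of_nonneg hR.le]
  exact mul_lt_of_lt_one_right hR hz

theorem exists_isolating_radius (Λ : Finset ℂ) (p : ℂ) :
    ∃ δ > 0, ∀ q ∈ Λ, q ∈ Metric.ball p δ → q = p := by
  obtain ⟨δ, hδ, hball⟩ := Metric.isOpen_iff.mp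
    ((Λ.erase p).finite_toSet.isClosed.isOpen_compl) p (by simp)
  refine ⟨δ, hδ, fun q hq hqp => ?_⟩
  by_contra hne
  exact hball hqp (Finset.mem_coe.mpr (Finset.mem_erase.mpr ⟨hne, hq⟩))

variable {G g : ℂ → ℂ} {Λ : Finset ℂ} {ρ R : ℝ}

theorem exists_local_puiseux_log_expansion (hρ : 0 < ρ) (hρR : ρ ≤ R)
    (hg : AnalyticOnNhd ℂ g (Metric.ball 0 R)) (hGg : Set.EqOn G g (Metric.ball 0 ρ))
    (hext : ExtendsMultivalued Λ ρ G) (hmon : HasQuasiUnipotentLocalMonodromy Λ ρ G)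
    {ζ : ℂ} (hζ : ‖ζ‖ = 1) (hζΛ : R * ζ ∈ Λ) :
    ∃ N₀ m₀ : ℕ, N₀ ≠ 0 ∧ ∀ N, N ≠ 0 → N₀ ∣ N → ∀ m ≥ m₀, ∃ M₀ : ℕ, ∀ M ≥ M₀,
      ∃ H : ℕ → ℂ → ℂ, (∀ k, AnalyticAt ℂ (H k) 0) ∧ (fun z => g (R * z))
        =ᶠ[𝓝[Metric.ball 0 1] ζ] fun z => puiseuxLog N M m H (Complex.log (1 - z / ζ)) := by
  have hR : 0 < R := hρ.trans_le hρR
  have hζ0 : ζ ≠ 0 := norm_pos_iff.mp (hζ ▸ one_pos)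
  have hp : ‖(R : ℂ) * ζ‖ = R := by
    rw [norm_mul, hζ, mul_one, Complex.norm_real, Real.norm_of_nonneg hR.le]
  obtain ⟨δ, hδ, hδΛ⟩ := exists_isolating_radius Λ (R * ζ)
  obtain ⟨F, hF, hgF⟩ := exists_isLocalBranch hρ hρR hg hGg hext hp hδ hδΛ
  obtain ⟨hqu, hmg⟩ := hmon _ hζΛ δ hδ hδΛ F hF
  obtain ⟨N₀, m₀, hN₀, hN⟩ :=
    exists_puiseux_log_expansion (Complex.log (-(R * ζ))) hF.1 hqu hmg
  refine ⟨N₀, m₀, hN₀, fun N hN0 hdvd m hm => ?_⟩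
  obtain ⟨M₀, hM⟩ := hN N hN0 hdvd m hm
  refine ⟨M₀, fun M hM₀ => ?_⟩
  obtain ⟨H, hH, hFH⟩ := hM M hM₀
  refine ⟨H, hH, ?_⟩
  have hmul := tendsto_mul_nhdsWithin_ball hR ζ
  have hlog := tendsto_log_one_sub_div hζ0
  rw [hζ] at hlog
  filter_upwards [hmul.eventually self_mem_nhdsWithin,
    hmul.eventually (mem_nhdsWithin_of_mem_nhds (Metric.ball_mem_nhds _ hδ)),
    (tendsto_comap.comp hlog).eventually (eventually_lt_atBot _)] with z hzR hzδ hz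
  rw [hgF ⟨hzR, hzδ⟩, Function.comp_apply, diskLog,
    mul_div_mul_left _ _ (Complex.ofReal_ne_zero.mpr hR.ne'), hFH _ hz]

theorem exists_uniform_puiseux_parameters {ι : Type*} (Z : Finset ι) {P : ι → ℕ → ℕ → ℕ → Prop}
    (hP : ∀ ζ ∈ Z, ∃ N₀ m₀ : ℕ, N₀ ≠ 0 ∧ ∀ N, N ≠ 0 → N₀ ∣ N → ∀ m ≥ m₀, ∃ M₀ : ℕ,
      ∀ M ≥ M₀, P ζ N M m) :
    ∃ N M m : ℕ, N ≠ 0 ∧ ∀ ζ ∈ Z, P ζ N M m := by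
  choose! N₀ m₀ hN₀ hP using hP
  have hN : ∏ ζ ∈ Z, N₀ ζ ≠ 0 := Finset.prod_ne_zero_iff.mpr hN₀
  choose! M₀ hM₀ using fun ζ hζ => hP ζ hζ _ hN (Finset.dvd_prod_of_mem N₀ hζ) (Z.sup m₀)
    (Finset.le_sup hζ)
  exact ⟨_, Z.sup M₀, _, hN, fun ζ hζ => hM₀ ζ hζ _ (Finset.le_sup hζ)⟩

theorem exists_hasPuiseuxLogSingularities (hρ : 0 < ρ) (hρR : ρ ≤ R)
    (hg : AnalyticOnNhd ℂ g (Metric.ball 0 R)) (hGg : Set.EqOn G g (Metric.ball 0 ρ))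
    (hext : ExtendsMultivalued Λ ρ G) (hmon : HasQuasiUnipotentLocalMonodromy Λ ρ G) :
    ∃ (N M m : ℕ) (Z : Finset ℂ) (H : ℂ → ℕ → ℂ → ℂ),
      HasPuiseuxLogSingularities N M m Z H fun z => g (R * z) := by
  classical
  have hR : 0 < R := hρ.trans_le hρR
  have hRC : (R : ℂ) ≠ 0 := Complex.ofReal_ne_zero.mpr hR.ne'
  set Z : Finset ℂ := {ζ ∈ Λ.image fun p => p / R | ‖ζ‖ = 1}
  have hZ (ζ : ℂ) : ζ ∈ Z ↔ R * ζ ∈ Λ ∧ ‖ζ‖ = 1 := by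
    simp only [Z, Finset.mem_filter, Finset.mem_image, div_eq_iff hRC, mul_comm ζ,
      exists_eq_right]
  obtain ⟨N, M, m, hN, hexpansion⟩ := exists_uniform_puiseux_parameters Z fun ζ hζ =>
    exists_local_puiseux_log_expansion hρ hρR hg hGg hext hmon ((hZ ζ).mp hζ).2 ((hZ ζ).mp hζ).1
  choose! H hH hgH using hexpansion
  refine ⟨N, M, m, Z, H, hN, fun ζ hζ => ((hZ ζ).mp hζ).2, hH, fun p hp hpZ => ?_, hgH⟩
  have hp1 := mem_sphere_zero_iff_norm.mp hp
  have hpR : ‖(R : ℂ) * p‖ = R := by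
    rw [norm_mul, hp1, mul_one, Complex.norm_real, Real.norm_of_nonneg hR.le]
  obtain ⟨h, hh, hgh⟩ := exists_analyticAt_of_notMem hρ hρR hg hGg hext hpR
    fun hpΛ => hpZ ((hZ p).mpr ⟨hpΛ, hp1⟩)
  exact ⟨fun z => h (R * z), hh.fun_comp (analyticAt_const.mul analyticAt_id),
    (tendsto_mul_nhdsWithin_ball hR p).eventually hgh⟩

theorem hasSum_mul_pow_mul_pow {a : ℕ → ℂ} (hR : 0 < R)
    (hg : ∀ z ∈ Metric.ball (0 : ℂ) R, HasSum (fun n => a n * z ^ n) (g z)) {z : ℂ}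
    (hz : z ∈ Metric.ball (0 : ℂ) 1) :
    HasSum (fun n => a n * (R : ℂ) ^ n * z ^ n) (g (R * z)) := by
  have hRz : (R : ℂ) * z ∈ Metric.ball (0 : ℂ) R := by
    rw [mem_ball_zero_iff] at hz ⊢
    rw [norm_mul, Complex.norm_real, Real.norm_of_nonneg hR.le]
    exact mul_lt_of_lt_one_right hR hz
  simpa only [mul_pow, mul_assoc] using hg _ hRz

end Rescaling

theorem corollary4p2 (a : ℕ → ℂ) (G : ℂ → ℂ) (Λ : Finset ℂ) (ρ : ℝ) (hρ : 0 < ρ)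
    (hG : ∀ z ∈ Metric.ball (0 : ℂ) ρ, HasSum (fun n : ℕ => a n * z ^ n) (G z))
    (hext : ExtendsMultivalued Λ ρ G)
    (hmon : HasQuasiUnipotentLocalMonodromy Λ ρ G)
    (hlim : 0 < limsup (fun n : ℕ => ‖a n‖ₑ ^ (1 / (n : ℝ))) atTop) :
    IsNilssonType a := by
  obtain ⟨R, g, hρR, hg, hR⟩ := exists_hasSum_on_maximal_ball hρ hG hlim
  have hR0 : 0 < R := hρ.trans_le hρR
  have hRC : (R : ℂ) ≠ 0 := Complex.ofReal_ne_zero.mpr hR0.ne'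
  have hGg : Set.EqOn G g (Metric.ball 0 ρ) := fun z hz =>
    (hG z hz).unique (hg z (Metric.ball_subset_ball hρR hz))
  obtain ⟨N, M, m, Z, H, hsingular⟩ :=
    exists_hasPuiseuxLogSingularities hρ hρR (analyticOnNhd_of_hasSum hR0 hg) hGg hext hmon
  have hrescaled : IsNilssonType fun n => a n * (R : ℂ) ^ n := by
    refine hsingular.isNilssonType (fun z hz => hasSum_mul_pow_mul_pow hR0 hg hz)
      fun r hr hsum => hR (R * r) (lt_mul_of_one_lt_right hR0 hr) ?_
    simpa only [Complex.ofReal_mul, mul_pow, mul_assoc] using hsum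
  have hunscaled := hrescaled.mul_geometric (inv_pos.mpr hR0)
  simpa only [Complex.ofReal_inv, mul_assoc, ← mul_pow, mul_inv_cancel₀ hRC, one_pow,
    mul_one] using hunscaled
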